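/- Let $k>0$ and $\mu\in\mathbb{R}$. A bounded Keplerian trajectory is described by Delaunay's elements $E=(L,G,Z,g,z)$ with $0<G<L$, $|Z|<G$, where $L=k\sqrt a$, $G=k\sqrt{a(1-e^2)}$, $Z=G\cos I$, $g=\omega$, $z=\Omega$, and $(a,e,I,\omega,\Omega)$ are the semimajor axis, eccentricity, inclination, argument of perihelion and longitude of the node; $\mathcal X(E,\ell)\in\mathbb{R}^3$ is the position on it at mean anomaly $\ell$. For a two-orbit configuration $\mathcal E=(E,E')\in\mathbb{R}^{10}$ and $V=(\ell,\ell')\in\mathbb{T}^2=[-\pi,\pi]^2$ (opposite sides identified) put $\mathcal X=\mathcal X(E,\ell)$, $\mathcal X'=\mathcal X(E',\ell')$, $\Delta=\mathcal X-\mathcal X'$, $d(\mathcal E,V)=|\Delta|$ and \[ R=\mu k^2\Bigl(\frac1{|\mathcal X-\mathcal X'|}-\frac{\mathcal X\cdot\mathcal X'}{|\mathcal X'|^3}\Bigr),\qquad \overline{\frac{\partial R}{\partial y_j}}=\frac1{(2\pi)^2}\int_{\mathbb{T}^2}\frac{\partial R}{\partial y_j}\,d\ell\,d\ell', \] where $y_1,\dots,y_4$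 are the components of $Y=(G,Z,g,z)$, the elements of the first orbit other than $L$. Let $\mathcal E_c$ be a configuration with exactly one $V_c\in\mathbb{T}^2$ such that $d(\mathcal E_c,V_c)=0$ (a single crossing point), and suppose that $\mathcal E_c$ is non-degenerate: every critical point of $V\mapsto d^2(\mathcal E_c,V)$ has non-singular Hessian matrix. Then there are a connected open neighbourhood $\mathcal W$ of $\mathcal E_c$ in the set of two-orbit configurations, and a continuous map $\mathcal E\mapsto V_h(\mathcal E)=(\ell_h,\ell_h')$ on $\mathcal W$ with $V_h(\mathcal E_c)=V_c$, such that for every $\mathcal E\in\mathcal W$ the point $V_h(\mathcal E)$ is a local minimum point of $V\mapsto d^2(\mathcal E,V)$, $\det\mathcal A_h(\mathcal E)>0$ and $\tau_3^{(h)}(\mathcal E)\neq0$, where \[ \mathcal A_h=\frac12\frac{\partial^2 d^2}{\partial V^2}(\mathcal E,V_h(\mathcal E)),\qquad \tau_3^{(h)}=\frac{\partial\mathcal X}{\partial\ell}(E,\ell_h)\times\frac{\partial\mathcal X'}{\partial\ell'}(E',\ell_h'). \] Let $\hat\tau_3^{(h)}=\tau_3^{(h)}/|\tau_3^{(h)}|$,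 $\Delta_h=\Delta(\mathcal E,V_h)$, and let $\tilde d_h=\bigl(\hat\tau_3^{(h)}\cdot\Delta_h/|\Delta_h|\bigr)\,d(\mathcal E,V_h)$ be the signed distance (with $\tilde d_h=0$ if $\Delta_h=0$); let $\mathcal W^+=\mathcal W\cap\{\tilde d_h>0\}$ and $\mathcal W^-=\mathcal W\cap\{\tilde d_h<0\}$. Then for each $j=1,\dots,4$ the derivatives $\partial_{y_j}(1/\sqrt{\det\mathcal A_h})$ and $\partial_{y_j}\tilde d_h$ exist on $\mathcal W$, with \[ \frac{\partial\tilde d_h}{\partial y_j}=\hat\tau_3^{(h)}\cdot\frac{\partial\Delta}{\partial y_j}(\mathcal E,V_h), \] and there are two Lipschitz-continuous maps $\bigl(\overline{\partial R/\partial y_j}\bigr)_h^{\pm}:\mathcal W\to\mathbb{R}$ such that on $\mathcal W^+$ (resp. $\mathcal W^-$) the average $\overline{\partial R/\partial y_j}$ exists and equals $\bigl(\overline{\partial R/\partial y_j}\bigr)_h^{+}$ (resp. $\bigl(\overline{\partial R/\partial y_j}\bigr)_h^{-}$), and on all of $\mathcal W$ \[ \Bigl(\overline{\frac{\partial R}{\partial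 y_j}}\Bigr)_h^- -\Bigl(\overline{\frac{\partial R}{\partial y_j}}\Bigr)_h^+=\frac{\mu k^2}{\pi}\Bigl[\frac{\partial}{\partial y_j}\Bigl(\frac1{\sqrt{\det\mathcal A_h}}\Bigr)\tilde d_h+\frac1{\sqrt{\det\mathcal A_h}}\,\frac{\partial\tilde d_h}{\partial y_j}\Bigr]. \] -/

import Mathlib

/-- Delaunay elements of a bounded Keplerian trajectory, without the mean anomaly:
the components `0, 1, 2, 3, 4` are `L, G, Z, g, z`. -/
abbrev OrbitElements : Type := Fin 5 → ℝ

/-- A two-orbit configuration `(E, E')`: the asteroid and the planet. -/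
abbrev TwoOrbit : Type := OrbitElements × OrbitElements

/-- A pair of mean anomalies `V = (ℓ, ℓ')`. Functions on the torus are treated as functions on `ℝ²`
that are `2π`-periodic in each variable. -/
abbrev Anomalies : Type := Fin 2 → ℝ

/-- The space of Cartesian coordinates. -/
abbrev Space : Type := EuclideanSpace ℝ (Fin 3)

namespace Delaunay

/-- The open set where Delaunay elements are regular coordinates: `0 < G < L` and `|Z| < G`,
that is eccentricity `0 < e < 1` and inclination `0 < I < π`. -/
def domain : Set OrbitElements := {x | 0 < x 1 ∧ x 1 < x 0 ∧ |x 2| < x 1}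

/-- The semimajor axis `a`, from `L = k √a`. -/
noncomputable def semimajorAxis (k : ℝ) (x : OrbitElements) : ℝ := (x 0 / k) ^ 2

/-- The eccentricity `e`, from `G = k √(a (1 - e²)) = L √(1 - e²)`. -/
noncomputable def ecc (x : OrbitElements) : ℝ := Real.sqrt (1 - (x 1 / x 0) ^ 2)

/-- `cos I`, from `Z = G cos I`. -/
noncomputable def cosIncl (x : OrbitElements) : ℝ := x 2 / x 1

/-- `sin I`, for the inclination `I` between `0` and `π`. -/
noncomputable def sinIncl (x : OrbitElements) : ℝ := Real.sqrt (1 - cosIncl x ^ 2)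

/-- The eccentric anomaly: the solution `u` of the Kepler equation `u - e sin u = ℓ`. -/
noncomputable def eccAnomaly (e l : ℝ) : ℝ := Function.invFun (fun u : ℝ => u - e * Real.sin u) l

/-- For `0 ≤ e < 1` the Kepler equation has exactly one solution, namely `eccAnomaly e l`. -/
theorem eccAnomaly_spec {e : ℝ} (h0 : 0 ≤ e) (h1 : e < 1) (l u : ℝ) :
    u - e * Real.sin u = l ↔ u = eccAnomaly e l := by
  have hsurj : ∃ v : ℝ, v - e * Real.sin v = l := by
    have hc : Continuous fun v : ℝ => v - e * Real.sin v := by fun_prop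
    have hb : ∀ v : ℝ, |e * Real.sin v| ≤ 1 := fun v => by
      rw [abs_mul, abs_of_nonneg h0]
      nlinarith [Real.abs_sin_le_one v, abs_nonneg (Real.sin v)]
    have := intermediate_value_Icc (by linarith : l - 1 ≤ l + 1) hc.continuousOn
    obtain ⟨v, -, hv⟩ := this (show l ∈ _ from
      ⟨by have := (abs_le.1 (hb (l - 1))).1; linarith,
       by have := (abs_le.1 (hb (l + 1))).2; linarith⟩)
    exact ⟨v, hv⟩
  have hinj : ∀ v w : ℝ, v - e * Real.sin v = w - e * Real.sin w → v = w := by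
    intro v w h
    have h2 : |Real.sin v - Real.sin w| ≤ |v - w| := by
      rw [Real.sin_sub_sin, abs_mul, abs_mul]
      have e1 := Real.abs_sin_le_abs (x := (v - w) / 2)
      have e2 := Real.abs_cos_le_one ((v + w) / 2)
      rw [abs_div, abs_of_pos (by norm_num : (0 : ℝ) < 2)] at *
      nlinarith [abs_nonneg (Real.sin ((v - w) / 2)), abs_nonneg (v - w)]
    have h3 : |v - w| = e * |Real.sin v - Real.sin w| := by
      have h4 : v - w = e * (Real.sin v - Real.sin w) := by linarith
      rw [h4, abs_mul, abs_of_nonneg h0]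
    have : |v - w| = 0 := by nlinarith [abs_nonneg (v - w)]
    exact sub_eq_zero.1 (abs_eq_zero.1 this)
  have hs : eccAnomaly e l - e * Real.sin (eccAnomaly e l) = l :=
    Function.invFun_eq (f := fun v : ℝ => v - e * Real.sin v) hsurj
  exact ⟨fun h => hinj _ _ (h.trans hs.symm), fun h => h ▸ hs⟩

/-- The heliocentric position `𝒳(E, ℓ)` on the trajectory with Delaunay elements `x` at mean
anomaly `l`: the perifocal position `(p, q, 0) = (a (cos u - e), a √(1 - e²) sin u, 0)` is rotated
by the argument of perihelion `g`, the inclination `I` and the longitude of the node `z`. -/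
noncomputable def position (k : ℝ) (x : OrbitElements) (l : ℝ) : Space :=
  let u : ℝ := eccAnomaly (ecc x) l
  let p : ℝ := semimajorAxis k x * (Real.cos u - ecc x)
  let q : ℝ := semimajorAxis k x * Real.sqrt (1 - ecc x ^ 2) * Real.sin u
  let g : ℝ := x 3
  let z : ℝ := x 4
  !₂[(Real.cos z * Real.cos g - Real.sin z * Real.sin g * cosIncl x) * p
      + (-(Real.cos z * Real.sin g) - Real.sin z * Real.cos g * cosIncl x) * q,
    (Real.sin z * Real.cos g + Real.cos z * Real.sin g * cosIncl x) * p
      + (-(Real.sin z * Real.sin g) + Real.cos z * Real.cos g * cosIncl x) * q,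
    Real.sin g * sinIncl x * p + Real.cos g * sinIncl x * q]

end Delaunay

namespace TwoOrbit

/-- The pairs of trajectories described by regular Delaunay elements. -/
def domain : Set TwoOrbit := Delaunay.domain ×ˢ Delaunay.domain

/-- `Δ(ℰ, V) = 𝒳 - 𝒳'`. -/
noncomputable def delta (k : ℝ) (E : TwoOrbit) (V : Anomalies) : Space :=
  Delaunay.position k E.1 (V 0) - Delaunay.position k E.2 (V 1)

/-- The Keplerian distance function `d(ℰ, V) = |𝒳 - 𝒳'|`. -/
noncomputable def dist (k : ℝ) (E : TwoOrbit) (V : Anomalies) : ℝ := ‖delta k E V‖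

/-- The partial derivative of a function of `V = (ℓ, ℓ')` with respect to its `i`-th variable. -/
noncomputable def partialV (i : Fin 2) (f : Anomalies → ℝ) (V : Anomalies) : ℝ :=
  deriv (fun s : ℝ => f (Function.update V i s)) (V i)

/-- `V` is a critical point of `V ↦ d²(ℰ, V)`. -/
def IsCritical (k : ℝ) (E : TwoOrbit) (V : Anomalies) : Prop :=
  ∀ i : Fin 2, partialV i (fun U => dist k E U ^ 2) V = 0

/-- The Hessian matrix of `V ↦ d²(ℰ, V)` at `V`. -/
noncomputable def hessian (k : ℝ) (E : TwoOrbit) (V : Anomalies) : Matrix (Fin 2) (Fin 2) ℝ :=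
  Matrix.of fun i j => partialV i (partialV j (fun U => dist k E U ^ 2)) V

/-- All the critical points of `V ↦ d²(ℰ, V)` are non-degenerate. -/
def NonDegenerate (k : ℝ) (E : TwoOrbit) : Prop :=
  ∀ V : Anomalies, IsCritical k E V → (hessian k E V).det ≠ 0

/-- `V` is the only point of the torus (up to multiples of `2π`) where the Keplerian distance
vanishes: the two trajectories cross at exactly one point. -/
def IsUniqueCrossing (k : ℝ) (E : TwoOrbit) (V : Anomalies) : Prop :=
  dist k E V = 0 ∧
    ∀ U : Anomalies, dist k E U = 0 → ∃ n : Fin 2 → ℤ, ∀ i, U i = V i + 2 * Real.pi * n i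

/-- `𝒜 = (1/2) ∂²d²/∂V²`, at `(ℰ, V)`. -/
noncomputable def matA (k : ℝ) (E : TwoOrbit) (V : Anomalies) : Matrix (Fin 2) (Fin 2) ℝ :=
  (1 / 2 : ℝ) • hessian k E V

/-- `τ₃ = ∂𝒳/∂ℓ × ∂𝒳'/∂ℓ'`, at `(ℰ, V)`. -/
noncomputable def tau3 (k : ℝ) (E : TwoOrbit) (V : Anomalies) : Space :=
  WithLp.toLp 2 (crossProduct
    (WithLp.ofLp (deriv (Delaunay.position k E.1) (V 0)))
    (WithLp.ofLp (deriv (Delaunay.position k E.2) (V 1))))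

/-- The unit vector of `τ₃`. -/
noncomputable def tau3Hat (k : ℝ) (E : TwoOrbit) (V : Anomalies) : Space :=
  ‖tau3 k E V‖⁻¹ • tau3 k E V

/-- The unit vector of `Δ`, with value `0` where `Δ = 0`. -/
noncomputable def deltaHat (k : ℝ) (E : TwoOrbit) (V : Anomalies) : Space :=
  ‖delta k E V‖⁻¹ • delta k E V

/-- The distance with sign `(τ̂₃ · Δ̂) d`, at `(ℰ, V)`; it is `0` where `d = 0`. -/
noncomputable def signedDist (k : ℝ) (E : TwoOrbit) (V : Anomalies) : ℝ :=
  inner ℝ (tau3Hat k E V) (deltaHat k E V) * dist k E V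

/-- The configuration obtained from `E` by giving the value `s` to the component `y_j` of
`Y = (G, Z, g, z)` of the asteroid. -/
def setY (j : Fin 4) (E : TwoOrbit) (s : ℝ) : TwoOrbit := (Function.update E.1 j.succ s, E.2)

/-- The value of `y_j`, where `Y = (G, Z, g, z)`. -/
def getY (j : Fin 4) (E : TwoOrbit) : ℝ := E.1 j.succ

/-- `∂f/∂y_j`, where `Y = (G, Z, g, z)`. -/
noncomputable def partialY {F : Type} [NormedAddCommGroup F] [NormedSpace ℝ F]
    (j : Fin 4) (f : TwoOrbit → F) (E : TwoOrbit) : F :=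
  deriv (fun s : ℝ => f (setY j E s)) (getY j E)

/-- The perturbing function `R = μ k² (1 / |𝒳 - 𝒳'| - 𝒳 · 𝒳' / |𝒳'|³)`. -/
noncomputable def perturbing (k μ : ℝ) (E : TwoOrbit) (V : Anomalies) : ℝ :=
  μ * k ^ 2 * (1 / dist k E V
    - inner ℝ (Delaunay.position k E.1 (V 0)) (Delaunay.position k E.2 (V 1))
      / ‖Delaunay.position k E.2 (V 1)‖ ^ 3)

/-- The torus `-π ≤ ℓ ≤ π`, `-π ≤ ℓ' ≤ π`. -/
def torus : Set Anomalies := Set.Icc (fun _ => -Real.pi) (fun _ => Real.pi)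

/-- The average over the torus of `∂R/∂y_j` exists at `E` in the ordinary sense and is `c`. -/
def HasAverage (k μ : ℝ) (j : Fin 4) (E : TwoOrbit) (c : ℝ) : Prop :=
  (∀ V : Anomalies,
    DifferentiableAt ℝ (fun s : ℝ => perturbing k μ (setY j E s) V) (getY j E)) ∧
  MeasureTheory.IntegrableOn (fun V => partialY j (fun E₁ => perturbing k μ E₁ V) E) torus ∧
  c = 1 / (2 * Real.pi) ^ 2 * ∫ V in torus, partialY j (fun E₁ => perturbing k μ E₁ V) E

end TwoOrbit

/-!
The singularity of `1/d` at a crossing is isolated by the following argument.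

*Centred coordinates.* At a non-degenerate crossing point the Hessian of `d²` is positive definite,
so the implicit function theorem continues the point to an analytic branch `Vh` of critical points,
and compactness of the torus makes `Vh` a global minimum point with uniform constants on a small
closed ball of configurations (`exists_singularFamily`). Along the branch `Δ` is orthogonal to both
tangent vectors, hence `Δ = D τ̂₃` with the signed distance `D`; therefore `d² = D²` at `Vh`, and
`D` is analytic although `d` is not (`TwoOrbit.hasFDerivAt_signedDist`). With
`P (ℰ, v) = d² (ℰ, Vh ℰ + v)` one has `P (ℰ, v) = D² + Q (ℰ, v)`, where `Q` vanishes to second order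
at `v = 0` and is bounded below by a multiple of `|v|²`. Since the integral of a derivative over the
torus is zero, the average of the derivative of `1/d` at fixed mean anomalies is the average of the
derivative of `P ^ (-1/2)` at fixed `v` (`TwoOrbit.integral_fderiv_invDist`), that is, of
`-(D D' + Q₁ / 2) (D² + Q) ^ (-3/2)`, where the prime denotes the derivative in the chosen direction
and `Q₁` is that derivative of `Q`.

*Regularity.* `Q₁` vanishes to second order, so the term with `Q₁` is Lipschitz in the configuration
and in `|D|` by direct estimates. In the term with `D D'`, the function `Q` is compared with its
quadratic part `q₀`, and the square `|v| ≤ π` with the whole plane, where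
`c ∫ (c² + q₀) ^ (-3/2) = 2π / √(det 𝒜)` for every `c > 0` (`integral_invCube_quadratic`). The
error of this comparison could diverge logarithmically as `c → 0`, but the cubic part of `Q`, which
is responsible for it, is odd in `v` and cancels (`SingularFamily.defect_bounded`). So the
only discontinuity of the average is that of `-2π sgn(D) D' / √(det 𝒜)`, and the remainder is
Lipschitz off `D = 0` (`SingularFamily.lipOn_regular_part`), also between points where the signs of
`D` are opposite.

*Jump.* The function `2π |D| (1 / √(det 𝒜))'` is Lipschitz. Adding it shows that the averaged
derivative of `1/d` plus `2π sgn(D) (D / √(det 𝒜))'` is Lipschitz off `D = 0`; it extends to a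
Lipschitz function `Φ`. The averaged derivative is `Φ - 2π (D / √(det 𝒜))'` where `D > 0` and
`Φ + 2π (D / √(det 𝒜))'` where `D < 0`. Both expressions are Lipschitz everywhere, and their
difference is the jump (`TwoOrbit.exists_lipschitz_averages`).
-/

open scoped ContDiff Topology
open MeasureTheory

/-! ### Smoothness and periodicity of the Keplerian motion -/

namespace Delaunay

/-- The eccentric anomaly is an analytic function of the eccentricity and the mean anomaly: it
coincides with the implicit function defined by the Kepler equation. -/
theorem contDiffAt_eccAnomaly {e : ℝ} (h0 : 0 < e) (h1 : e < 1) (l : ℝ) :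
    ContDiffAt ℝ ω (fun p : ℝ × ℝ => eccAnomaly p.1 p.2) (e, l) := by
  set f : (ℝ × ℝ) × ℝ → ℝ := fun q => q.2 - q.1.1 * Real.sin q.2 - q.1.2 with hf
  set u : (ℝ × ℝ) × ℝ := ((e, l), eccAnomaly e l) with hu
  have hu0 : f u = 0 := by
    have := (eccAnomaly_spec h0.le h1 l (eccAnomaly e l)).2 rfl
    simp only [hf, hu]; linarith
  have cdf : ContDiffAt ℝ ω f u := by
    have : ContDiff ℝ ω f := by
      simp only [hf]
      exact (contDiff_snd.sub (contDiff_fst.fst.mul contDiff_snd.sin)).sub contDiff_fst.snd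
    exact this.contDiffAt
  have hder : (fderiv ℝ f u ∘L .inr ℝ (ℝ × ℝ) ℝ).IsInvertible := by
    have hne : 1 - e * Real.cos (eccAnomaly e l) ≠ 0 := by
      nlinarith [Real.cos_le_one (eccAnomaly e l)]
    refine ⟨ContinuousLinearEquiv.unitsEquivAut ℝ (Units.mk0 _ hne), ?_⟩
    ext
    have hd : HasDerivAt (fun t : ℝ => f ((e, l), t)) (1 - e * Real.cos (eccAnomaly e l))
        (eccAnomaly e l) := by
      simp only [hf]
      exact ((hasDerivAt_id _).sub ((Real.hasDerivAt_sin _).const_mul e)).sub_const l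
    have hd2 : HasDerivAt (fun t : ℝ => f ((e, l), t)) (fderiv ℝ f u ((0 : ℝ × ℝ), (1 : ℝ)))
        (eccAnomaly e l) := by
      have h3 : HasDerivAt (fun t : ℝ => ((e, l), t)) ((0 : ℝ × ℝ), (1 : ℝ)) (eccAnomaly e l) :=
        (hasDerivAt_const _ _).prodMk (hasDerivAt_id _)
      have h4 : HasFDerivAt f (fderiv ℝ f u) ((e, l), eccAnomaly e l) :=
        (cdf.differentiableAt (by simp)).hasFDerivAt
      exact h4.comp_hasDerivAt _ h3
    simp [hd2.unique hd]
  have himp := cdf.contDiffAt_implicitFunction (by simp) hder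
  refine himp.congr_of_eventuallyEq ?_
  have hev := cdf.eventually_apply_implicitFunction (by simp) hder
  have he : ∀ᶠ p : ℝ × ℝ in 𝓝 (e, l), 0 < p.1 ∧ p.1 < 1 :=
    ((isOpen_lt continuous_const continuous_fst).inter
      (isOpen_lt continuous_fst continuous_const)).mem_nhds ⟨h0, h1⟩
  filter_upwards [hev, he] with p hp hp'
  rw [hu0] at hp
  refine ((eccAnomaly_spec hp'.1.le hp'.2 p.2 _).1 ?_).symm
  simp only [hf] at hp
  linarith

theorem isOpen_domain : IsOpen domain := by
  have h : domain = {x : OrbitElements | 0 < x 1} ∩ ({x | x 1 < x 0} ∩ {x | |x 2| < x 1}) := rfl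
  rw [h]
  exact (isOpen_lt (by fun_prop) (by fun_prop)).inter
    ((isOpen_lt (by fun_prop) (by fun_prop)).inter (isOpen_lt (by fun_prop) (by fun_prop)))

theorem ecc_sq_arg_pos {x : OrbitElements} (hx : x ∈ domain) : 0 < 1 - (x 1 / x 0) ^ 2 := by
  obtain ⟨h1, h2, -⟩ := hx
  have h3 : x 1 / x 0 < 1 := (div_lt_one (h1.trans h2)).2 h2
  have h4 : 0 < x 1 / x 0 := div_pos h1 (h1.trans h2)
  nlinarith

theorem ecc_pos {x : OrbitElements} (hx : x ∈ domain) : 0 < ecc x :=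
  Real.sqrt_pos.2 (ecc_sq_arg_pos hx)

theorem ecc_lt_one {x : OrbitElements} (hx : x ∈ domain) : ecc x < 1 := by
  have h4 : 0 < x 1 / x 0 := div_pos hx.1 (hx.1.trans hx.2.1)
  rw [ecc, Real.sqrt_lt' one_pos]
  nlinarith

theorem one_sub_cosIncl_sq_pos {x : OrbitElements} (hx : x ∈ domain) : 0 < 1 - cosIncl x ^ 2 := by
  obtain ⟨h1, -, h3⟩ := hx
  have h : |cosIncl x| < 1 := by
    rw [cosIncl, abs_div, abs_of_pos h1]
    exact (div_lt_one h1).2 h3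
  have := (sq_lt_one_iff_abs_lt_one (cosIncl x)).2 h
  linarith

theorem contDiffAt_ecc {x : OrbitElements} (hx : x ∈ domain) : ContDiffAt ℝ ω ecc x := by
  refine ContDiffAt.sqrt ?_ (ecc_sq_arg_pos hx).ne'
  exact contDiffAt_const.sub (((contDiffAt_apply ℝ ℝ (1 : Fin 5) x).div
    (contDiffAt_apply ℝ ℝ (0 : Fin 5) x) (hx.1.trans hx.2.1).ne').pow 2)

theorem contDiffAt_cosIncl {x : OrbitElements} (hx : x ∈ domain) : ContDiffAt ℝ ω cosIncl x :=
  (contDiffAt_apply ℝ ℝ (2 : Fin 5) x).div (contDiffAt_apply ℝ ℝ (1 : Fin 5) x) hx.1.ne'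

theorem contDiffAt_sinIncl {x : OrbitElements} (hx : x ∈ domain) : ContDiffAt ℝ ω sinIncl x :=
  ContDiffAt.sqrt (contDiffAt_const.sub ((contDiffAt_cosIncl hx).pow 2))
    (one_sub_cosIncl_sq_pos hx).ne'

/-- The position on a Keplerian orbit is jointly analytic in the elements and the mean anomaly. -/
theorem contDiffAt_position (k : ℝ) {x : OrbitElements} (hx : x ∈ domain) (l : ℝ) :
    ContDiffAt ℝ ω (fun p : OrbitElements × ℝ => position k p.1 p.2) (x, l) := by
  have comp1 : ∀ {f : OrbitElements → ℝ}, ContDiffAt ℝ ω f x →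
      ContDiffAt ℝ ω (fun p : OrbitElements × ℝ => f p.1) (x, l) := fun h => h.fst'
  have he := comp1 (contDiffAt_ecc hx)
  have hcI := comp1 (contDiffAt_cosIncl hx)
  have hsI := comp1 (contDiffAt_sinIncl hx)
  have hu : ContDiffAt ℝ ω (fun p : OrbitElements × ℝ => eccAnomaly (ecc p.1) p.2) (x, l) :=
    ContDiffAt.comp (x, l) (f := fun p : OrbitElements × ℝ => (ecc p.1, p.2))
      (contDiffAt_eccAnomaly (ecc_pos hx) (ecc_lt_one hx) l) (he.prodMk contDiffAt_snd)
  have ha : ContDiffAt ℝ ω (fun p : OrbitElements × ℝ => semimajorAxis k p.1) (x, l) :=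
    comp1 (((contDiffAt_apply ℝ ℝ (0 : Fin 5) x).div_const k).pow 2)
  have hg : ContDiffAt ℝ ω (fun p : OrbitElements × ℝ => p.1 3) (x, l) :=
    comp1 (contDiffAt_apply ℝ ℝ (3 : Fin 5) x)
  have hz : ContDiffAt ℝ ω (fun p : OrbitElements × ℝ => p.1 4) (x, l) :=
    comp1 (contDiffAt_apply ℝ ℝ (4 : Fin 5) x)
  have hq : ContDiffAt ℝ ω (fun p : OrbitElements × ℝ => Real.sqrt (1 - ecc p.1 ^ 2)) (x, l) := by
    refine (contDiffAt_const.sub (he.pow 2)).sqrt ?_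
    have := ecc_pos hx
    have := ecc_lt_one hx
    nlinarith
  have hp := ha.mul (hu.cos.sub he)
  have hqq := (ha.mul hq).mul hu.sin
  rw [contDiffAt_euclidean]
  intro i
  fin_cases i
  · exact (((hz.cos.mul hg.cos).sub ((hz.sin.mul hg.sin).mul hcI)).mul hp).add
      (((hz.cos.mul hg.sin).neg.sub ((hz.sin.mul hg.cos).mul hcI)).mul hqq)
  · exact (((hz.sin.mul hg.cos).add ((hz.cos.mul hg.sin).mul hcI)).mul hp).add
      (((hz.sin.mul hg.sin).neg.add ((hz.cos.mul hg.cos).mul hcI)).mul hqq)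
  · exact ((hg.sin.mul hsI).mul hp).add ((hg.cos.mul hsI).mul hqq)

theorem eccAnomaly_add_two_pi {e : ℝ} (h0 : 0 ≤ e) (h1 : e < 1) (l : ℝ) :
    eccAnomaly e (l + 2 * Real.pi) = eccAnomaly e l + 2 * Real.pi := by
  refine ((eccAnomaly_spec h0 h1 _ _).1 ?_).symm
  have := (eccAnomaly_spec h0 h1 l _).2 rfl
  rw [Real.sin_add_two_pi]
  linarith

theorem position_periodic (k : ℝ) {x : OrbitElements} (hx : x ∈ domain) :
    Function.Periodic (position k x) (2 * Real.pi) := by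
  intro l
  simp only [position, eccAnomaly_add_two_pi (ecc_pos hx).le (ecc_lt_one hx),
    Real.cos_add_two_pi, Real.sin_add_two_pi]

/-- A bounded Keplerian orbit with positive angular momentum does not meet the centre. -/
theorem position_ne_zero {k : ℝ} (hk : 0 < k) {x : OrbitElements} (hx : x ∈ domain) (l : ℝ) :
    position k x l ≠ 0 := by
  intro h
  have hcomp : ∀ i, position k x l i = 0 := fun i => by rw [h]; rfl
  have h0 := hcomp 0
  have h1 := hcomp 1
  have h2 := hcomp 2
  simp only [position, PiLp.toLp_apply, Matrix.cons_val_zero, Matrix.cons_val_one,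
    Matrix.cons_val] at h0 h1 h2
  have hL : 0 < x 0 := hx.1.trans hx.2.1
  have ha : 0 < semimajorAxis k x := by unfold semimajorAxis; positivity
  have he := ecc_lt_one hx
  have he0 := ecc_pos hx
  have hb : 0 < Real.sqrt (1 - ecc x ^ 2) := Real.sqrt_pos.2 (by nlinarith)
  have hcs : sinIncl x ^ 2 = 1 - cosIncl x ^ 2 := Real.sq_sqrt (one_sub_cosIncl_sq_pos hx).le
  set u := eccAnomaly (ecc x) l
  set p := semimajorAxis k x * (Real.cos u - ecc x) with hp
  set q := semimajorAxis k x * Real.sqrt (1 - ecc x ^ 2) * Real.sin u with hq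
  have hz := Real.sin_sq_add_cos_sq (x 4)
  have hg := Real.sin_sq_add_cos_sq (x 3)
  -- the rotation preserves the norm
  have hnorm : p ^ 2 + q ^ 2 = 0 := by
    have e1 : ∀ (cz sz cg sg c s : ℝ), sz ^ 2 + cz ^ 2 = 1 → sg ^ 2 + cg ^ 2 = 1 →
        s ^ 2 = 1 - c ^ 2 →
        ((cz * cg - sz * sg * c) * p + (-(cz * sg) - sz * cg * c) * q) ^ 2 +
        ((sz * cg + cz * sg * c) * p + (-(sz * sg) + cz * cg * c) * q) ^ 2 +
        (sg * s * p + cg * s * q) ^ 2 = p ^ 2 + q ^ 2 := by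
      intro cz sz cg sg c s h1 h2 h3
      have : ((cz * cg - sz * sg * c) * p + (-(cz * sg) - sz * cg * c) * q) ^ 2 +
        ((sz * cg + cz * sg * c) * p + (-(sz * sg) + cz * cg * c) * q) ^ 2 +
        (sg * s * p + cg * s * q) ^ 2 = (sz ^ 2 + cz ^ 2) * ((cg * p - sg * q) ^ 2 +
          c ^ 2 * (sg * p + cg * q) ^ 2) + s ^ 2 * (sg * p + cg * q) ^ 2 := by ring
      rw [this, h1, h3]
      have : 1 * ((cg * p - sg * q) ^ 2 + c ^ 2 * (sg * p + cg * q) ^ 2) +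
        (1 - c ^ 2) * (sg * p + cg * q) ^ 2 = (sg ^ 2 + cg ^ 2) * (p ^ 2 + q ^ 2) := by ring
      rw [this, h2, one_mul]
    rw [← e1 _ _ _ _ _ _ hz hg hcs, h0, h1, h2]
    ring
  have hp0 : p = 0 := by nlinarith [sq_nonneg p, sq_nonneg q]
  have hq0 : q = 0 := by nlinarith [sq_nonneg p, sq_nonneg q]
  have hsin : Real.sin u = 0 := by
    rcases mul_eq_zero.1 hq0 with h | h
    · exact absurd h (mul_pos ha hb).ne'
    · exact h
  have hcos : Real.cos u = ecc x := by
    rcases mul_eq_zero.1 hp0 with h | h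
    · exact absurd h ha.ne'
    · linarith
  have := Real.sin_sq_add_cos_sq u
  rw [hsin, hcos] at this
  nlinarith

end Delaunay

/-! ### Elementary estimates for inverse powers of a square root -/

/-- The function `t ↦ t ^ (-3/2)`, which gives the derivatives of the inverse distance in terms of
the squared distance. -/
noncomputable def invCube (t : ℝ) : ℝ := (Real.sqrt t ^ 3)⁻¹

theorem le_sqrt_and_sq {σ a : ℝ} (ha : σ ^ 2 ≤ a) :
    σ ≤ Real.sqrt a ∧ Real.sqrt a ^ 2 = a :=
  ⟨Real.le_sqrt_of_sq_le ha, Real.sq_sqrt ((sq_nonneg σ).trans ha)⟩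

theorem invCube_nonneg (a : ℝ) : 0 ≤ invCube a := by unfold invCube; positivity

theorem invCube_le {σ a : ℝ} (hσ : 0 < σ) (ha : σ ^ 2 ≤ a) : invCube a ≤ (σ ^ 3)⁻¹ := by
  have h := (le_sqrt_and_sq ha).1
  unfold invCube
  gcongr

theorem abs_inv_pow_sub_le {σ x y : ℝ} (hσ : 0 < σ) (hx : σ ≤ x) (hy : σ ≤ y) :
    |x⁻¹ - y⁻¹| ≤ |x ^ 2 - y ^ 2| / (2 * σ ^ 3) := by
  have hx0 := hσ.trans_le hx
  have hy0 := hσ.trans_le hy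
  have e : x⁻¹ - y⁻¹ = (y ^ 2 - x ^ 2) / (x * y * (x + y)) := by field_simp; ring
  rw [e, abs_div, abs_sub_comm, abs_of_pos (by positivity : 0 < x * y * (x + y))]
  have : 2 * σ ^ 3 ≤ x * y * (x + y) := by
    calc 2 * σ ^ 3 = σ * σ * (σ + σ) := by ring
      _ ≤ x * y * (x + y) := by gcongr
  gcongr

/-- For positive `p, q` bounded by `b`, a Lipschitz estimate for powers. -/
theorem abs_pow_sub_pow_le_of_le {b p q : ℝ} (n : ℕ) (hp : 0 ≤ p) (hq : 0 ≤ q) (hpb : p ≤ b)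
    (hqb : q ≤ b) : |p ^ (n + 1) - q ^ (n + 1)| ≤ (n + 1) * b ^ n * |p - q| := by
  have h := abs_pow_sub_pow_le p q (n + 1)
  have hm : max |p| |q| ≤ b := by rw [abs_of_nonneg hp, abs_of_nonneg hq]; exact max_le hpb hqb
  have h0 : 0 ≤ max |p| |q| := le_max_of_le_left (abs_nonneg p)
  calc |p ^ (n + 1) - q ^ (n + 1)| ≤ |p - q| * ((n + 1 : ℕ) : ℝ) * max |p| |q| ^ (n + 1 - 1) := h
    _ ≤ |p - q| * ((n + 1 : ℕ) : ℝ) * b ^ n := by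
        rw [Nat.add_sub_cancel]; gcongr
    _ = _ := by push_cast; ring

theorem abs_inv_sqrt_pow_sub_le {σ a b : ℝ} (n : ℕ) (hσ : 0 < σ) (ha : σ ^ 2 ≤ a)
    (hb : σ ^ 2 ≤ b) : |(Real.sqrt a ^ (n + 1))⁻¹ - (Real.sqrt b ^ (n + 1))⁻¹|
      ≤ (n + 1) * |a - b| / σ ^ (n + 3) := by
  obtain ⟨h1, h2⟩ := le_sqrt_and_sq ha
  obtain ⟨h3, h4⟩ := le_sqrt_and_sq hb
  have h5 := abs_inv_pow_sub_le hσ h1 h3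
  rw [h2, h4] at h5
  have h6 := abs_pow_sub_pow_le_of_le n (inv_nonneg.2 (hσ.le.trans h1))
    (inv_nonneg.2 (hσ.le.trans h3)) (inv_anti₀ hσ h1) (inv_anti₀ hσ h3)
  rw [inv_pow, inv_pow] at h6
  refine h6.trans ?_
  calc (n + 1) * σ⁻¹ ^ n * |(Real.sqrt a)⁻¹ - (Real.sqrt b)⁻¹|
      ≤ (n + 1) * σ⁻¹ ^ n * (|a - b| / (2 * σ ^ 3)) := by gcongr
    _ ≤ (n + 1) * σ⁻¹ ^ n * (|a - b| / σ ^ 3) := by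
        gcongr; linarith [pow_pos hσ 3]
    _ = (n + 1) * |a - b| / σ ^ (n + 3) := by
        rw [inv_pow, pow_add]; field_simp

theorem abs_invCube_sub_le {σ a b : ℝ} (hσ : 0 < σ) (ha : σ ^ 2 ≤ a) (hb : σ ^ 2 ≤ b) :
    |invCube a - invCube b| ≤ 3 * |a - b| / σ ^ 5 := by
  have := abs_inv_sqrt_pow_sub_le 2 hσ ha hb
  norm_num at this
  exact this

/-- The remainder of the first order Taylor expansion of `t ↦ t ^ (-3/2)`. -/
theorem abs_invCube_taylor_le {σ a b : ℝ} (hσ : 0 < σ) (ha : σ ^ 2 ≤ a) (hb : σ ^ 2 ≤ b) :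
    |invCube a - invCube b + 3 / 2 * (a - b) / Real.sqrt b ^ 5| ≤ 2 * (a - b) ^ 2 / σ ^ 7 := by
  obtain ⟨hx, h2⟩ := le_sqrt_and_sq ha
  obtain ⟨hy, h4⟩ := le_sqrt_and_sq hb
  unfold invCube
  set x := Real.sqrt a
  set y := Real.sqrt b
  have hx0 := hσ.trans_le hx
  have hy0 := hσ.trans_le hy
  rw [← h2, ← h4]
  have e : (x ^ 3)⁻¹ - (y ^ 3)⁻¹ + 3 / 2 * (x ^ 2 - y ^ 2) / y ^ 5
      = (x ^ 2 - y ^ 2) ^ 2 / (x + y) ^ 2 *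
        (3 / 2 * (y ^ 5)⁻¹ + 3 * (x * y ^ 4)⁻¹ + 2 * (x ^ 2 * y ^ 3)⁻¹ + (x ^ 3 * y ^ 2)⁻¹) := by
    field_simp; ring
  rw [e, abs_of_nonneg (by positivity)]
  have hb : 3 / 2 * (y ^ 5)⁻¹ + 3 * (x * y ^ 4)⁻¹ + 2 * (x ^ 2 * y ^ 3)⁻¹ + (x ^ 3 * y ^ 2)⁻¹
      ≤ 3 / 2 * (σ ^ 5)⁻¹ + 3 * (σ * σ ^ 4)⁻¹ + 2 * (σ ^ 2 * σ ^ 3)⁻¹ + (σ ^ 3 * σ ^ 2)⁻¹ := by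
    gcongr
  have hxy : (2 * σ) ^ 2 ≤ (x + y) ^ 2 := by gcongr; linarith
  calc _ ≤ (x ^ 2 - y ^ 2) ^ 2 / (2 * σ) ^ 2 * (3 / 2 * (σ ^ 5)⁻¹ + 3 * (σ * σ ^ 4)⁻¹
        + 2 * (σ ^ 2 * σ ^ 3)⁻¹ + (σ ^ 3 * σ ^ 2)⁻¹) := by gcongr
    _ = 15 / 8 * (x ^ 2 - y ^ 2) ^ 2 / σ ^ 7 := by field_simp; ring
    _ ≤ _ := by gcongr; norm_num

theorem hasDerivAt_invCube {t : ℝ} (ht : 0 < t) :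
    HasDerivAt invCube (-(3 / 2) * (Real.sqrt t ^ 5)⁻¹) t := by
  have h := ((Real.hasDerivAt_sqrt ht.ne').pow 3).inv (pow_ne_zero 3 (Real.sqrt_pos.2 ht).ne')
  have hs := (Real.sqrt_pos.2 ht).ne'
  convert! h using 1
  simp only [Pi.pow_apply]
  field_simp
  push_cast
  ring

/-- A mixed second difference of `(c, t) ↦ (c² + t) ^ (-3/2)`. -/
theorem abs_invCube_mixed_le {σ a b c₁ c₂ : ℝ} (hσ : 0 < σ) (h1 : 0 < c₁) (h12 : c₁ ≤ c₂)
    (ha : σ ^ 2 ≤ c₁ ^ 2 + a) (hb : σ ^ 2 ≤ c₁ ^ 2 + b) :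
    |(invCube (c₂ ^ 2 + a) - invCube (c₂ ^ 2 + b)) - (invCube (c₁ ^ 2 + a) - invCube (c₁ ^ 2 + b))|
      ≤ 15 * c₂ * |a - b| / σ ^ 7 * (c₂ - c₁) := by
  have key : ∀ c ∈ Set.Icc c₁ c₂, σ ^ 2 ≤ c ^ 2 + a ∧ σ ^ 2 ≤ c ^ 2 + b := fun c hc => by
    have : c₁ ^ 2 ≤ c ^ 2 := by have := hc.1; gcongr
    constructor <;> linarith
  have hder : ∀ c ∈ Set.Icc c₁ c₂, HasDerivWithinAt
      (fun c => invCube (c ^ 2 + a) - invCube (c ^ 2 + b))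
      (-3 * c * ((Real.sqrt (c ^ 2 + a) ^ 5)⁻¹ - (Real.sqrt (c ^ 2 + b) ^ 5)⁻¹))
      (Set.Icc c₁ c₂) c := fun c hc => by
    have hp := (pow_pos hσ 2)
    have hq (t : ℝ) : HasDerivAt (fun c : ℝ => c ^ 2 + t) (2 * c) c := by
      simpa using (hasDerivAt_pow 2 c).add_const t
    have d1 := (hasDerivAt_invCube (hp.trans_le (key c hc).1)).comp c (hq a)
    have d2 := (hasDerivAt_invCube (hp.trans_le (key c hc).2)).comp c (hq b)
    have d := (d1.sub d2).hasDerivWithinAt (s := Set.Icc c₁ c₂)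
    refine d.congr_deriv ?_
    ring
  have bound : ∀ c ∈ Set.Icc c₁ c₂,
      ‖-3 * c * ((Real.sqrt (c ^ 2 + a) ^ 5)⁻¹ - (Real.sqrt (c ^ 2 + b) ^ 5)⁻¹)‖
        ≤ 15 * c₂ * |a - b| / σ ^ 7 := fun c hc => by
    have h := abs_inv_sqrt_pow_sub_le 4 hσ (key c hc).1 (key c hc).2
    have hc0 : 0 ≤ c := h1.le.trans hc.1
    rw [Real.norm_eq_abs, abs_mul, abs_mul, abs_of_nonneg hc0]
    have e : c ^ 2 + a - (c ^ 2 + b) = a - b := by ring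
    rw [e] at h
    norm_num at h ⊢
    calc _ ≤ 3 * c * (5 * |a - b| / σ ^ 7) := by gcongr
      _ ≤ 3 * c₂ * (5 * |a - b| / σ ^ 7) := by have := hc.2; gcongr
      _ = _ := by ring
  have := (convex_Icc c₁ c₂).norm_image_sub_le_of_norm_hasDerivWithin_le hder bound
    (Set.left_mem_Icc.2 h12) (Set.right_mem_Icc.2 h12)
  simpa only [Real.norm_eq_abs, abs_of_nonneg (sub_nonneg.2 h12)] using this

/-- A bound for the variation of `(c² + t) ^ (-3/2)` in `c` which does not degenerate as the
smaller value of `c` tends to `0`. -/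
theorem abs_invCube_sub_le_of_le {t c₁ c₂ : ℝ} (h1 : 0 < c₁) (h12 : c₁ ≤ c₂) (ht : 0 ≤ t) :
    |invCube (c₂ ^ 2 + t) - invCube (c₁ ^ 2 + t)|
      ≤ 6 * (c₂ - c₁) * c₂ / (Real.sqrt (c₁ ^ 2 + t) ^ 3 * (c₂ ^ 2 + t)) := by
  have h2 := h1.trans_le h12
  have hx0 : 0 < Real.sqrt (c₁ ^ 2 + t) := Real.sqrt_pos.2 (by positivity)
  have hy0 : 0 < Real.sqrt (c₂ ^ 2 + t) := Real.sqrt_pos.2 (by positivity)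
  have hx := Real.sq_sqrt (by positivity : 0 ≤ c₁ ^ 2 + t)
  have hy := Real.sq_sqrt (by positivity : 0 ≤ c₂ ^ 2 + t)
  have hxy : Real.sqrt (c₁ ^ 2 + t) ≤ Real.sqrt (c₂ ^ 2 + t) := by gcongr
  unfold invCube
  rw [← hy, Real.sqrt_sq hy0.le]
  set x := Real.sqrt (c₁ ^ 2 + t)
  set y := Real.sqrt (c₂ ^ 2 + t)
  have hd : (y - x) * y ≤ 2 * c₂ * (c₂ - c₁) := by
    calc (y - x) * y ≤ (y - x) * (y + x) := by
          have := sub_nonneg.2 hxy; gcongr; linarith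
      _ = (c₂ - c₁) * (c₂ + c₁) := by linear_combination hy - hx
      _ ≤ _ := by nlinarith [sub_nonneg.2 h12]
  have e : (y ^ 3)⁻¹ - (x ^ 3)⁻¹ = -((y - x) * (x ^ 2 + x * y + y ^ 2) / (x ^ 3 * y ^ 3)) := by
    field_simp; ring
  rw [e, abs_neg, abs_of_nonneg (by have := sub_nonneg.2 hxy; positivity)]
  calc (y - x) * (x ^ 2 + x * y + y ^ 2) / (x ^ 3 * y ^ 3)
      ≤ (y - x) * (y ^ 2 + y * y + y ^ 2) / (x ^ 3 * y ^ 3) := by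
        have := sub_nonneg.2 hxy; gcongr
    _ = 3 * ((y - x) * y) / (x ^ 3 * y ^ 2) := by field_simp; ring
    _ ≤ 3 * (2 * c₂ * (c₂ - c₁)) / (x ^ 3 * y ^ 2) := by gcongr
    _ = _ := by ring

theorem continuous_invCube_comp {α : Type*} [TopologicalSpace α] {f : α → ℝ} (hf : Continuous f)
    (h0 : ∀ a, 0 < f a) : Continuous fun a => invCube (f a) :=
  (hf.sqrt.pow 3).inv₀ fun a => pow_ne_zero 3 (Real.sqrt_pos.2 (h0 a)).ne'

theorem measurable_invCube : Measurable invCube := by unfold invCube; fun_prop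

/-! ### A scale-invariant radial majorant in the plane -/

/-- A radial function of `v` in the plane whose integral does not depend on the scale `c`. All
singular integrals below are dominated by multiples of it. -/
noncomputable def radialKernel (c : ℝ) (v : Anomalies) : ℝ := c / (‖v‖ * (c + ‖v‖) ^ 2)

theorem radialKernel_integrable {c : ℝ} (hc : 0 < c) :
    Integrable (radialKernel c) ∧ ∫ v, radialKernel c v = 8 := by
  set f : ℝ → ℝ := fun y => c / (y * (c + y) ^ 2)
  have hf : radialKernel c = fun v : Anomalies => f ‖v‖ := rfl
  have hder : ∀ y ∈ Set.Ici (0 : ℝ), HasDerivAt (fun y => y / (c + y)) (c / (c + y) ^ 2) y := by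
    intro y hy
    have hne : c + y ≠ 0 := by have : 0 ≤ y := hy; positivity
    have := (hasDerivAt_id y).div ((hasDerivAt_id y).const_add c) hne
    convert! this using 1
    simp
  have hnn : ∀ y ∈ Set.Ioi (0 : ℝ), 0 ≤ c / (c + y) ^ 2 := fun y _ => by positivity
  have hlim : Filter.Tendsto (fun y => y / (c + y)) Filter.atTop (𝓝 1) := by
    have h1 : Filter.Tendsto (fun y : ℝ => 1 - c / (c + y)) Filter.atTop (𝓝 (1 - 0)) :=
      tendsto_const_nhds.sub (Filter.Tendsto.const_div_atTop
        (Filter.tendsto_atTop_add_const_left _ _ Filter.tendsto_id) c)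
    rw [sub_zero] at h1
    refine h1.congr' ?_
    filter_upwards [Filter.eventually_gt_atTop 0] with y hy
    have : c + y ≠ 0 := by positivity
    field_simp
    ring
  have hcongr : Set.EqOn (fun y : ℝ => c / (c + y) ^ 2)
      (fun y : ℝ => y ^ (Module.finrank ℝ Anomalies - 1) • f y) (Set.Ioi 0) := by
    intro y hy
    have : y ≠ 0 := ne_of_gt hy
    have h2 : Module.finrank ℝ Anomalies = 2 := by simp
    simp only [h2, f, smul_eq_mul]
    field_simp
    norm_num
  rw [hf, integrable_fun_norm_addHaar, integral_fun_norm_addHaar]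
  constructor
  · exact (integrableOn_Ioi_deriv_of_nonneg' hder hnn hlim).congr_fun hcongr measurableSet_Ioi
  · rw [← setIntegral_congr_fun measurableSet_Ioi hcongr,
      integral_Ioi_of_hasDerivAt_of_nonneg' hder hnn hlim]
    have hvol : (volume : Measure Anomalies).real (Metric.ball 0 1) = 4 := by
      rw [measureReal_def, Real.volume_pi_ball _ one_pos]
      norm_num
    rw [hvol]
    simp
    norm_num

/-- The domination principle for integrals over subsets of the plane. -/
theorem integral_le_of_radialKernel {f : Anomalies → ℝ} {S : Set Anomalies} {c M : ℝ} (hc : 0 < c)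
    (hM : 0 ≤ M) (hS : MeasurableSet S) (hf : AEStronglyMeasurable f (volume.restrict S))
    (h : ∀ v ∈ S, v ≠ 0 → |f v| ≤ M * radialKernel c v) :
    IntegrableOn f S ∧ |∫ v in S, f v| ≤ 8 * M := by
  obtain ⟨hi, hv⟩ := radialKernel_integrable hc
  have hae : ∀ᵐ v ∂(volume.restrict S), ‖f v‖ ≤ M * radialKernel c v := by
    have h0 : ∀ᵐ v : Anomalies, v ≠ 0 := by simp [ae_iff]
    rw [ae_restrict_iff' hS]
    filter_upwards [h0] with v hv hvS
    exact h v hvS hv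
  have hint : IntegrableOn (fun v => M * radialKernel c v) S := (hi.const_mul M).integrableOn
  refine ⟨Integrable.mono' hint hf hae, ?_⟩
  calc |∫ v in S, f v| ≤ ∫ v in S, M * radialKernel c v := by
        rw [← Real.norm_eq_abs]
        exact norm_integral_le_of_norm_le hint hae
    _ ≤ ∫ v, M * radialKernel c v := by
        refine setIntegral_le_integral (hi.const_mul M) (Filter.Eventually.of_forall fun v => ?_)
        unfold radialKernel
        simp only [Pi.zero_apply]
        positivity
    _ = 8 * M := by rw [integral_const_mul, hv, mul_comm]

theorem inv_norm_le_radialKernel {v : Anomalies} (hv : v ≠ 0) (h : ‖v‖ ≤ Real.pi) :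
    ‖v‖⁻¹ ≤ 4 * Real.pi * radialKernel Real.pi v := by
  have h0 : 0 < ‖v‖ := norm_pos_iff.2 hv
  have hp := Real.pi_pos
  have h2 : (Real.pi + ‖v‖) ^ 2 ≤ (2 * Real.pi) ^ 2 := by gcongr; linarith
  calc ‖v‖⁻¹ = 4 * Real.pi * (Real.pi / (‖v‖ * (2 * Real.pi) ^ 2)) := by field_simp; ring
    _ ≤ 4 * Real.pi * (Real.pi / (‖v‖ * (Real.pi + ‖v‖) ^ 2)) := by gcongr
    _ = _ := rfl

theorem inv_norm_cube_le_radialKernel {v : Anomalies} (h : Real.pi ≤ ‖v‖) :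
    (‖v‖ ^ 3)⁻¹ ≤ 4 / Real.pi * radialKernel Real.pi v := by
  have hp := Real.pi_pos
  have h0 : 0 < ‖v‖ := hp.trans_le h
  have h2 : (Real.pi + ‖v‖) ^ 2 ≤ (2 * ‖v‖) ^ 2 := by gcongr; linarith
  calc (‖v‖ ^ 3)⁻¹ = 4 / Real.pi * (Real.pi / (‖v‖ * (2 * ‖v‖) ^ 2)) := by field_simp; ring
    _ ≤ 4 / Real.pi * (Real.pi / (‖v‖ * (Real.pi + ‖v‖) ^ 2)) := by gcongr
    _ = _ := rfl

theorem div_cube_le_radialKernel {v : Anomalies} {c : ℝ} (hc : 0 < c) (hv : v ≠ 0) :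
    c / (c + ‖v‖) ^ 3 ≤ radialKernel c v := by
  have h0 : 0 < ‖v‖ := norm_pos_iff.2 hv
  unfold radialKernel
  have : ‖v‖ * (c + ‖v‖) ^ 2 ≤ (c + ‖v‖) ^ 3 := by
    rw [pow_succ' _ 2]; gcongr; linarith
  gcongr

theorem TwoOrbit.mem_torus_iff {v : Anomalies} : v ∈ TwoOrbit.torus ↔ ‖v‖ ≤ Real.pi := by
  rw [TwoOrbit.torus, Set.mem_Icc, pi_norm_le_iff_of_nonneg Real.pi_pos.le]
  simp only [Pi.le_def, Real.norm_eq_abs, abs_le]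
  exact ⟨fun h i => ⟨h.1 i, h.2 i⟩, fun h => ⟨fun i => (h i).1, fun i => (h i).2⟩⟩

theorem TwoOrbit.measurableSet_torus : MeasurableSet TwoOrbit.torus := measurableSet_Icc

theorem TwoOrbit.isCompact_torus : IsCompact TwoOrbit.torus := isCompact_Icc

/-! ### Lipschitz functions on a set -/

/-- `f` is Lipschitz on `S`, with a real constant. -/
def LipOn {X : Type*} [PseudoMetricSpace X] (f : X → ℝ) (S : Set X) : Prop :=
  ∃ K : ℝ, 0 ≤ K ∧ ∀ x ∈ S, ∀ y ∈ S, |f x - f y| ≤ K * dist x y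

namespace LipOn

variable {X : Type*} [PseudoMetricSpace X] {f g : X → ℝ} {S T : Set X}

theorem iff_lipschitzOnWith : LipOn f S ↔ ∃ K : NNReal, LipschitzOnWith K f S := by
  constructor
  · rintro ⟨K, hK, h⟩
    refine ⟨⟨K, hK⟩, LipschitzOnWith.of_dist_le_mul fun x hx y hy => ?_⟩
    rw [Real.dist_eq]
    exact h x hx y hy
  · rintro ⟨K, h⟩
    refine ⟨K, K.2, fun x hx y hy => ?_⟩
    rw [← Real.dist_eq]
    exact h.dist_le_mul x hx y hy

theorem mono (h : LipOn f S) (hT : T ⊆ S) : LipOn f T := by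
  obtain ⟨K, hK, h⟩ := h
  exact ⟨K, hK, fun x hx y hy => h x (hT hx) y (hT hy)⟩

theorem congr (h : LipOn f S) (hfg : Set.EqOn g f S) : LipOn g S := by
  obtain ⟨K, hK, h⟩ := h
  exact ⟨K, hK, fun x hx y hy => by rw [hfg hx, hfg hy]; exact h x hx y hy⟩

theorem add (hf : LipOn f S) (hg : LipOn g S) : LipOn (fun x => f x + g x) S := by
  obtain ⟨K, hK, hf⟩ := hf
  obtain ⟨L, hL, hg⟩ := hg
  refine ⟨K + L, by positivity, fun x hx y hy => ?_⟩
  have e : f x + g x - (f y + g y) = (f x - f y) + (g x - g y) := by ring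
  rw [e]
  linarith [abs_add_le (f x - f y) (g x - g y), hf x hx y hy, hg x hx y hy]

theorem const_mul (a : ℝ) (hf : LipOn f S) : LipOn (fun x => a * f x) S := by
  obtain ⟨K, hK, hf⟩ := hf
  refine ⟨|a| * K, by positivity, fun x hx y hy => ?_⟩
  rw [← mul_sub, abs_mul, mul_assoc]
  exact mul_le_mul_of_nonneg_left (hf x hx y hy) (abs_nonneg a)

theorem sub (hf : LipOn f S) (hg : LipOn g S) : LipOn (fun x => f x - g x) S :=
  (hf.add (hg.const_mul (-1))).congr fun x _ => by ring

theorem mul {A B : ℝ} (hf : LipOn f S) (hg : LipOn g S) (hA : ∀ x ∈ S, |f x| ≤ A)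
    (hB : ∀ x ∈ S, |g x| ≤ B) : LipOn (fun x => f x * g x) S := by
  obtain ⟨K, hK, hf⟩ := hf
  obtain ⟨L, hL, hg⟩ := hg
  refine ⟨K * |B| + |A| * L, by positivity, fun x hx y hy => ?_⟩
  have e : f x * g x - f y * g y = (f x - f y) * g x + f y * (g x - g y) := by ring
  rw [e]
  calc _ ≤ |f x - f y| * |g x| + |f y| * |g x - g y| := by
        rw [← abs_mul, ← abs_mul]; exact abs_add_le _ _
    _ ≤ K * dist x y * |B| + |A| * (L * dist x y) :=
        add_le_add (mul_le_mul (hf x hx y hy) ((hB x hx).trans (le_abs_self B)) (abs_nonneg _)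
          (by positivity)) (mul_le_mul ((hA y hy).trans (le_abs_self A)) (hg x hx y hy)
          (abs_nonneg _) (abs_nonneg _))
    _ = _ := by ring

theorem abs (hf : LipOn f S) : LipOn (fun x => |f x|) S := by
  obtain ⟨K, hK, hf⟩ := hf
  exact ⟨K, hK, fun x hx y hy => (abs_abs_sub_abs_le _ _).trans (hf x hx y hy)⟩

end LipOn

/-! ### Singular integrals depending on parameters -/

/-- A family of functions `Q x` on the square `‖v‖ ≤ π` with a non-degenerate minimum at `0` with
value `0`, with its quadratic part `q₀ x`, and a family `Q₁ x` vanishing to second order at `0`;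
all of this with constants that do not depend on `x`. The lower bounds have the form
`2 σ² ‖v‖²` with `σ ≤ 1/2` so that `c² + Q x v ≥ (σ (c + ‖v‖))²` for all `c`. -/
structure SingularFamily {X : Type*} [PseudoMetricSpace X] (W : Set X)
    (Q q₀ Q₁ : X → Anomalies → ℝ) (σ C : ℝ) : Prop where
  pos : 0 < σ
  le_half : σ ≤ 1 / 2
  nonneg : 0 ≤ C
  continuous : ∀ x ∈ W, Continuous (Q x)
  continuous_quad : ∀ x ∈ W, Continuous (q₀ x)
  continuous_num : ∀ x ∈ W, Continuous (Q₁ x)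
  lower : ∀ x ∈ W, ∀ v ∈ TwoOrbit.torus, 2 * σ ^ 2 * ‖v‖ ^ 2 ≤ Q x v
  lower_quad : ∀ x ∈ W, ∀ v, 2 * σ ^ 2 * ‖v‖ ^ 2 ≤ q₀ x v
  quad_neg : ∀ x ∈ W, ∀ v, q₀ x (-v) = q₀ x v
  lip : ∀ x ∈ W, ∀ y ∈ W, ∀ v ∈ TwoOrbit.torus, |Q x v - Q y v| ≤ C * dist x y * ‖v‖ ^ 2
  cubic : ∀ x ∈ W, ∀ v ∈ TwoOrbit.torus, |Q x v - q₀ x v| ≤ C * ‖v‖ ^ 3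
  quartic : ∀ x ∈ W, ∀ v ∈ TwoOrbit.torus, |Q x v + Q x (-v) - 2 * q₀ x v| ≤ C * ‖v‖ ^ 4
  num_le : ∀ x ∈ W, ∀ v ∈ TwoOrbit.torus, |Q₁ x v| ≤ C * ‖v‖ ^ 2
  num_lip : ∀ x ∈ W, ∀ y ∈ W, ∀ v ∈ TwoOrbit.torus, |Q₁ x v - Q₁ y v| ≤ C * dist x y * ‖v‖ ^ 2

namespace SingularFamily

open TwoOrbit (torus mem_torus_iff measurableSet_torus isCompact_torus)

variable {X : Type*} [PseudoMetricSpace X] {W : Set X} {Q q₀ Q₁ : X → Anomalies → ℝ} {σ C : ℝ}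

theorem sq_le_aux (hσ : 0 < σ) (hσ2 : σ ≤ 1 / 2) {c n q : ℝ} (hq : 2 * σ ^ 2 * n ^ 2 ≤ q) :
    (σ * (c + n)) ^ 2 ≤ c ^ 2 + q := by
  have h1 : σ ^ 2 ≤ 1 / 4 := by nlinarith
  nlinarith [mul_nonneg (sq_nonneg σ) (sq_nonneg (c - n)), sq_nonneg c,
    mul_nonneg (sub_nonneg.2 h1) (sq_nonneg c)]

theorem sq_le (h : SingularFamily W Q q₀ Q₁ σ C) {x : X} (hx : x ∈ W) {v : Anomalies}
    (hv : v ∈ torus) (c : ℝ) : (σ * (c + ‖v‖)) ^ 2 ≤ c ^ 2 + Q x v :=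
  sq_le_aux h.pos h.le_half (h.lower x hx v hv)

theorem sq_le_quad (h : SingularFamily W Q q₀ Q₁ σ C) {x : X} (hx : x ∈ W) (v : Anomalies)
    (c : ℝ) : (σ * (c + ‖v‖)) ^ 2 ≤ c ^ 2 + q₀ x v :=
  sq_le_aux h.pos h.le_half (h.lower_quad x hx v)

theorem scale_pos (h : SingularFamily W Q q₀ Q₁ σ C) {c : ℝ} (hc : 0 < c) (v : Anomalies) :
    0 < σ * (c + ‖v‖) := by have := h.pos; positivity

theorem continuousOn_invCube (h : SingularFamily W Q q₀ Q₁ σ C) {x : X} (hx : x ∈ W) {c : ℝ}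
    (hc : 0 < c) : ContinuousOn (fun v => invCube (c ^ 2 + Q x v)) torus := by
  have h1 : ContinuousOn (fun v => c ^ 2 + Q x v) torus :=
    (continuous_const.add (h.continuous x hx)).continuousOn
  refine (h1.sqrt.pow 3).inv₀ fun v hv => pow_ne_zero 3 (Real.sqrt_pos.2 ?_).ne'
  exact (pow_pos (h.scale_pos hc v) 2).trans_le (h.sq_le hx hv c)

theorem continuous_invCube_quad (h : SingularFamily W Q q₀ Q₁ σ C) {x : X} (hx : x ∈ W) {c : ℝ}
    (hc : 0 < c) : Continuous (fun v => invCube (c ^ 2 + q₀ x v)) :=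
  continuous_invCube_comp (continuous_const.add (h.continuous_quad x hx)) fun v =>
    (pow_pos (h.scale_pos hc v) 2).trans_le (h.sq_le_quad hx v c)

theorem integrableOn_invCube (h : SingularFamily W Q q₀ Q₁ σ C) {x : X} (hx : x ∈ W) {c : ℝ}
    (hc : 0 < c) : IntegrableOn (fun v => invCube (c ^ 2 + Q x v)) torus :=
  (h.continuousOn_invCube hx hc).integrableOn_compact isCompact_torus

theorem continuousOn_num (h : SingularFamily W Q q₀ Q₁ σ C) {x : X} (hx : x ∈ W) {c : ℝ}
    (hc : 0 < c) : ContinuousOn (fun v => Q₁ x v * invCube (c ^ 2 + Q x v)) torus :=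
  (h.continuous_num x hx).continuousOn.mul (h.continuousOn_invCube hx hc)

theorem integrableOn_num (h : SingularFamily W Q q₀ Q₁ σ C) {x : X} (hx : x ∈ W) {c : ℝ}
    (hc : 0 < c) : IntegrableOn (fun v => Q₁ x v * invCube (c ^ 2 + Q x v)) torus :=
  (h.continuousOn_num hx hc).integrableOn_compact isCompact_torus

/-- The integral with a numerator vanishing to second order is Lipschitz in the parameter, uniformly
in the distance `c` from the singularity. -/
theorem num_lip_param (h : SingularFamily W Q q₀ Q₁ σ C) :
    ∃ K : ℝ, 0 ≤ K ∧ ∀ c : ℝ, 0 < c → ∀ x ∈ W, ∀ y ∈ W,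
      |(∫ v in torus, Q₁ x v * invCube (c ^ 2 + Q x v))
        - ∫ v in torus, Q₁ y v * invCube (c ^ 2 + Q y v)| ≤ K * dist x y := by
  have hσ := h.pos
  have hC := h.nonneg
  have hpi := Real.pi_pos
  refine ⟨8 * ((C / σ ^ 3 + 3 * C ^ 2 / σ ^ 5) * (4 * Real.pi)), by positivity,
    fun c hc x hx y hy => ?_⟩
  rw [← integral_sub (h.integrableOn_num hx hc) (h.integrableOn_num hy hc)]
  have hM : 0 ≤ (C / σ ^ 3 + 3 * C ^ 2 / σ ^ 5) * (4 * Real.pi) * dist x y := by positivity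
  refine (integral_le_of_radialKernel (c := Real.pi) hpi hM measurableSet_torus
    (((h.continuousOn_num hx hc).sub (h.continuousOn_num hy hc)).aestronglyMeasurable
      measurableSet_torus) fun v hv hv0 => ?_).2.trans (le_of_eq (by ring))
  have hn : 0 < ‖v‖ := norm_pos_iff.2 hv0
  have hs := h.scale_pos hc v
  have e : Q₁ x v * invCube (c ^ 2 + Q x v) - Q₁ y v * invCube (c ^ 2 + Q y v)
      = (Q₁ x v - Q₁ y v) * invCube (c ^ 2 + Q x v)
        + Q₁ y v * (invCube (c ^ 2 + Q x v) - invCube (c ^ 2 + Q y v)) := by ring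
  have e1 := invCube_le hs (h.sq_le hx hv c)
  have e2 := abs_invCube_sub_le hs (h.sq_le hx hv c) (h.sq_le hy hv c)
  rw [add_sub_add_left_eq_sub] at e2
  have hcn : σ * ‖v‖ ≤ σ * (c + ‖v‖) := by gcongr; linarith
  simp only [Pi.sub_apply]
  rw [e]
  calc _ ≤ |Q₁ x v - Q₁ y v| * invCube (c ^ 2 + Q x v)
        + |Q₁ y v| * |invCube (c ^ 2 + Q x v) - invCube (c ^ 2 + Q y v)| := by
        refine (abs_add_le _ _).trans_eq ?_
        rw [abs_mul, abs_mul, abs_of_nonneg (invCube_nonneg _)]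
    _ ≤ C * dist x y * ‖v‖ ^ 2 * ((σ * (c + ‖v‖)) ^ 3)⁻¹
        + C * ‖v‖ ^ 2 * (3 * (C * dist x y * ‖v‖ ^ 2) / (σ * (c + ‖v‖)) ^ 5) := by
        gcongr
        · exact invCube_nonneg _
        · exact h.num_lip x hx y hy v hv
        · exact h.num_le y hy v hv
        · refine e2.trans ?_
          gcongr
          exact h.lip x hx y hy v hv
    _ ≤ C * dist x y * ‖v‖ ^ 2 * ((σ * ‖v‖) ^ 3)⁻¹
        + C * ‖v‖ ^ 2 * (3 * (C * dist x y * ‖v‖ ^ 2) / (σ * ‖v‖) ^ 5) := by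
        gcongr
    _ = (C / σ ^ 3 + 3 * C ^ 2 / σ ^ 5) * dist x y * ‖v‖⁻¹ := by field_simp
    _ ≤ (C / σ ^ 3 + 3 * C ^ 2 / σ ^ 5) * dist x y * (4 * Real.pi * radialKernel Real.pi v) := by
        gcongr
        exact inv_norm_le_radialKernel hv0 (mem_torus_iff.1 hv)
    _ = _ := by ring

/-- The integral with a numerator vanishing to second order is Lipschitz in the distance `c` from
the singularity. -/
theorem num_lip_scale (h : SingularFamily W Q q₀ Q₁ σ C) :
    ∃ K : ℝ, 0 ≤ K ∧ ∀ x ∈ W, ∀ c₁ c₂ : ℝ, 0 < c₁ → c₁ ≤ c₂ →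
      |(∫ v in torus, Q₁ x v * invCube (c₂ ^ 2 + Q x v))
        - ∫ v in torus, Q₁ x v * invCube (c₁ ^ 2 + Q x v)| ≤ K * (c₂ - c₁) := by
  have hσ := h.pos
  have hC := h.nonneg
  refine ⟨8 * (6 * C / σ ^ 5), by positivity, fun x hx c₁ c₂ h1 h12 => ?_⟩
  have h2 := h1.trans_le h12
  have h3 := sub_nonneg.2 h12
  rw [← integral_sub (h.integrableOn_num hx h2) (h.integrableOn_num hx h1)]
  have hM : 0 ≤ 6 * C / σ ^ 5 * (c₂ - c₁) := by positivity
  refine (integral_le_of_radialKernel h2 hM measurableSet_torus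
    (((h.continuousOn_num hx h2).sub (h.continuousOn_num hx h1)).aestronglyMeasurable
      measurableSet_torus) fun v hv hv0 => ?_).2.trans (le_of_eq (by ring))
  have hn : 0 < ‖v‖ := norm_pos_iff.2 hv0
  have hQ : 0 ≤ Q x v := le_trans (by positivity) (h.lower x hx v hv)
  have e := abs_invCube_sub_le_of_le h1 h12 hQ
  have hs1 : σ * ‖v‖ ≤ Real.sqrt (c₁ ^ 2 + Q x v) := by
    refine Real.le_sqrt_of_sq_le (le_trans ?_ (h.sq_le hx hv c₁))
    gcongr; linarith
  simp only [Pi.sub_apply]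
  rw [← mul_sub, abs_mul]
  calc _ ≤ C * ‖v‖ ^ 2 * (6 * (c₂ - c₁) * c₂ /
        (Real.sqrt (c₁ ^ 2 + Q x v) ^ 3 * (c₂ ^ 2 + Q x v))) := by
        gcongr
        exact h.num_le x hx v hv
    _ ≤ C * ‖v‖ ^ 2 * (6 * (c₂ - c₁) * c₂ / ((σ * ‖v‖) ^ 3 * (σ * (c₂ + ‖v‖)) ^ 2)) := by
        gcongr
        exact h.sq_le hx hv c₂
    _ = 6 * C / σ ^ 5 * (c₂ - c₁) * radialKernel c₂ v := by
        unfold radialKernel; field_simp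

/-- Integrals of `c (c² + Q) ^ (-3/2)` are Lipschitz in the parameter, uniformly in `c`. -/
theorem invCube_lip_param (h : SingularFamily W Q q₀ Q₁ σ C) :
    ∃ K : ℝ, 0 ≤ K ∧ ∀ c : ℝ, 0 < c → ∀ x ∈ W, ∀ y ∈ W,
      |c * (∫ v in torus, invCube (c ^ 2 + Q x v))
        - c * ∫ v in torus, invCube (c ^ 2 + Q y v)| ≤ K * dist x y := by
  have hσ := h.pos
  have hC := h.nonneg
  refine ⟨8 * (3 * C / σ ^ 5), by positivity, fun c hc x hx y hy => ?_⟩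
  rw [← mul_sub, ← integral_sub (h.integrableOn_invCube hx hc) (h.integrableOn_invCube hy hc),
    ← integral_const_mul]
  have hM : 0 ≤ 3 * C / σ ^ 5 * dist x y := by positivity
  refine (integral_le_of_radialKernel hc hM measurableSet_torus
    ((continuousOn_const.mul ((h.continuousOn_invCube hx hc).sub
      (h.continuousOn_invCube hy hc))).aestronglyMeasurable measurableSet_torus)
      fun v hv hv0 => ?_).2.trans (le_of_eq (by ring))
  have hn : 0 < ‖v‖ := norm_pos_iff.2 hv0
  have hs := h.scale_pos hc v
  have e2 := abs_invCube_sub_le hs (h.sq_le hx hv c) (h.sq_le hy hv c)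
  rw [add_sub_add_left_eq_sub] at e2
  simp only [Pi.mul_apply, Pi.sub_apply]
  rw [abs_mul, abs_of_pos hc]
  calc _ ≤ c * (3 * (C * dist x y * ‖v‖ ^ 2) / (σ * (c + ‖v‖)) ^ 5) := by
        gcongr
        refine e2.trans ?_
        gcongr
        exact h.lip x hx y hy v hv
    _ ≤ c * (3 * (C * dist x y * (c + ‖v‖) ^ 2) / (σ * (c + ‖v‖)) ^ 5) := by
        gcongr; linarith
    _ = 3 * C / σ ^ 5 * dist x y * (c / (c + ‖v‖) ^ 3) := by field_simp
    _ ≤ _ := by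
        gcongr
        exact div_cube_le_radialKernel hc hv0

theorem neg_mem_torus {v : Anomalies} (hv : v ∈ torus) : -v ∈ torus := by
  rw [mem_torus_iff, norm_neg]; exact mem_torus_iff.1 hv

theorem integral_torus_comp_neg (f : Anomalies → ℝ) :
    ∫ v in torus, f (-v) = ∫ v in torus, f v := by
  rw [← integral_indicator measurableSet_torus, ← integral_indicator measurableSet_torus,
    ← integral_neg_eq_self (torus.indicator f)]
  congr 1
  ext v
  by_cases hv : v ∈ torus
  · rw [Set.indicator_of_mem hv, Set.indicator_of_mem (neg_mem_torus hv)]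
  · have : -v ∉ torus := fun h' => hv (by simpa using neg_mem_torus h')
    rw [Set.indicator_of_notMem hv, Set.indicator_of_notMem this]

theorem norm_of_notMem_torus {v : Anomalies} (hv : v ∈ torusᶜ) : Real.pi ≤ ‖v‖ := by
  by_contra h
  exact hv (mem_torus_iff.2 (not_le.1 h).le)

/-- The error made in replacing `Q` by its quadratic part, on the square, together with the
contribution of the quadratic part outside the square. -/
noncomputable def defect (Q q₀ : X → Anomalies → ℝ) (x : X) (c : ℝ) : ℝ :=
  (∫ v in torusᶜ, invCube (c ^ 2 + q₀ x v))
    - ∫ v in torus, (invCube (c ^ 2 + Q x v) - invCube (c ^ 2 + q₀ x v))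

theorem integrableOn_sub (h : SingularFamily W Q q₀ Q₁ σ C) {x : X} (hx : x ∈ W) {c : ℝ}
    (hc : 0 < c) :
    IntegrableOn (fun v => invCube (c ^ 2 + Q x v) - invCube (c ^ 2 + q₀ x v)) torus :=
  (h.integrableOn_invCube hx hc).sub
    ((h.continuous_invCube_quad hx hc).continuousOn.integrableOn_compact isCompact_torus)

theorem quad_outside (h : SingularFamily W Q q₀ Q₁ σ C) {x : X} (hx : x ∈ W) {c : ℝ}
    (hc : 0 < c) : IntegrableOn (fun v => invCube (c ^ 2 + q₀ x v)) torusᶜ ∧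
      |∫ v in torusᶜ, invCube (c ^ 2 + q₀ x v)| ≤ 8 * (4 / (Real.pi * σ ^ 3)) := by
  have hσ := h.pos
  have hpi := Real.pi_pos
  refine integral_le_of_radialKernel hpi (by positivity) measurableSet_torus.compl
    (h.continuous_invCube_quad hx hc).aestronglyMeasurable fun v hv hv0 => ?_
  have hn : 0 < ‖v‖ := norm_pos_iff.2 hv0
  rw [abs_of_nonneg (invCube_nonneg _)]
  calc _ ≤ ((σ * (c + ‖v‖)) ^ 3)⁻¹ := invCube_le (h.scale_pos hc v) (h.sq_le_quad hx v c)
    _ ≤ ((σ * ‖v‖) ^ 3)⁻¹ := by gcongr; linarith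
    _ = (σ ^ 3)⁻¹ * (‖v‖ ^ 3)⁻¹ := by rw [mul_pow, mul_inv]
    _ ≤ (σ ^ 3)⁻¹ * (4 / Real.pi * radialKernel Real.pi v) := by
        gcongr
        exact inv_norm_cube_le_radialKernel (norm_of_notMem_torus hv)
    _ = _ := by field_simp

theorem integrableOn_quad_torus (h : SingularFamily W Q q₀ Q₁ σ C) {x : X} (hx : x ∈ W) {c : ℝ}
    (hc : 0 < c) : IntegrableOn (fun v => invCube (c ^ 2 + q₀ x v)) torus :=
  (h.continuous_invCube_quad hx hc).continuousOn.integrableOn_compact isCompact_torus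

/-- The integral over the square differs from the integral of the quadratic part over the plane by
the defect. -/
theorem integral_sub_eq_defect (h : SingularFamily W Q q₀ Q₁ σ C) {x : X} (hx : x ∈ W) {c : ℝ}
    (hc : 0 < c) : (∫ v, invCube (c ^ 2 + q₀ x v)) - ∫ v in torus, invCube (c ^ 2 + Q x v)
      = defect Q q₀ x c := by
  have hi : Integrable (fun v => invCube (c ^ 2 + q₀ x v)) := by
    rw [← integrableOn_univ, ← Set.union_compl_self torus]
    exact (h.integrableOn_quad_torus hx hc).union (h.quad_outside hx hc).1
  rw [← integral_add_compl measurableSet_torus hi, defect,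
    integral_sub (h.integrableOn_invCube hx hc) (h.integrableOn_quad_torus hx hc)]
  ring

/-- The defect stays bounded as `c → 0`: the cubic part of `Q` would produce a logarithmic
divergence, but it is odd and does not contribute to the integral over the symmetric square. -/
theorem defect_bounded (h : SingularFamily W Q q₀ Q₁ σ C) :
    ∃ K : ℝ, 0 ≤ K ∧ ∀ c : ℝ, 0 < c → ∀ x ∈ W, |defect Q q₀ x c| ≤ K := by
  have hσ := h.pos
  have hC := h.nonneg
  have hpi := Real.pi_pos
  refine ⟨8 * (4 / (Real.pi * σ ^ 3)) + 1 / 2 * (8 * ((3 / 2 * C / σ ^ 5 + 4 * C ^ 2 / σ ^ 7) *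
    (4 * Real.pi))), by positivity, fun c hc x hx => ?_⟩
  set θ : Anomalies → ℝ := fun v => invCube (c ^ 2 + Q x v) - invCube (c ^ 2 + q₀ x v) with hθ
  have hi : IntegrableOn θ torus := h.integrableOn_sub hx hc
  have hcont : ContinuousOn θ torus :=
    (h.continuousOn_invCube hx hc).sub (h.continuous_invCube_quad hx hc).continuousOn
  have hcontn : ContinuousOn (fun v => θ (-v)) torus :=
    hcont.comp continuous_neg.continuousOn fun v hv => neg_mem_torus hv
  have hin : IntegrableOn (fun v => θ (-v)) torus := hcontn.integrableOn_compact isCompact_torus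
  have hsym : ∫ v in torus, θ v = 1 / 2 * ∫ v in torus, (θ v + θ (-v)) := by
    rw [integral_add hi hin, integral_torus_comp_neg]; ring
  have hb : |∫ v in torus, (θ v + θ (-v))|
      ≤ 8 * ((3 / 2 * C / σ ^ 5 + 4 * C ^ 2 / σ ^ 7) * (4 * Real.pi)) := by
    refine (integral_le_of_radialKernel (c := Real.pi) hpi (by positivity) measurableSet_torus
      ((hcont.add hcontn).aestronglyMeasurable measurableSet_torus) fun v hv hv0 => ?_).2
    have hn : 0 < ‖v‖ := norm_pos_iff.2 hv0
    have hs := h.scale_pos hc v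
    have hb2 := h.sq_le_quad hx v c
    have ha := abs_invCube_taylor_le hs (h.sq_le hx hv c) hb2
    have ha' := abs_invCube_taylor_le hs
      (by simpa using h.sq_le hx (neg_mem_torus hv) c) hb2
    rw [add_sub_add_left_eq_sub] at ha ha'
    have hcub := h.cubic x hx v hv
    have hcub' := h.cubic x hx (-v) (neg_mem_torus hv)
    rw [norm_neg, h.quad_neg x hx] at hcub'
    have hquart := h.quartic x hx v hv
    have hs5 : σ * (c + ‖v‖) ≤ Real.sqrt (c ^ 2 + q₀ x v) := (le_sqrt_and_sq hb2).1
    set s := Real.sqrt (c ^ 2 + q₀ x v)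
    have hs0 : 0 < s := hs.trans_le hs5
    simp only [Pi.add_apply, hθ, h.quad_neg x hx]
    set A := invCube (c ^ 2 + Q x v)
    set A' := invCube (c ^ 2 + Q x (-v))
    set B := invCube (c ^ 2 + q₀ x v)
    have e : A - B + (A' - B) = (A - B + 3 / 2 * (Q x v - q₀ x v) / s ^ 5)
        + (A' - B + 3 / 2 * (Q x (-v) - q₀ x v) / s ^ 5)
        - 3 / 2 / s ^ 5 * (Q x v + Q x (-v) - 2 * q₀ x v) := by ring
    have hsv : σ * ‖v‖ ≤ σ * (c + ‖v‖) := by gcongr; linarith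
    have sq_of (t : ℝ) (ht : |t| ≤ C * ‖v‖ ^ 3) :
        2 * t ^ 2 / (σ * (c + ‖v‖)) ^ 7 ≤ 2 * (C * ‖v‖ ^ 3) ^ 2 / (σ * ‖v‖) ^ 7 := by
      have : t ^ 2 ≤ (C * ‖v‖ ^ 3) ^ 2 := by rw [← sq_abs]; gcongr
      gcongr
    rw [e]
    calc _ ≤ |A - B + 3 / 2 * (Q x v - q₀ x v) / s ^ 5|
          + |A' - B + 3 / 2 * (Q x (-v) - q₀ x v) / s ^ 5|
          + |3 / 2 / s ^ 5 * (Q x v + Q x (-v) - 2 * q₀ x v)| :=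
          (abs_sub _ _).trans (by gcongr; exact abs_add_le _ _)
      _ ≤ 2 * (C * ‖v‖ ^ 3) ^ 2 / (σ * ‖v‖) ^ 7 + 2 * (C * ‖v‖ ^ 3) ^ 2 / (σ * ‖v‖) ^ 7
          + 3 / 2 / (σ * ‖v‖) ^ 5 * (C * ‖v‖ ^ 4) := by
          rw [abs_mul, abs_of_pos (by positivity : 0 < 3 / 2 / s ^ 5)]
          have := sq_of _ hcub
          have := sq_of _ hcub'
          have : σ * ‖v‖ ≤ s := hsv.trans hs5
          gcongr <;> linarith
      _ = (3 / 2 * C / σ ^ 5 + 4 * C ^ 2 / σ ^ 7) * ‖v‖⁻¹ := by field_simp; ring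
      _ ≤ (3 / 2 * C / σ ^ 5 + 4 * C ^ 2 / σ ^ 7) * (4 * Real.pi * radialKernel Real.pi v) := by
          gcongr
          exact inv_norm_le_radialKernel hv0 (mem_torus_iff.1 hv)
      _ = _ := by ring
  unfold defect
  rw [hsym]
  refine (abs_sub _ _).trans (add_le_add (h.quad_outside hx hc).2 ?_)
  rw [abs_mul, abs_of_pos (by norm_num : (0 : ℝ) < 1 / 2)]
  gcongr

/-- The variation of the defect with `c`, for comparable values of `c`. -/
theorem defect_lip_scale (h : SingularFamily W Q q₀ Q₁ σ C) :
    ∃ K : ℝ, 0 ≤ K ∧ ∀ x ∈ W, ∀ c₁ c₂ : ℝ, 0 < c₁ → c₁ ≤ c₂ → c₂ ≤ 2 * c₁ →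
      c₂ * |defect Q q₀ x c₂ - defect Q q₀ x c₁| ≤ K * (c₂ - c₁) := by
  have hσ := h.pos
  have hC := h.nonneg
  have hpi := Real.pi_pos
  refine ⟨8 * (24 / σ ^ 5 * (4 / Real.pi)) + 8 * (60 * C / σ ^ 7), by positivity,
    fun x hx c₁ c₂ h1 h12 h21 => ?_⟩
  have h2 := h1.trans_le h12
  have h3 := sub_nonneg.2 h12
  have hout : |∫ v in torusᶜ, c₂ * (invCube (c₂ ^ 2 + q₀ x v) - invCube (c₁ ^ 2 + q₀ x v))|
      ≤ 8 * (24 / σ ^ 5 * (4 / Real.pi) * (c₂ - c₁)) := by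
    refine (integral_le_of_radialKernel hpi (by positivity) measurableSet_torus.compl
      (continuous_const.mul ((h.continuous_invCube_quad hx h2).sub
        (h.continuous_invCube_quad hx h1))).aestronglyMeasurable fun v hv hv0 => ?_).2
    have hn : 0 < ‖v‖ := norm_pos_iff.2 hv0
    have hs := h.scale_pos h1 v
    have hq := h.sq_le_quad hx v c₁
    have e := abs_invCube_sub_le hs (hq.trans (by gcongr : c₁ ^ 2 + q₀ x v ≤ c₂ ^ 2 + q₀ x v)) hq
    rw [add_sub_add_right_eq_sub, abs_of_nonneg (by nlinarith : 0 ≤ c₂ ^ 2 - c₁ ^ 2)] at e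
    simp only [Pi.mul_apply, Pi.sub_apply]
    rw [abs_mul, abs_of_pos h2]
    calc _ ≤ c₂ * (3 * (c₂ ^ 2 - c₁ ^ 2) / (σ * (c₁ + ‖v‖)) ^ 5) := by gcongr
      _ = 3 * (c₂ * (c₂ + c₁)) * (c₂ - c₁) / (σ * (c₁ + ‖v‖)) ^ 5 := by ring
      _ ≤ 3 * ((2 * c₁) * (2 * c₁ + 2 * c₁)) * (c₂ - c₁) / (σ * (c₁ + ‖v‖)) ^ 5 := by
          gcongr; linarith
      _ = 24 / σ ^ 5 * (c₂ - c₁) * (c₁ ^ 2 / (c₁ + ‖v‖) ^ 5) := by field_simp; ring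
      _ ≤ 24 / σ ^ 5 * (c₂ - c₁) * ((c₁ + ‖v‖) ^ 2 / (c₁ + ‖v‖) ^ 5) := by
          gcongr; linarith
      _ = 24 / σ ^ 5 * (c₂ - c₁) * ((c₁ + ‖v‖) ^ 3)⁻¹ := by field_simp
      _ ≤ 24 / σ ^ 5 * (c₂ - c₁) * (‖v‖ ^ 3)⁻¹ := by gcongr; linarith
      _ ≤ 24 / σ ^ 5 * (c₂ - c₁) * (4 / Real.pi * radialKernel Real.pi v) := by
          gcongr
          exact inv_norm_cube_le_radialKernel (norm_of_notMem_torus hv)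
      _ = _ := by ring
  have hin : |∫ v in torus, c₂ * ((invCube (c₂ ^ 2 + Q x v) - invCube (c₂ ^ 2 + q₀ x v))
      - (invCube (c₁ ^ 2 + Q x v) - invCube (c₁ ^ 2 + q₀ x v)))|
      ≤ 8 * (60 * C / σ ^ 7 * (c₂ - c₁)) := by
    refine (integral_le_of_radialKernel h1 (by positivity) measurableSet_torus
      ((continuousOn_const.mul (((h.continuousOn_invCube hx h2).sub
        (h.continuous_invCube_quad hx h2).continuousOn).sub ((h.continuousOn_invCube hx h1).sub
        (h.continuous_invCube_quad hx h1).continuousOn))).aestronglyMeasurable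
        measurableSet_torus) fun v hv hv0 => ?_).2
    have hn : 0 < ‖v‖ := norm_pos_iff.2 hv0
    have hs := h.scale_pos h1 v
    have e := abs_invCube_mixed_le hs h1 h12 (h.sq_le hx hv c₁) (h.sq_le_quad hx v c₁)
    simp only [Pi.mul_apply, Pi.sub_apply]
    rw [abs_mul, abs_of_pos h2]
    calc _ ≤ c₂ * (15 * c₂ * |Q x v - q₀ x v| / (σ * (c₁ + ‖v‖)) ^ 7 * (c₂ - c₁)) := by gcongr
      _ ≤ (2 * c₁) * (15 * (2 * c₁) * (C * (c₁ + ‖v‖) ^ 3) / (σ * (c₁ + ‖v‖)) ^ 7 * (c₂ - c₁)) := by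
          have : |Q x v - q₀ x v| ≤ C * (c₁ + ‖v‖) ^ 3 :=
            (h.cubic x hx v hv).trans (by gcongr; linarith)
          gcongr
      _ = 60 * C / σ ^ 7 * (c₂ - c₁) * (c₁ / (c₁ + ‖v‖) ^ 3 * (c₁ / (c₁ + ‖v‖))) := by
          field_simp; ring
      _ ≤ 60 * C / σ ^ 7 * (c₂ - c₁) * (radialKernel c₁ v * 1) := by
          have : c₁ / (c₁ + ‖v‖) ≤ 1 := (div_le_one (by positivity)).2 (by linarith)
          gcongr
          · unfold radialKernel; positivity
          · exact div_cube_le_radialKernel h1 hv0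
      _ = _ := by ring
  have e : c₂ * (defect Q q₀ x c₂ - defect Q q₀ x c₁)
      = (∫ v in torusᶜ, c₂ * (invCube (c₂ ^ 2 + q₀ x v) - invCube (c₁ ^ 2 + q₀ x v)))
        - ∫ v in torus, c₂ * ((invCube (c₂ ^ 2 + Q x v) - invCube (c₂ ^ 2 + q₀ x v))
      - (invCube (c₁ ^ 2 + Q x v) - invCube (c₁ ^ 2 + q₀ x v))) := by
    rw [integral_const_mul, integral_const_mul,
      integral_sub (h.quad_outside hx h2).1 (h.quad_outside hx h1).1,
      integral_sub (h.integrableOn_sub hx h2) (h.integrableOn_sub hx h1)]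
    unfold defect
    ring
  rw [← abs_of_pos h2, ← abs_mul, abs_of_pos h2, e]
  refine (abs_sub _ _).trans ((add_le_add hout hin).trans (le_of_eq (by ring)))

/-- `c` times the defect is Lipschitz in `c`. -/
theorem mul_defect_lip_scale (h : SingularFamily W Q q₀ Q₁ σ C) :
    ∃ K : ℝ, 0 ≤ K ∧ ∀ x ∈ W, ∀ c₁ c₂ : ℝ, 0 < c₁ → c₁ ≤ c₂ →
      |c₂ * defect Q q₀ x c₂ - c₁ * defect Q q₀ x c₁| ≤ K * (c₂ - c₁) := by
  obtain ⟨K, hK, hb⟩ := h.defect_bounded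
  obtain ⟨L, hL, hl⟩ := h.defect_lip_scale
  refine ⟨3 * K + L, by positivity, fun x hx c₁ c₂ h1 h12 => ?_⟩
  have h2 := h1.trans_le h12
  have h3 := sub_nonneg.2 h12
  have b1 := hb c₁ h1 x hx
  have b2 := hb c₂ h2 x hx
  rcases le_total c₂ (2 * c₁) with h21 | h21
  · have e : c₂ * defect Q q₀ x c₂ - c₁ * defect Q q₀ x c₁
        = (c₂ - c₁) * defect Q q₀ x c₁ + c₂ * (defect Q q₀ x c₂ - defect Q q₀ x c₁) := by ring
    rw [e]
    have l := hl x hx c₁ c₂ h1 h12 h21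
    calc _ ≤ (c₂ - c₁) * |defect Q q₀ x c₁| + c₂ * |defect Q q₀ x c₂ - defect Q q₀ x c₁| := by
          refine (abs_add_le _ _).trans_eq ?_
          rw [abs_mul, abs_mul, abs_of_nonneg h3, abs_of_pos h2]
      _ ≤ (c₂ - c₁) * K + L * (c₂ - c₁) := by gcongr
      _ ≤ _ := by nlinarith
  · -- the two values of `c` are far apart: the size of both terms is controlled by `c₂ - c₁`
    calc _ ≤ c₂ * |defect Q q₀ x c₂| + c₁ * |defect Q q₀ x c₁| := by
          refine (abs_sub _ _).trans_eq ?_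
          rw [abs_mul, abs_mul, abs_of_pos h1, abs_of_pos h2]
      _ ≤ c₂ * K + c₁ * K := by gcongr
      _ ≤ 3 * K * (c₂ - c₁) := by nlinarith
      _ ≤ _ := by nlinarith

/-- **The singular part of the averaged derivative.** If `D` is a Lipschitz function and `κ` gives
the integrals of the quadratic parts over the plane, the integral of
`(D D' + Q₁ / 2) (D² + Q) ^ (-3/2)` becomes Lipschitz across `D = 0` once `sgn(D) D' κ` is removed
from it. -/
theorem lipOn_regular_part (h : SingularFamily W Q q₀ Q₁ σ C) {D D' κ : X → ℝ} {M : ℝ}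
    (hD : LipOn D W) (hDb : ∀ x ∈ W, |D x| ≤ M) (hD' : LipOn D' W) (hDb' : ∀ x ∈ W, |D' x| ≤ M)
    (hκ : LipOn κ W) (hκ' : ∀ x ∈ W, ∀ c : ℝ, 0 < c → c * ∫ v, invCube (c ^ 2 + q₀ x v) = κ x) :
    LipOn (fun x => SignType.sign (D x) * D' x * κ x
      - ∫ v in torus, (D x * D' x + 1 / 2 * Q₁ x v) * invCube (D x ^ 2 + Q x v))
      (W ∩ {x | D x ≠ 0}) := by
  have hsub : W ∩ {x | D x ≠ 0} ⊆ W := Set.inter_subset_left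
  -- the term with a numerator of second order
  have hT : LipOn (fun x => ∫ v in torus, Q₁ x v * invCube (|D x| ^ 2 + Q x v))
      (W ∩ {x | D x ≠ 0}) := by
    obtain ⟨K, hK, h1⟩ := h.num_lip_param
    obtain ⟨L, hL, h2⟩ := h.num_lip_scale
    obtain ⟨N, hN, h3⟩ := hD
    refine ⟨K + L * N, by positivity, fun x hx y hy => ?_⟩
    have e1 := h1 |D x| (abs_pos.2 hx.2) x hx.1 y hy.1
    have e2 : |(∫ v in torus, Q₁ y v * invCube (|D x| ^ 2 + Q y v))
        - ∫ v in torus, Q₁ y v * invCube (|D y| ^ 2 + Q y v)| ≤ L * |D x - D y| := by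
      rcases le_total |D y| |D x| with hle | hle
      · refine (h2 y hy.1 _ _ (abs_pos.2 hy.2) hle).trans ?_
        gcongr
        exact abs_sub_abs_le_abs_sub _ _
      · rw [abs_sub_comm, abs_sub_comm (D x)]
        refine (h2 y hy.1 _ _ (abs_pos.2 hx.2) hle).trans ?_
        gcongr
        exact abs_sub_abs_le_abs_sub _ _
    calc _ ≤ K * dist x y + L * |D x - D y| := (abs_sub_le _ _ _).trans (add_le_add e1 e2)
      _ ≤ K * dist x y + L * (N * dist x y) := by gcongr; exact h3 x hx.1 y hy.1
      _ = _ := by ring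
  -- the term with the constant numerator
  obtain ⟨B, hB0, hB⟩ := h.defect_bounded
  have hn : LipOn (fun x => SignType.sign (D x) * (|D x| * defect Q q₀ x |D x|))
      (W ∩ {x | D x ≠ 0}) := by
    obtain ⟨K, hK, h1⟩ := h.invCube_lip_param
    obtain ⟨L, hL, h2⟩ := h.mul_defect_lip_scale
    obtain ⟨N, hN, h3⟩ := hD
    obtain ⟨P, hP, h4⟩ := hκ
    refine ⟨P + K + L * N + B * N, by positivity, fun x hx y hy => ?_⟩
    have hdn : 0 ≤ dist x y := dist_nonneg
    have h3' := h3 x hx.1 y hy.1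
    have hbound : ∀ z ∈ W ∩ {x | D x ≠ 0}, abs (|D z| * defect Q q₀ z |D z|) ≤ B * |D z| := by
      intro z hz
      rw [abs_mul, abs_abs, mul_comm]
      gcongr
      exact hB _ (abs_pos.2 hz.2) z hz.1
    have hsame : abs (|D x| * defect Q q₀ x |D x| - |D y| * defect Q q₀ y |D y|)
        ≤ (P + K + L * N) * dist x y := by
      have hc := abs_pos.2 hx.2
      have e1 : abs (|D x| * defect Q q₀ x |D x| - |D x| * defect Q q₀ y |D x|)
          ≤ (P + K) * dist x y := by
        rw [← h.integral_sub_eq_defect hx.1 hc, ← h.integral_sub_eq_defect hy.1 hc, mul_sub,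
          mul_sub, hκ' x hx.1 _ hc, hκ' y hy.1 _ hc]
        have := h1 _ hc x hx.1 y hy.1
        have h4' := h4 x hx.1 y hy.1
        rw [abs_le] at *
        constructor <;> linarith
      have e2 : abs (|D x| * defect Q q₀ y |D x| - |D y| * defect Q q₀ y |D y|)
          ≤ L * |D x - D y| := by
        rcases le_total |D y| |D x| with hle | hle
        · refine (h2 y hy.1 _ _ (abs_pos.2 hy.2) hle).trans ?_
          gcongr
          exact abs_sub_abs_le_abs_sub _ _
        · rw [abs_sub_comm, abs_sub_comm (D x)]
          refine (h2 y hy.1 _ _ (abs_pos.2 hx.2) hle).trans ?_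
          gcongr
          exact abs_sub_abs_le_abs_sub _ _
      calc _ ≤ (P + K) * dist x y + L * |D x - D y| := (abs_sub_le _ _ _).trans (add_le_add e1 e2)
        _ ≤ (P + K) * dist x y + L * (N * dist x y) := by gcongr
        _ = _ := by ring
    have hle : (P + K + L * N) * dist x y ≤ (P + K + L * N + B * N) * dist x y := by
      rw [add_mul _ (B * N)]
      linarith [mul_nonneg (mul_nonneg hB0 hN) hdn]
    have hb1 := hbound x hx
    have hb2 := hbound y hy
    rcases lt_or_gt_of_ne hx.2 with hx0 | hx0 <;> rcases lt_or_gt_of_ne hy.2 with hy0 | hy0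
    · simp only [sign_neg hx0, sign_neg hy0]
      rw [← mul_sub, abs_mul]
      simpa using hsame.trans hle
    · -- opposite signs: both terms are small
      have h5 : |D x| + |D y| = |D x - D y| := by
        rw [abs_of_neg hx0, abs_of_pos hy0, abs_of_neg (by linarith)]; ring
      simp only [sign_neg hx0, sign_pos hy0]
      calc _ ≤ _ + _ := abs_sub _ _
        _ = abs (|D x| * defect Q q₀ x |D x|) + abs (|D y| * defect Q q₀ y |D y|) := by simp
        _ ≤ B * (|D x| + |D y|) := by linarith
        _ ≤ B * (N * dist x y) := by rw [h5]; gcongr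
        _ ≤ _ := by
          rw [add_mul _ (B * N), mul_assoc B]
          linarith [mul_nonneg (by positivity : 0 ≤ P + K + L * N) hdn]
    · have h5 : |D x| + |D y| = |D x - D y| := by
        rw [abs_of_pos hx0, abs_of_neg hy0, abs_of_pos (by linarith)]; ring
      simp only [sign_pos hx0, sign_neg hy0]
      calc _ ≤ _ + _ := abs_sub _ _
        _ = abs (|D x| * defect Q q₀ x |D x|) + abs (|D y| * defect Q q₀ y |D y|) := by simp
        _ ≤ B * (|D x| + |D y|) := by linarith
        _ ≤ B * (N * dist x y) := by rw [h5]; gcongr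
        _ ≤ _ := by
          rw [add_mul _ (B * N), mul_assoc B]
          linarith [mul_nonneg (by positivity : 0 ≤ P + K + L * N) hdn]
    · simp only [sign_pos hx0, sign_pos hy0]
      rw [← mul_sub, abs_mul]
      simpa using hsame.trans hle
  have hnb : ∀ x ∈ W ∩ {x | D x ≠ 0},
      |SignType.sign (D x) * (|D x| * defect Q q₀ x |D x|)| ≤ M * B := fun x hx => by
    have hs : |((SignType.sign (D x) : SignType) : ℝ)| = 1 := by
      rcases lt_or_gt_of_ne hx.2 with hx0 | hx0
      · simp [sign_neg hx0]
      · simp [sign_pos hx0]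
    rw [abs_mul, hs, one_mul, abs_mul, abs_abs]
    have := hDb x hx.1
    have h0 := (abs_nonneg _).trans this
    gcongr
    exact hB _ (abs_pos.2 hx.2) x hx.1
  refine (((hD'.mono hsub).mul hn (fun x hx => hDb' x hx.1) hnb).sub (hT.const_mul (1 / 2))).congr
    fun x hx => ?_
  have hc := abs_pos.2 hx.2
  have i1 := (h.integrableOn_invCube hx.1 hc).const_mul (D x * D' x)
  have i2 := (h.integrableOn_num hx.1 hc).const_mul (1 / 2)
  have e : ∀ v, (D x * D' x + 1 / 2 * Q₁ x v) * invCube (D x ^ 2 + Q x v)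
      = D x * D' x * invCube (|D x| ^ 2 + Q x v)
        + 1 / 2 * (Q₁ x v * invCube (|D x| ^ 2 + Q x v)) := fun v => by rw [sq_abs]; ring
  simp only [e]
  rw [integral_add i1 i2, integral_const_mul, integral_const_mul,
    ← h.integral_sub_eq_defect hx.1 hc, mul_sub, hκ' x hx.1 _ hc]
  have hsg : D x = SignType.sign (D x) * |D x| := (sign_mul_abs (D x)).symm
  linear_combination (-D' x * ∫ v in torus, invCube (|D x| ^ 2 + Q x v)) * hsg

end SingularFamily

/-! ### The integral of the quadratic model over the plane -/

theorem integral_invCube_circle {c : ℝ} (hc : 0 < c) :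
    ∫ v : Anomalies, invCube (c ^ 2 + (v 0 ^ 2 + v 1 ^ 2)) = 2 * Real.pi / c := by
  have h1 : ∫ v : Anomalies, invCube (c ^ 2 + (v 0 ^ 2 + v 1 ^ 2))
      = ∫ w : EuclideanSpace ℝ (Fin 2), invCube (c ^ 2 + ‖w‖ ^ 2) := by
    rw [← (EuclideanSpace.volume_preserving_symm_measurableEquiv_toLp (Fin 2)).integral_comp
      (MeasurableEquiv.toLp 2 (Fin 2 → ℝ)).symm.measurableEmbedding]
    congr 1
    ext w
    rw [EuclideanSpace.norm_sq_eq]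
    simp
  have hder : ∀ y ∈ Set.Ici (0 : ℝ), HasDerivAt (fun y => -(Real.sqrt (c ^ 2 + y ^ 2))⁻¹)
      (y * invCube (c ^ 2 + y ^ 2)) y := fun y _ => by
    have hp : 0 < c ^ 2 + y ^ 2 := by positivity
    have hs := (Real.sqrt_pos.2 hp).ne'
    have h := ((((hasDerivAt_pow 2 y).const_add (c ^ 2)).sqrt hp.ne').inv hs).neg
    refine h.congr_deriv ?_
    unfold invCube
    field_simp
    push_cast
    ring
  have hnn : ∀ y ∈ Set.Ioi (0 : ℝ), 0 ≤ y * invCube (c ^ 2 + y ^ 2) := fun y hy =>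
    mul_nonneg (le_of_lt hy) (invCube_nonneg _)
  have hlim : Filter.Tendsto (fun y => -(Real.sqrt (c ^ 2 + y ^ 2))⁻¹) Filter.atTop (𝓝 0) := by
    rw [← neg_zero]
    refine (Filter.Tendsto.inv_tendsto_atTop ?_).neg
    refine Filter.tendsto_atTop_mono (fun y => ?_) Filter.tendsto_id
    exact Real.le_sqrt_of_sq_le (by simp only [id]; nlinarith [sq_nonneg c])
  have hb : (volume : Measure (EuclideanSpace ℝ (Fin 2))).real (Metric.ball 0 1) = Real.pi := by
    rw [measureReal_def, EuclideanSpace.volume_ball_fin_two]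
    simp [Real.pi_pos.le]
  have hr := integral_Ioi_of_hasDerivAt_of_nonneg' hder hnn hlim
  rw [h1, integral_fun_norm_addHaar volume (fun y : ℝ => invCube (c ^ 2 + y ^ 2)), hb]
  simp only [finrank_euclideanSpace, Fintype.card_fin, smul_eq_mul, Nat.add_one_sub_one, pow_one,
    nsmul_eq_mul]
  rw [hr]
  simp only [ne_eq, OfNat.ofNat_ne_zero, not_false_eq_true, zero_pow, add_zero,
    Real.sqrt_sq hc.le]
  push_cast
  field_simp
  ring

/-- For a positive definite quadratic form `q`, the integral of `c (c² + q) ^ (-3/2)` over the plane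
does not depend on `c`. -/
theorem integral_invCube_quadratic {a b d c : ℝ} (ha : 0 < a) (hdet : 0 < a * d - b ^ 2)
    (hc : 0 < c) :
    c * ∫ v : Anomalies, invCube (c ^ 2 + (a * v 0 ^ 2 + 2 * b * (v 0 * v 1) + d * v 1 ^ 2))
      = 2 * Real.pi / Real.sqrt (a * d - b ^ 2) := by
  set s := Real.sqrt a with hs
  set t := Real.sqrt (a * d - b ^ 2) with ht
  have hs0 : 0 < s := Real.sqrt_pos.2 ha
  have ht0 : 0 < t := Real.sqrt_pos.2 hdet
  have hs2 : s ^ 2 = a := Real.sq_sqrt ha.le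
  have ht2 : t ^ 2 = a * d - b ^ 2 := Real.sq_sqrt hdet.le
  -- the Cholesky factor of the quadratic form
  set M : Matrix (Fin 2) (Fin 2) ℝ := !![s, b / s; 0, t / s] with hM
  have hMdet : M.det = t := by
    rw [hM, Matrix.det_fin_two_of]; field_simp; ring
  have hmap := Real.map_matrix_volume_pi_eq_smul_volume_pi (M := M) (by rw [hMdet]; exact ht0.ne')
  have hmeas : Measurable fun v : Anomalies => invCube (c ^ 2 + (v 0 ^ 2 + v 1 ^ 2)) :=
    measurable_invCube.comp (by fun_prop)
  have hlin : Measurable (Matrix.toLin' M) :=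
    (LinearMap.continuous_of_finiteDimensional (Matrix.toLin' M)).measurable
  have h := integral_map (μ := volume) hlin.aemeasurable hmeas.aestronglyMeasurable
  rw [hmap, integral_smul_measure, integral_invCube_circle hc, hMdet, abs_of_pos (inv_pos.2 ht0),
    ENNReal.toReal_ofReal (inv_pos.2 ht0).le] at h
  have e : ∀ v : Anomalies, (Matrix.toLin' M v) 0 ^ 2 + (Matrix.toLin' M v) 1 ^ 2
      = a * v 0 ^ 2 + 2 * b * (v 0 * v 1) + d * v 1 ^ 2 := fun v => by
    have hd : d = (t ^ 2 + b ^ 2) / s ^ 2 := by rw [ht2, hs2]; field_simp; ring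
    simp only [Matrix.toLin'_apply, hM, Matrix.mulVec, dotProduct, Fin.sum_univ_two,
      Matrix.of_apply, Matrix.cons_val_zero, Matrix.cons_val_one, Matrix.cons_val', hd, ← hs2,
      Matrix.cons_val_fin_one]
    field_simp
    ring
  simp only [e] at h
  rw [← h, smul_eq_mul]
  field_simp

/-! ### Integrals of periodic functions over the torus -/

namespace TwoOrbit

/-- A function of the two mean anomalies that descends to the torus. -/
def IsTorusPeriodic {F : Type*} (f : Anomalies → F) : Prop :=
  ∀ (V : Anomalies) (i : Fin 2), f (V + Pi.single i (2 * Real.pi)) = f V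

theorem integral_torus_eq_iterated {f : Anomalies → ℝ} (hf : Continuous f) :
    ∫ v in torus, f v = ∫ x in (-Real.pi)..Real.pi, ∫ y in (-Real.pi)..Real.pi, f ![x, y] := by
  have hpi : -Real.pi ≤ Real.pi := by linarith [Real.pi_pos]
  have hpre : torus = MeasurableEquiv.finTwoArrow ⁻¹'
      (Set.Icc (-Real.pi) Real.pi ×ˢ Set.Icc (-Real.pi) Real.pi) := by
    ext v
    simp only [torus, Set.mem_Icc, Pi.le_def, Fin.forall_fin_two, Set.mem_preimage, Set.mem_prod,
      MeasurableEquiv.finTwoArrow_apply]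
    tauto
  have hg : Continuous fun p : ℝ × ℝ => f ![p.1, p.2] := by fun_prop
  have h1 : ∫ v in torus, f v = ∫ p in Set.Icc (-Real.pi) Real.pi ×ˢ Set.Icc (-Real.pi) Real.pi,
      f ![p.1, p.2] := by
    rw [hpre, ← (volume_preserving_finTwoArrow ℝ).setIntegral_preimage_emb
      (MeasurableEquiv.measurableEmbedding _)]
    congr 1
    ext v
    congr 1
    ext i
    fin_cases i <;> rfl
  rw [h1, Measure.volume_eq_prod, setIntegral_prod]
  · rw [intervalIntegral.integral_of_le hpi, integral_Icc_eq_integral_Ioc]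
    congr 1
    ext x
    rw [intervalIntegral.integral_of_le hpi, integral_Icc_eq_integral_Ioc]
  · exact hg.continuousOn.integrableOn_compact (isCompact_Icc.prod isCompact_Icc)

/-- The integral over the torus is invariant under translations. -/
theorem integral_torus_add_left {f : Anomalies → ℝ} (hf : Continuous f) (hp : IsTorusPeriodic f)
    (a : Anomalies) : ∫ v in torus, f (a + v) = ∫ v in torus, f v := by
  have p0 (y : ℝ) : Function.Periodic (fun x => f ![x, y]) (2 * Real.pi) := fun x => by
    refine Eq.trans (congrArg f ?_) (hp ![x, y] 0)
    ext i; fin_cases i <;> simp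
  have p1 (x : ℝ) : Function.Periodic (fun y => f ![x, y]) (2 * Real.pi) := fun y => by
    refine Eq.trans (congrArg f ?_) (hp ![x, y] 1)
    ext i; fin_cases i <;> simp
  have shift (g : ℝ → ℝ) (hg : Function.Periodic g (2 * Real.pi)) (s : ℝ) :
      ∫ x in (-Real.pi)..Real.pi, g (s + x) = ∫ x in (-Real.pi)..Real.pi, g x := by
    rw [intervalIntegral.integral_comp_add_left]
    have := hg.intervalIntegral_add_eq (s + -Real.pi) (-Real.pi)
    have e1 : s + -Real.pi + 2 * Real.pi = s + Real.pi := by ring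
    have e2 : -Real.pi + 2 * Real.pi = Real.pi := by ring
    rwa [e1, e2] at this
  rw [integral_torus_eq_iterated hf, integral_torus_eq_iterated (by fun_prop)]
  have ha (x y : ℝ) : a + ![x, y] = ![a 0 + x, a 1 + y] := by
    ext i; fin_cases i <;> rfl
  simp only [ha]
  have h1 (x : ℝ) : ∫ y in (-Real.pi)..Real.pi, f ![a 0 + x, a 1 + y]
      = ∫ y in (-Real.pi)..Real.pi, f ![a 0 + x, y] := shift _ (p1 (a 0 + x)) (a 1)
  simp only [h1]
  refine shift (fun x => ∫ y in (-Real.pi)..Real.pi, f ![x, y]) (fun x => ?_) (a 0)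
  exact intervalIntegral.integral_congr fun y _ => p0 y x

/-- A directional derivative of a function on the torus has vanishing integral. -/
theorem integral_torus_fderiv_eq_zero {f : Anomalies → ℝ} (hf : ContDiff ℝ 1 f)
    (hp : IsTorusPeriodic f) (w : Anomalies) : ∫ v in torus, fderiv ℝ f v w = 0 := by
  have hle : (fun _ => -Real.pi : Anomalies) ≤ fun _ => Real.pi := fun _ => by
    linarith [Real.pi_pos]
  have hd (v : Anomalies) : HasFDerivAt f (fderiv ℝ f v) v :=
    (hf.differentiable one_ne_zero v).hasFDerivAt
  have hcont : Continuous fun v => fderiv ℝ f v w :=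
    (hf.continuous_fderiv one_ne_zero).clm_apply continuous_const
  have hsum (v : Anomalies) : ∑ i : Fin 2, (w i • fderiv ℝ f v) (Pi.single i 1)
      = fderiv ℝ f v w := by
    conv_rhs => rw [pi_eq_sum_univ' w]
    simp only [map_sum, _root_.smul_apply, map_smul]
  have h := integral_divergence_of_hasFDerivAt_off_countable' (fun _ => -Real.pi)
    (fun _ => Real.pi) hle (fun i v => w i • f v) (fun i v => w i • fderiv ℝ f v) ∅
    Set.countable_empty (fun i => (hf.continuous.const_smul (w i)).continuousOn)
    (fun v _ i => (hd v).const_smul (w i))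
    (by simp only [hsum]; exact hcont.continuousOn.integrableOn_compact isCompact_Icc)
  simp only [hsum] at h
  rw [torus, h]
  refine Finset.sum_eq_zero fun i _ => sub_eq_zero.2 ?_
  congr 1
  ext x
  refine congrArg (w i • ·) (Eq.trans (congrArg f ?_) (hp _ i))
  ext j
  refine Fin.succAboveCases i ?_ (fun l => ?_) j
  · simp; ring
  · simp

end TwoOrbit

/-! ### Taylor estimates that are uniform in a parameter -/

/-- Taylor's formula of order two at a critical point. -/
theorem norm_sub_le_of_second_deriv {F : Type*} [NormedAddCommGroup F] [NormedSpace ℝ F]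
    {g g' g'' : ℝ → F} {M : ℝ} (h1 : ∀ t, HasDerivAt g (g' t) t)
    (h2 : ∀ t, HasDerivAt g' (g'' t) t) (h0 : g' 0 = 0)
    (hM : ∀ t ∈ Set.Icc (0 : ℝ) 1, ‖g'' t‖ ≤ M) : ‖g 1 - g 0‖ ≤ M := by
  have hM0 : 0 ≤ M := (norm_nonneg _).trans (hM 0 ⟨le_rfl, zero_le_one⟩)
  have b1 : ∀ t ∈ Set.Icc (0 : ℝ) 1, ‖g' t‖ ≤ M := fun t ht => by
    have := (convex_Icc (0 : ℝ) 1).norm_image_sub_le_of_norm_hasDerivWithin_le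
      (fun s _ => (h2 s).hasDerivWithinAt) hM ⟨le_rfl, zero_le_one⟩ ht
    rw [h0, sub_zero, sub_zero, Real.norm_of_nonneg ht.1] at this
    nlinarith [ht.2]
  simpa using (convex_Icc (0 : ℝ) 1).norm_image_sub_le_of_norm_hasDerivWithin_le
    (fun s _ => (h1 s).hasDerivWithinAt) b1 ⟨le_rfl, zero_le_one⟩
    (⟨zero_le_one, le_rfl⟩ : (1 : ℝ) ∈ Set.Icc (0 : ℝ) 1)

section Parametric

open TwoOrbit (torus mem_torus_iff isCompact_torus)

variable {X F : Type*} [NormedAddCommGroup X] [NormedSpace ℝ X] [NormedAddCommGroup F]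
  [NormedSpace ℝ F] {K : Set X} {f : X × Anomalies → F}

/-- The second derivative of `f` at `p` in the direction `v` of the second factor, that is the
quadratic form of the partial Hessian. -/
noncomputable def secondV (f : X × Anomalies → F) (p : X × Anomalies) (v : Anomalies) : F :=
  fderiv ℝ (fderiv ℝ f) p (0, v) (0, v)

theorem hasDerivAt_line (x : X) (v : Anomalies) (a t : ℝ) :
    HasDerivAt (fun t : ℝ => (x, (a * t) • v)) (a • ((0 : X), v)) t := by
  have h := (hasDerivAt_const t x).prodMk (((hasDerivAt_id t).const_mul a).smul_const v)
  refine h.congr_deriv ?_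
  simp

theorem ContDiffAt.hasDerivAt_comp_line {f : X × Anomalies → F} {x : X} {v : Anomalies} {a t : ℝ}
    (hf : ContDiffAt ℝ ω f (x, (a * t) • v)) :
    HasDerivAt (fun t : ℝ => f (x, (a * t) • v)) (a • fderiv ℝ f (x, (a * t) • v) (0, v)) t := by
  have h := (hf.differentiableAt (by simp)).hasFDerivAt.comp_hasDerivAt t (hasDerivAt_line x v a t)
  rwa [map_smul] at h

theorem ContDiffAt.fderiv_omega {E : Type*} [NormedAddCommGroup E] [NormedSpace ℝ E] {f : E → F}
    {p : E} (hf : ContDiffAt ℝ ω f p) : ContDiffAt ℝ ω (fderiv ℝ f) p :=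
  hf.fderiv_right (by exact le_top)

theorem ContDiffAt.hasDerivAt_fderiv_comp_line {f : X × Anomalies → F} {x : X} {v : Anomalies}
    {a t : ℝ} (hf : ContDiffAt ℝ ω f (x, (a * t) • v)) :
    HasDerivAt (fun t : ℝ => a • fderiv ℝ f (x, (a * t) • v) (0, v))
      (a ^ 2 • secondV f (x, (a * t) • v) v) t := by
  have h := (hf.fderiv_omega.hasDerivAt_comp_line.clm_apply
    (hasDerivAt_const t ((0 : X), v))).const_smul a
  refine h.congr_deriv ?_
  simp [secondV, smul_smul, sq]

theorem norm_secondV_le {H : X × Anomalies →L[ℝ] X × Anomalies →L[ℝ] F} (v : Anomalies) :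
    ‖H (0, v) (0, v)‖ ≤ ‖H‖ * ‖v‖ ^ 2 := by
  have hn : ‖((0 : X), v)‖ = ‖v‖ := by simp [Prod.norm_def]
  calc _ ≤ ‖H (0, v)‖ * ‖((0 : X), v)‖ := ContinuousLinearMap.le_opNorm _ _
    _ ≤ ‖H‖ * ‖((0 : X), v)‖ * ‖((0 : X), v)‖ := by gcongr; exact ContinuousLinearMap.le_opNorm _ _
    _ = _ := by rw [hn]; ring

theorem smul_mem_torus {v : Anomalies} (hv : v ∈ torus) {t : ℝ} (ht : |t| ≤ 1) :
    t • v ∈ torus := by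
  rw [mem_torus_iff] at *
  rw [norm_smul, Real.norm_eq_abs]
  nlinarith [norm_nonneg v]

theorem abs_le_one_of_mem {t : ℝ} (ht : t ∈ Set.Icc (0 : ℝ) 1) : |t| ≤ 1 := by
  rw [abs_of_nonneg ht.1]; exact ht.2

theorem convex_torus : Convex ℝ torus := convex_Icc _ _

theorem exists_bound_of_contDiffAt (hK : IsCompact K)
    (hf : ∀ x ∈ K, ∀ v, ContDiffAt ℝ ω f (x, v)) :
    ∃ C : ℝ, 0 ≤ C ∧ ∀ x ∈ K, ∀ v ∈ torus, ‖f (x, v)‖ ≤ C := by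
  obtain ⟨C, hC⟩ := (hK.prod isCompact_torus).exists_bound_of_continuousOn (f := f)
    fun p hp => (hf p.1 hp.1 p.2).continuousAt.continuousWithinAt
  exact ⟨|C|, abs_nonneg C, fun x hx v hv => (hC (x, v) ⟨hx, hv⟩).trans (le_abs_self C)⟩

theorem exists_lipschitz_of_contDiffAt (hK : IsCompact K) (hKc : Convex ℝ K)
    (hf : ∀ x ∈ K, ∀ v, ContDiffAt ℝ ω f (x, v)) :
    ∃ C : ℝ, 0 ≤ C ∧ ∀ x ∈ K, ∀ y ∈ K, ∀ v ∈ torus, ∀ w ∈ torus,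
      ‖f (x, v) - f (y, w)‖ ≤ C * max (dist x y) (dist v w) := by
  have hc : ContDiffOn ℝ ω f (K ×ˢ torus) := fun p hp => (hf p.1 hp.1 p.2).contDiffWithinAt
  obtain ⟨C, hC⟩ := hc.exists_lipschitzOnWith (by simp) (hKc.prod convex_torus)
    (hK.prod isCompact_torus)
  refine ⟨C, C.2, fun x hx y hy v hv w hw => ?_⟩
  rw [← dist_eq_norm]
  exact hC.dist_le_mul (x, v) ⟨hx, hv⟩ (y, w) ⟨hy, hw⟩

theorem exists_quadratic_bound (hK : IsCompact K) (hf : ∀ x ∈ K, ∀ v, ContDiffAt ℝ ω f (x, v))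
    (hcrit : ∀ x ∈ K, ∀ v, fderiv ℝ f (x, 0) (0, v) = 0) :
    ∃ C : ℝ, 0 ≤ C ∧ ∀ x ∈ K, ∀ v ∈ torus, ‖f (x, v) - f (x, 0)‖ ≤ C * ‖v‖ ^ 2 := by
  obtain ⟨C, hC0, hC⟩ := exists_bound_of_contDiffAt hK
    (fun x hx v => (hf x hx v).fderiv_omega.fderiv_omega)
  refine ⟨C, hC0, fun x hx v hv => ?_⟩
  have h := norm_sub_le_of_second_deriv (M := C * ‖v‖ ^ 2)
    (fun t => (hf x hx ((1 * t) • v)).hasDerivAt_comp_line)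
    (fun t => (hf x hx ((1 * t) • v)).hasDerivAt_fderiv_comp_line) (by simp [hcrit x hx])
    (fun t ht => by
      rw [one_pow, one_smul, one_mul]
      refine (norm_secondV_le v).trans ?_
      gcongr
      exact hC x hx _ (smul_mem_torus hv (abs_le_one_of_mem ht)))
  simpa using h

theorem exists_quadratic_lipschitz (hK : IsCompact K) (hKc : Convex ℝ K)
    (hf : ∀ x ∈ K, ∀ v, ContDiffAt ℝ ω f (x, v))
    (hcrit : ∀ x ∈ K, ∀ v, fderiv ℝ f (x, 0) (0, v) = 0) :
    ∃ C : ℝ, 0 ≤ C ∧ ∀ x ∈ K, ∀ y ∈ K, ∀ v ∈ torus,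
      ‖(f (x, v) - f (x, 0)) - (f (y, v) - f (y, 0))‖ ≤ C * dist x y * ‖v‖ ^ 2 := by
  obtain ⟨C, hC0, hC⟩ := exists_lipschitz_of_contDiffAt hK hKc
    (fun x hx v => (hf x hx v).fderiv_omega.fderiv_omega)
  refine ⟨C, hC0, fun x hx y hy v hv => ?_⟩
  have h := norm_sub_le_of_second_deriv (M := C * dist x y * ‖v‖ ^ 2)
    (fun t => (hf x hx ((1 * t) • v)).hasDerivAt_comp_line.sub
      (hf y hy ((1 * t) • v)).hasDerivAt_comp_line)
    (fun t => (hf x hx ((1 * t) • v)).hasDerivAt_fderiv_comp_line.sub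
      (hf y hy ((1 * t) • v)).hasDerivAt_fderiv_comp_line) (by simp [hcrit x hx, hcrit y hy])
    (fun t ht => by
      rw [one_pow, one_smul, one_smul, one_mul]
      have := norm_secondV_le (H := fderiv ℝ (fderiv ℝ f) (x, t • v)
        - fderiv ℝ (fderiv ℝ f) (y, t • v)) v
      refine this.trans ?_
      have ht' := smul_mem_torus hv (abs_le_one_of_mem ht)
      have := hC x hx y hy _ ht' _ ht'
      rw [dist_self, max_eq_left dist_nonneg] at this
      gcongr)
  have e : f (x, v) - f (x, 0) - (f (y, v) - f (y, 0))
      = f (x, v) - f (y, v) - (f (x, 0) - f (y, 0)) := by abel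
  rw [e]
  simpa using h

theorem exists_cubic_bound (hK : IsCompact K) (hKc : Convex ℝ K)
    (hf : ∀ x ∈ K, ∀ v, ContDiffAt ℝ ω f (x, v))
    (hcrit : ∀ x ∈ K, ∀ v, fderiv ℝ f (x, 0) (0, v) = 0) :
    ∃ C : ℝ, 0 ≤ C ∧ ∀ x ∈ K, ∀ v ∈ torus,
      ‖(f (x, v) - f (x, 0)) - (1 / 2 : ℝ) • secondV f (x, 0) v‖ ≤ C * ‖v‖ ^ 3 := by
  obtain ⟨C, hC0, hC⟩ := exists_lipschitz_of_contDiffAt hK hKc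
    (fun x hx v => (hf x hx v).fderiv_omega.fderiv_omega)
  refine ⟨C, hC0, fun x hx v hv => ?_⟩
  set S := secondV f (x, 0) v with hS
  have hq (t : ℝ) : HasDerivAt (fun t : ℝ => (1 / 2 * t ^ 2) • S) (t • S) t := by
    have := ((hasDerivAt_pow 2 t).const_mul (1 / 2)).smul_const S
    refine this.congr_deriv ?_
    congr 1; push_cast; ring
  have hq' (t : ℝ) : HasDerivAt (fun t : ℝ => t • S) S t := by
    simpa using (hasDerivAt_id t).smul_const S
  have h := norm_sub_le_of_second_deriv (M := C * ‖v‖ ^ 3)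
    (fun t => (hf x hx ((1 * t) • v)).hasDerivAt_comp_line.sub (hq t))
    (fun t => (hf x hx ((1 * t) • v)).hasDerivAt_fderiv_comp_line.sub (hq' t))
    (by simp [hcrit x hx])
    (fun t ht => by
      rw [one_pow, one_smul, one_mul]
      have := norm_secondV_le (H := fderiv ℝ (fderiv ℝ f) (x, t • v)
        - fderiv ℝ (fderiv ℝ f) (x, 0)) v
      refine this.trans ?_
      have := hC x hx x hx _ (smul_mem_torus hv (abs_le_one_of_mem ht)) 0
        (by rw [mem_torus_iff]; simp [Real.pi_pos.le])
      rw [dist_self, max_eq_right dist_nonneg, dist_zero_right, norm_smul, Real.norm_eq_abs] at this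
      have : ‖fderiv ℝ (fderiv ℝ f) (x, t • v) - fderiv ℝ (fderiv ℝ f) (x, 0)‖ ≤ C * ‖v‖ := by
        refine this.trans ?_
        gcongr
        nlinarith [abs_le_one_of_mem ht, norm_nonneg v]
      calc _ ≤ C * ‖v‖ * ‖v‖ ^ 2 := by gcongr
        _ = _ := by ring)
  have e : f (x, v) - f (x, 0) - (1 / 2 : ℝ) • S = f (x, v) - (1 / 2 : ℝ) • S - f (x, 0) := by abel
  rw [e]
  simpa using h

theorem exists_second_difference_bound (hK : IsCompact K) (hKc : Convex ℝ K)
    (hf : ∀ x ∈ K, ∀ v, ContDiffAt ℝ ω f (x, v)) :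
    ∃ C : ℝ, 0 ≤ C ∧ ∀ x ∈ K, ∀ v ∈ torus,
      ‖f (x, v) + f (x, -v) - (2 : ℝ) • f (x, 0)‖ ≤ C * ‖v‖ ^ 2 := by
  obtain ⟨C, hC0, hC⟩ := exists_lipschitz_of_contDiffAt hK hKc
    (fun x hx v => (hf x hx v).fderiv_omega)
  refine ⟨2 * C, by positivity, fun x hx v hv => ?_⟩
  have h := (convex_Icc (0 : ℝ) 1).norm_image_sub_le_of_norm_hasDerivWithin_le
    (fun t _ => ((hf x hx ((1 * t) • v)).hasDerivAt_comp_line.add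
      (hf x hx ((-1 * t) • v)).hasDerivAt_comp_line).hasDerivWithinAt) (C := 2 * C * ‖v‖ ^ 2)
    (fun t ht => by
      rw [one_smul, neg_one_smul, one_mul, neg_one_mul, ← sub_eq_add_neg,
        ← sub_apply]
      refine (ContinuousLinearMap.le_opNorm _ _).trans ?_
      have hn : ‖((0 : X), v)‖ = ‖v‖ := by simp [Prod.norm_def]
      have ht1 := abs_le_one_of_mem ht
      have := hC x hx x hx _ (smul_mem_torus hv ht1) _
        (smul_mem_torus hv (by rwa [abs_neg] : |-t| ≤ 1))
      rw [dist_self, max_eq_right dist_nonneg, dist_eq_norm, ← sub_smul, norm_smul,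
        Real.norm_eq_abs, sub_neg_eq_add] at this
      have h2 : |t + t| ≤ 2 := (abs_add_le t t).trans (by linarith)
      rw [hn]
      calc _ ≤ C * (2 * ‖v‖) * ‖v‖ := by
            gcongr
            refine this.trans ?_
            gcongr
        _ = _ := by ring)
    ⟨le_rfl, zero_le_one⟩ (⟨zero_le_one, le_rfl⟩ : (1 : ℝ) ∈ Set.Icc (0 : ℝ) 1)
  simpa [two_smul] using h

/-- The even part of `f` agrees with its Taylor polynomial of degree two up to order four. -/
theorem exists_quartic_bound (hK : IsCompact K) (hKc : Convex ℝ K)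
    (hf : ∀ x ∈ K, ∀ v, ContDiffAt ℝ ω f (x, v)) :
    ∃ C : ℝ, 0 ≤ C ∧ ∀ x ∈ K, ∀ v ∈ torus,
      ‖(f (x, v) - f (x, 0)) + (f (x, -v) - f (x, 0)) - secondV f (x, 0) v‖ ≤ C * ‖v‖ ^ 4 := by
  obtain ⟨C, hC0, hC⟩ := exists_second_difference_bound hK hKc
    (fun x hx v => (hf x hx v).fderiv_omega.fderiv_omega)
  refine ⟨C, hC0, fun x hx v hv => ?_⟩
  set S := secondV f (x, 0) v with hS
  have hq (t : ℝ) : HasDerivAt (fun t : ℝ => t ^ 2 • S) ((2 * t) • S) t := by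
    have := (hasDerivAt_pow 2 t).smul_const S
    refine this.congr_deriv ?_
    congr 1; push_cast; ring
  have hq' (t : ℝ) : HasDerivAt (fun t : ℝ => (2 * t) • S) ((2 : ℝ) • S) t := by
    have := ((hasDerivAt_id t).const_mul 2).smul_const S
    rwa [mul_one] at this
  have h := norm_sub_le_of_second_deriv (M := C * ‖v‖ ^ 4)
    (fun t => ((hf x hx ((1 * t) • v)).hasDerivAt_comp_line.add
      (hf x hx ((-1 * t) • v)).hasDerivAt_comp_line).sub (hq t))
    (fun t => ((hf x hx ((1 * t) • v)).hasDerivAt_fderiv_comp_line.add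
      (hf x hx ((-1 * t) • v)).hasDerivAt_fderiv_comp_line).sub (hq' t))
    (by simp)
    (fun t ht => by
      rw [one_pow, neg_one_sq, one_smul, one_smul, one_mul, neg_one_mul, neg_smul]
      have := norm_secondV_le (H := fderiv ℝ (fderiv ℝ f) (x, t • v)
        + fderiv ℝ (fderiv ℝ f) (x, -(t • v)) - (2 : ℝ) • fderiv ℝ (fderiv ℝ f) (x, 0)) v
      refine this.trans ?_
      have ht1 := abs_le_one_of_mem ht
      have := hC x hx _ (smul_mem_torus hv ht1)
      rw [norm_smul, Real.norm_eq_abs] at this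
      calc _ ≤ C * (1 * ‖v‖) ^ 2 * ‖v‖ ^ 2 := by
            gcongr
            refine this.trans ?_
            gcongr
        _ = _ := by ring)
  have e : f (x, v) - f (x, 0) + (f (x, -v) - f (x, 0)) - S
      = f (x, v) + f (x, -v) - S - (f (x, 0) + f (x, 0)) := by abel
  rw [e]
  simpa using h

end Parametric

/-! ### Singular families from non-degenerate minimum points -/

section Parametric

open TwoOrbit (torus mem_torus_iff isCompact_torus)

variable {X : Type*} [NormedAddCommGroup X] [NormedSpace ℝ X]

theorem secondV_smul (f : X × Anomalies → ℝ) (p : X × Anomalies) (a : ℝ) (v : Anomalies) :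
    secondV f p (a • v) = a ^ 2 * secondV f p v := by
  have h : ((0 : X), a • v) = a • ((0 : X), v) := by simp
  simp only [secondV, h, map_smul, _root_.smul_apply, smul_eq_mul]
  ring

theorem secondV_neg (f : X × Anomalies → ℝ) (p : X × Anomalies) (v : Anomalies) :
    secondV f p (-v) = secondV f p v := by
  have := secondV_smul f p (-1) v
  simpa using this

theorem continuous_secondV (f : X × Anomalies → ℝ) (p : X × Anomalies) :
    Continuous (secondV f p) := by
  unfold secondV
  fun_prop

/-- A positive quadratic form on the plane is bounded below by a multiple of the squared norm. -/
theorem exists_secondV_lower {f : X × Anomalies → ℝ} {p : X × Anomalies}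
    (h : ∀ v, v ≠ 0 → 0 < secondV f p v) : ∃ m > 0, ∀ v, m * ‖v‖ ^ 2 ≤ secondV f p v := by
  obtain ⟨u, hu, hmin⟩ := (isCompact_sphere (0 : Anomalies) 1).exists_isMinOn
    (NormedSpace.sphere_nonempty.2 zero_le_one) (continuous_secondV f p).continuousOn
  have hu0 : u ≠ 0 := by
    rintro rfl
    simp at hu
  refine ⟨secondV f p u, h u hu0, fun v => ?_⟩
  by_cases hv : v = 0
  · have h0 : secondV f p 0 = 0 := by simpa using secondV_smul f p 0 0
    simp [hv, h0]
  have hn : ‖v‖ ≠ 0 := norm_ne_zero_iff.2 hv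
  have hmem : ‖v‖⁻¹ • v ∈ Metric.sphere (0 : Anomalies) 1 := by
    simp [norm_smul, hn]
  have := hmin hmem
  simp only [Set.mem_ofPred_eq, secondV_smul] at this
  calc _ ≤ ‖v‖⁻¹ ^ 2 * secondV f p v * ‖v‖ ^ 2 := by gcongr
    _ = _ := by field_simp

theorem fderiv_apply_const {E F : Type*} [NormedAddCommGroup E] [NormedSpace ℝ E]
    [NormedAddCommGroup F] [NormedSpace ℝ F] {f : E → F} {p : E} (hf : ContDiffAt ℝ ω f p)
    (v w : E) : fderiv ℝ (fun q => fderiv ℝ f q v) p w = fderiv ℝ (fderiv ℝ f) p w v := by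
  have hd := hf.fderiv_omega.differentiableAt (by simp)
  rw [(hd.hasFDerivAt.clm_apply (hasFDerivAt_const v p)).fderiv]
  simp

/-- If `0` is a critical point of `f (x, ·)` for all `x` in an open set, it is also a critical point
of the derivatives of `f` with respect to `x`. -/
theorem fderiv_partial_of_crit {f : X × Anomalies → ℝ} {U : Set X} (hU : IsOpen U)
    (hf : ∀ x ∈ U, ∀ v, ContDiffAt ℝ ω f (x, v))
    (hcrit : ∀ x ∈ U, ∀ v, fderiv ℝ f (x, 0) (0, v) = 0) {x : X} (hx : x ∈ U) (e : X)
    (v : Anomalies) :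
    fderiv ℝ (fun p => fderiv ℝ f p (e, 0)) (x, 0) (0, v) = 0 := by
  have hsymm := (hf x hx 0).isSymmSndFDerivAt_of_omega
  rw [fderiv_apply_const (hf x hx 0), hsymm.eq (0, v) (e, 0),
    ← fderiv_apply_const (hf x hx 0)]
  set g : X × Anomalies → ℝ := fun q => fderiv ℝ f q (0, v) with hg
  have hd : HasFDerivAt g (fderiv ℝ g (x, 0)) (x, 0) :=
    (((hf x hx 0).fderiv_omega.clm_apply contDiffAt_const).differentiableAt (by simp)).hasFDerivAt
  have hc : HasFDerivAt (fun y => g (y, 0))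
      ((fderiv ℝ g (x, 0)).comp ((ContinuousLinearMap.id ℝ X).prod 0)) x :=
    HasFDerivAt.comp (f := fun y => (y, (0 : Anomalies))) x hd
      ((hasFDerivAt_id x).prodMk (hasFDerivAt_const 0 x))
  have h3 : (fun y => g (y, 0)) =ᶠ[𝓝 x] fun _ => 0 := by
    filter_upwards [hU.mem_nhds hx] with y hy using hcrit y hy v
  have h4 := hc.unique ((hasFDerivAt_const (0 : ℝ) x).congr_of_eventuallyEq h3)
  simpa using congrArg (fun L => L e) h4

/-- A non-degenerate strict minimum point at `x₀`, continued by a critical point near `x₀`, gives a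
singular family near `x₀`; the neighbourhood and the lower bound are the same for all directions `e`
of differentiation. -/
theorem exists_singularFamily [FiniteDimensional ℝ X] {P : X × Anomalies → ℝ} {U : Set X}
    (hU : IsOpen U) {x₀ : X} (hx₀ : x₀ ∈ U) (hP : ∀ x ∈ U, ∀ v, ContDiffAt ℝ ω P (x, v))
    (hcrit : ∀ x ∈ U, ∀ v, fderiv ℝ P (x, 0) (0, v) = 0)
    (hpos : ∀ v ∈ torus, v ≠ 0 → P (x₀, 0) < P (x₀, v))
    (hnd : ∀ v, v ≠ 0 → 0 < secondV P (x₀, 0) v) :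
    ∃ r > 0, Metric.closedBall x₀ r ⊆ U ∧ ∃ σ : ℝ, ∀ e : X, ∃ C : ℝ,
      SingularFamily (Metric.closedBall x₀ r) (fun x v => P (x, v) - P (x, 0))
        (fun x v => 1 / 2 * secondV P (x, 0) v)
        (fun x v => fderiv ℝ P (x, v) (e, 0) - fderiv ℝ P (x, 0) (e, 0)) σ C := by
  have hprop : ProperSpace X := FiniteDimensional.proper_real X
  have hpi := Real.pi_pos
  obtain ⟨r₀, hr₀, hball⟩ := Metric.nhds_basis_closedBall.mem_iff.1 (hU.mem_nhds hx₀)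
  have hK : IsCompact (Metric.closedBall x₀ r₀) := isCompact_closedBall x₀ r₀
  have hKc : Convex ℝ (Metric.closedBall x₀ r₀) := convex_closedBall x₀ r₀
  have hPK : ∀ x ∈ Metric.closedBall x₀ r₀, ∀ v, ContDiffAt ℝ ω P (x, v) :=
    fun x hx => hP x (hball hx)
  have hcK : ∀ x ∈ Metric.closedBall x₀ r₀, ∀ v, fderiv ℝ P (x, 0) (0, v) = 0 :=
    fun x hx => hcrit x (hball hx)
  have hmem₀ : x₀ ∈ Metric.closedBall x₀ r₀ := Metric.mem_closedBall_self hr₀.le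
  obtain ⟨C₁, hC₁, h₁⟩ := exists_quadratic_lipschitz hK hKc hPK hcK
  obtain ⟨C₂, hC₂, h₂⟩ := exists_cubic_bound hK hKc hPK hcK
  obtain ⟨C₃, hC₃, h₃⟩ := exists_quartic_bound hK hKc hPK
  obtain ⟨C₄, hC₄, h₄⟩ := exists_lipschitz_of_contDiffAt hK hKc
    (fun x hx v => (hPK x hx v).fderiv_omega.fderiv_omega)
  obtain ⟨m, hm, hmq⟩ := exists_secondV_lower hnd
  -- the lower bound at `x₀`, near and away from the minimum point
  have hlow : ∃ m' > 0, ∀ v ∈ torus, m' * ‖v‖ ^ 2 ≤ P (x₀, v) - P (x₀, 0) := by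
    set ρ := m / (4 * (C₂ + 1)) with hρ
    have hρ0 : 0 < ρ := by positivity
    have hcontP : Continuous fun v => P (x₀, v) - P (x₀, 0) :=
      (continuous_iff_continuousAt.2 fun v => (hP x₀ hx₀ v).continuousAt.comp
        (f := fun v => (x₀, v)) (by fun_prop)).sub continuous_const
    have hTc : IsCompact (torus ∩ {v | ρ ≤ ‖v‖}) :=
      isCompact_torus.inter_right (isClosed_le continuous_const continuous_norm)
    obtain ⟨m₁, hm₁, hfar⟩ : ∃ m₁ > 0, ∀ v ∈ torus ∩ {v | ρ ≤ ‖v‖},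
        m₁ ≤ P (x₀, v) - P (x₀, 0) := by
      rcases (torus ∩ {v | ρ ≤ ‖v‖}).eq_empty_or_nonempty with he | hne
      · exact ⟨1, one_pos, by simp [he]⟩
      · obtain ⟨u, hu, hmin⟩ := hTc.exists_isMinOn hne hcontP.continuousOn
        have hu0 : u ≠ 0 := norm_pos_iff.1 (hρ0.trans_le hu.2)
        exact ⟨_, sub_pos.2 (hpos u hu.1 hu0), fun v hv => hmin hv⟩
    refine ⟨min (m / 4) (m₁ / Real.pi ^ 2), by positivity, fun v hv => ?_⟩
    rcases le_total ρ ‖v‖ with hv' | hv'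
    · have hvpi := mem_torus_iff.1 hv
      calc _ ≤ m₁ / Real.pi ^ 2 * Real.pi ^ 2 := by
            gcongr
            exact min_le_right _ _
        _ = m₁ := by field_simp
        _ ≤ _ := hfar v ⟨hv, hv'⟩
    · have hc := (abs_le.1 (h₂ x₀ hmem₀ v hv)).1
      have hq := hmq v
      rw [smul_eq_mul] at hc
      have hC : C₂ * ‖v‖ ≤ m / 4 := by
        calc C₂ * ‖v‖ ≤ (C₂ + 1) * ρ := by gcongr; linarith
          _ = m / 4 := by rw [hρ]; field_simp
      have hC' : C₂ * ‖v‖ ^ 3 ≤ m / 4 * ‖v‖ ^ 2 := by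
        calc C₂ * ‖v‖ ^ 3 = C₂ * ‖v‖ * ‖v‖ ^ 2 := by ring
          _ ≤ _ := by gcongr
      calc _ ≤ m / 4 * ‖v‖ ^ 2 := by gcongr; exact min_le_left _ _
        _ ≤ _ := by linarith
  obtain ⟨m', hm', hlow⟩ := hlow
  set r := min r₀ (min (m' / (2 * (C₁ + 1))) (m / (2 * (C₄ + 1)))) with hr
  have hr0 : 0 < r := by positivity
  have hrr : r ≤ r₀ := min_le_left _ _
  have hr1 : C₁ * r ≤ m' / 2 := by
    calc C₁ * r ≤ (C₁ + 1) * (m' / (2 * (C₁ + 1))) := by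
          gcongr
          · linarith
          · exact (min_le_right _ _).trans (min_le_left _ _)
      _ = m' / 2 := by field_simp
  have hr2 : C₄ * r ≤ m / 2 := by
    calc C₄ * r ≤ (C₄ + 1) * (m / (2 * (C₄ + 1))) := by
          gcongr
          · linarith
          · exact (min_le_right _ _).trans (min_le_right _ _)
      _ = m / 2 := by field_simp
  have hsub : Metric.closedBall x₀ r ⊆ Metric.closedBall x₀ r₀ :=
    Metric.closedBall_subset_closedBall hrr
  set κ := min (1 / 2) (min (m' / 2) (m / 4)) with hκ
  have hκ0 : 0 < κ := by positivity
  have hκ1 : κ ≤ 1 / 2 := min_le_left _ _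
  have hκ2 : κ ≤ m' / 2 := (min_le_right _ _).trans (min_le_left _ _)
  have hκ3 : κ ≤ m / 4 := (min_le_right _ _).trans (min_le_right _ _)
  have hκκ : 2 * κ ^ 2 ≤ κ := by nlinarith
  have h0t : (0 : Anomalies) ∈ torus := by rw [mem_torus_iff]; simp [hpi.le]
  refine ⟨r, hr0, hsub.trans hball, κ, fun e => ?_⟩
  have hN : ∀ x ∈ Metric.closedBall x₀ r₀, ∀ v,
      ContDiffAt ℝ ω (fun p => fderiv ℝ P p (e, 0)) (x, v) := fun x hx v =>
    (hPK x hx v).fderiv_omega.clm_apply contDiffAt_const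
  have hNc : ∀ x ∈ Metric.closedBall x₀ r₀, ∀ v,
      fderiv ℝ (fun p => fderiv ℝ P p (e, 0)) (x, 0) (0, v) = 0 := fun x hx v =>
    fderiv_partial_of_crit hU hP hcrit (hball hx) e v
  obtain ⟨C₅, hC₅, h₅⟩ := exists_quadratic_bound hK hN hNc
  obtain ⟨C₆, hC₆, h₆⟩ := exists_quadratic_lipschitz hK hKc hN hNc
  set C := C₁ + C₂ + C₃ + C₅ + C₆ with hC
  have hC1 : C₁ ≤ C := by linarith
  have hC2 : C₂ ≤ C := by linarith
  have hC3 : C₃ ≤ C := by linarith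
  have hC5 : C₅ ≤ C := by linarith
  have hC6 : C₆ ≤ C := by linarith
  have hcontf {g : X × Anomalies → ℝ} {x : X} (hg : ∀ v, ContDiffAt ℝ ω g (x, v)) :
      Continuous fun v => g (x, v) :=
    continuous_iff_continuousAt.2 fun v => (hg v).continuousAt.comp
      (f := fun v => (x, v)) (by fun_prop)
  refine ⟨C, hκ0, hκ1, by positivity, fun x hx => (hcontf (hPK x (hsub hx))).sub continuous_const,
    fun x hx => continuous_const.mul (continuous_secondV P (x, 0)),
    fun x hx => (hcontf (hN x (hsub hx))).sub continuous_const, fun x hx v hv => ?_,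
    fun x hx v => ?_, fun x hx v => by simp only [secondV_neg], fun x hx y hy v hv => ?_,
    fun x hx v hv => ?_, fun x hx v hv => ?_, fun x hx v hv => ?_, fun x hx y hy v hv => ?_⟩
  · have hd : dist x x₀ ≤ r := hx
    have h := (abs_le.1 (h₁ x (hsub hx) x₀ hmem₀ v hv)).1
    have hb : C₁ * dist x x₀ * ‖v‖ ^ 2 ≤ m' / 2 * ‖v‖ ^ 2 := by
      gcongr
      exact (mul_le_mul_of_nonneg_left hd hC₁).trans hr1
    have hk : 2 * κ ^ 2 * ‖v‖ ^ 2 ≤ m' / 2 * ‖v‖ ^ 2 := by gcongr; linarith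
    have := hlow v hv
    linarith
  · have hd : dist x x₀ ≤ r := hx
    have h := h₄ x (hsub hx) x₀ hmem₀ 0 h0t 0 h0t
    rw [dist_self, max_eq_left dist_nonneg] at h
    have h' : |secondV P (x, 0) v - secondV P (x₀, 0) v| ≤ m / 2 * ‖v‖ ^ 2 := by
      refine (norm_secondV_le (H := fderiv ℝ (fderiv ℝ P) (x, 0)
        - fderiv ℝ (fderiv ℝ P) (x₀, 0)) v).trans ?_
      gcongr
      exact h.trans ((mul_le_mul_of_nonneg_left hd hC₄).trans hr2)
    have := (abs_le.1 h').1
    have hk : 2 * κ ^ 2 * ‖v‖ ^ 2 ≤ m / 4 * ‖v‖ ^ 2 := by gcongr; linarith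
    have := hmq v
    linarith
  · exact (h₁ x (hsub hx) y (hsub hy) v hv).trans (by gcongr)
  · exact (h₂ x (hsub hx) v hv).trans (by gcongr)
  · have e : P (x, v) - P (x, 0) + (P (x, -v) - P (x, 0)) - 2 * (1 / 2 * secondV P (x, 0) v)
        = P (x, v) - P (x, 0) + (P (x, -v) - P (x, 0)) - secondV P (x, 0) v := by ring
    rw [e]
    exact (h₃ x (hsub hx) v hv).trans (by gcongr)
  · exact (h₅ x (hsub hx) v hv).trans (by gcongr)
  · exact (h₆ x (hsub hx) y (hsub hy) v hv).trans (by gcongr)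

end Parametric

/-! ### The distance function of two Keplerian orbits -/

namespace TwoOrbit

/-- `Δ` as a function of the configuration and the mean anomalies jointly. -/
noncomputable def jointDelta (k : ℝ) (p : TwoOrbit × Anomalies) : Space := delta k p.1 p.2

/-- `d²` as a function of the configuration and the mean anomalies jointly. -/
noncomputable def distSq (k : ℝ) (p : TwoOrbit × Anomalies) : ℝ := dist k p.1 p.2 ^ 2

/-- The direction of the coordinate `y_j` in the space of two-orbit configurations. -/
def yDir (j : Fin 4) : TwoOrbit := (Pi.single j.succ 1, 0)

theorem isOpen_domain : IsOpen domain := Delaunay.isOpen_domain.prod Delaunay.isOpen_domain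

theorem contDiffAt_fst_position (k : ℝ) {E : TwoOrbit} (hE : E ∈ domain) (V : Anomalies) :
    ContDiffAt ℝ ω (fun p : TwoOrbit × Anomalies => Delaunay.position k p.1.1 (p.2 0)) (E, V) :=
  ContDiffAt.comp (f := fun p : TwoOrbit × Anomalies => (p.1.1, p.2 0)) (E, V)
    (Delaunay.contDiffAt_position k hE.1 (V 0))
    (contDiffAt_fst.fst.prodMk (((contDiff_apply ℝ ℝ (0 : Fin 2)).comp contDiff_snd).contDiffAt))

theorem contDiffAt_snd_position (k : ℝ) {E : TwoOrbit} (hE : E ∈ domain) (V : Anomalies) :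
    ContDiffAt ℝ ω (fun p : TwoOrbit × Anomalies => Delaunay.position k p.1.2 (p.2 1)) (E, V) :=
  ContDiffAt.comp (f := fun p : TwoOrbit × Anomalies => (p.1.2, p.2 1)) (E, V)
    (Delaunay.contDiffAt_position k hE.2 (V 1))
    (contDiffAt_fst.snd.prodMk (((contDiff_apply ℝ ℝ (1 : Fin 2)).comp contDiff_snd).contDiffAt))

theorem contDiffAt_jointDelta (k : ℝ) {E : TwoOrbit} (hE : E ∈ domain) (V : Anomalies) :
    ContDiffAt ℝ ω (jointDelta k) (E, V) :=
  (contDiffAt_fst_position k hE V).sub (contDiffAt_snd_position k hE V)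

theorem contDiffAt_distSq (k : ℝ) {E : TwoOrbit} (hE : E ∈ domain) (V : Anomalies) :
    ContDiffAt ℝ ω (distSq k) (E, V) :=
  (contDiffAt_jointDelta k hE V).norm_sq ℝ

theorem delta_periodic (k : ℝ) {E : TwoOrbit} (hE : E ∈ domain) : IsTorusPeriodic (delta k E) := by
  intro V i
  have h1 := Delaunay.position_periodic k hE.1 (V 0)
  have h2 := Delaunay.position_periodic k hE.2 (V 1)
  fin_cases i <;> simp [delta, h1, h2]

/-- A fundamental domain of the torus may be centred at any point. -/
theorem exists_torus_delta_eq (k : ℝ) {E : TwoOrbit} (hE : E ∈ domain) (V V₀ : Anomalies) :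
    ∃ v ∈ torus, delta k E V = delta k E (V₀ + v) := by
  have hp : 0 < 2 * Real.pi := by positivity
  obtain ⟨y₀, hy₀, e₀⟩ := (Delaunay.position_periodic k hE.1).exists_mem_Ico hp (V 0)
    (V₀ 0 - Real.pi)
  obtain ⟨y₁, hy₁, e₁⟩ := (Delaunay.position_periodic k hE.2).exists_mem_Ico hp (V 1)
    (V₀ 1 - Real.pi)
  refine ⟨![y₀ - V₀ 0, y₁ - V₀ 1], ?_, ?_⟩
  · rw [torus, Set.mem_Icc]
    constructor <;> intro i <;> fin_cases i <;> simp <;> linarith [hy₀.1, hy₀.2, hy₁.1, hy₁.2]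
  · simp [delta, e₀, e₁]

theorem partialV_eq {g : TwoOrbit × Anomalies → ℝ} {E : TwoOrbit} {V : Anomalies}
    (hg : DifferentiableAt ℝ g (E, V)) (i : Fin 2) :
    partialV i (fun U => g (E, U)) V = fderiv ℝ g (E, V) (0, Pi.single i 1) := by
  have h1 : HasDerivAt (fun s : ℝ => (E, Function.update V i s)) (0, Pi.single i 1) (V i) :=
    (hasDerivAt_const _ _).prodMk (hasDerivAt_update V i (V i))
  have h2 : HasFDerivAt g (fderiv ℝ g (E, V)) (E, Function.update V i (V i)) := by
    rw [Function.update_eq_self]; exact hg.hasFDerivAt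
  exact (h2.comp_hasDerivAt _ h1).deriv

theorem setY_getY (j : Fin 4) (E : TwoOrbit) : setY j E (getY j E) = E := by
  simp [setY, getY]

theorem hasDerivAt_setY (j : Fin 4) (E : TwoOrbit) (t : ℝ) :
    HasDerivAt (setY j E) (yDir j) t :=
  (hasDerivAt_update E.1 j.succ t).prodMk (hasDerivAt_const t E.2)

theorem hasDerivAt_comp_setY {F : Type} [NormedAddCommGroup F] [NormedSpace ℝ F] {g : TwoOrbit → F}
    {E : TwoOrbit} (hg : DifferentiableAt ℝ g E) (j : Fin 4) :
    HasDerivAt (fun s : ℝ => g (setY j E s)) (fderiv ℝ g E (yDir j)) (getY j E) := by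
  have h2 : HasFDerivAt g (fderiv ℝ g E) (setY j E (getY j E)) := by
    rw [setY_getY]; exact hg.hasFDerivAt
  exact h2.comp_hasDerivAt _ (hasDerivAt_setY j E _)

theorem partialY_eq {F : Type} [NormedAddCommGroup F] [NormedSpace ℝ F] {g : TwoOrbit → F}
    {E : TwoOrbit} (hg : DifferentiableAt ℝ g E) (j : Fin 4) :
    partialY j g E = fderiv ℝ g E (yDir j) :=
  (hasDerivAt_comp_setY hg j).deriv

theorem fderiv_fst_slice {F : Type*} [NormedAddCommGroup F] [NormedSpace ℝ F]
    {g : TwoOrbit × Anomalies → F} {E : TwoOrbit} {V : Anomalies}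
    (hg : DifferentiableAt ℝ g (E, V)) (e : TwoOrbit) :
    DifferentiableAt ℝ (fun E₁ => g (E₁, V)) E ∧
      fderiv ℝ (fun E₁ => g (E₁, V)) E e = fderiv ℝ g (E, V) (e, 0) := by
  have h : HasFDerivAt (fun E₁ => g (E₁, V)) _ E :=
    HasFDerivAt.comp (f := fun y => (y, V)) E hg.hasFDerivAt
      ((hasFDerivAt_id E).prodMk (hasFDerivAt_const V E))
  exact ⟨h.differentiableAt, by rw [h.fderiv]; simp⟩

theorem fderiv_snd_slice {F : Type*} [NormedAddCommGroup F] [NormedSpace ℝ F]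
    {g : TwoOrbit × Anomalies → F} {E : TwoOrbit} {V : Anomalies}
    (hg : DifferentiableAt ℝ g (E, V)) (w : Anomalies) :
    fderiv ℝ (fun U => g (E, U)) V w = fderiv ℝ g (E, V) (0, w) := by
  have h : HasFDerivAt (fun U => g (E, U)) _ V :=
    HasFDerivAt.comp (f := fun y => (E, y)) V hg.hasFDerivAt
      ((hasFDerivAt_const E V).prodMk (hasFDerivAt_id V))
  rw [h.fderiv]; simp

theorem isCritical_iff (k : ℝ) {E : TwoOrbit} (hE : E ∈ domain) (V : Anomalies) :
    IsCritical k E V ↔ ∀ w, fderiv ℝ (distSq k) (E, V) (0, w) = 0 := by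
  have hd := (contDiffAt_distSq k hE V).differentiableAt (by simp)
  have h (i : Fin 2) : partialV i (fun U => dist k E U ^ 2) V
      = fderiv ℝ (distSq k) (E, V) (0, Pi.single i 1) := partialV_eq hd i
  unfold IsCritical
  simp only [h]
  constructor
  · intro hi w
    have hw : ((0 : TwoOrbit), w) = w 0 • ((0 : TwoOrbit), Pi.single 0 1)
        + w 1 • ((0 : TwoOrbit), Pi.single 1 1) := by
      ext i
      · simp
      · simp
      · fin_cases i <;> simp
    rw [hw, map_add, map_smul, map_smul, hi, hi]
    simp
  · exact fun hw i => hw _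

theorem hessian_apply (k : ℝ) {E : TwoOrbit} (hE : E ∈ domain) (V : Anomalies) (i j : Fin 2) :
    hessian k E V i j
      = fderiv ℝ (fderiv ℝ (distSq k)) (E, V) (0, Pi.single i 1) (0, Pi.single j 1) := by
  have h1 : partialV j (fun U => dist k E U ^ 2)
      = fun U => fderiv ℝ (distSq k) (E, U) (0, Pi.single j 1) := by
    ext U
    exact partialV_eq ((contDiffAt_distSq k hE U).differentiableAt (by simp)) j
  have hc := contDiffAt_distSq k hE V
  rw [hessian, Matrix.of_apply, h1, partialV_eq (g := fun p => fderiv ℝ (distSq k) p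
    (0, Pi.single j 1)) ((hc.fderiv_omega.clm_apply contDiffAt_const).differentiableAt (by simp)),
    fderiv_apply_const hc]

theorem hessian_symm (k : ℝ) {E : TwoOrbit} (hE : E ∈ domain) (V : Anomalies) (i j : Fin 2) :
    hessian k E V i j = hessian k E V j i := by
  rw [hessian_apply k hE, hessian_apply k hE,
    (contDiffAt_distSq k hE V).isSymmSndFDerivAt_of_omega.eq]

/-- The quadratic form of the Hessian matrix, in coordinates. -/
theorem secondV_distSq (k : ℝ) {E : TwoOrbit} (hE : E ∈ domain) (V w : Anomalies) :
    1 / 2 * secondV (distSq k) (E, V) w = matA k E V 0 0 * w 0 ^ 2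
      + 2 * matA k E V 0 1 * (w 0 * w 1) + matA k E V 1 1 * w 1 ^ 2 := by
  have hw : ((0 : TwoOrbit), w) = w 0 • ((0 : TwoOrbit), Pi.single 0 1)
      + w 1 • ((0 : TwoOrbit), Pi.single 1 1) := by
    ext i
    · simp
    · simp
    · fin_cases i <;> simp
  have hs := hessian_symm k hE V 1 0
  simp only [secondV, matA, Matrix.smul_apply, smul_eq_mul, hw, map_add, map_smul,
    _root_.add_apply, _root_.smul_apply, ← hessian_apply k hE]
  rw [hs]
  ring

theorem det_matA (k : ℝ) {E : TwoOrbit} (hE : E ∈ domain) (V : Anomalies) :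
    (matA k E V).det = matA k E V 0 0 * matA k E V 1 1 - matA k E V 0 1 ^ 2 := by
  rw [Matrix.det_fin_two]
  have : matA k E V 1 0 = matA k E V 0 1 := by
    simp only [matA, Matrix.smul_apply, hessian_symm k hE V 1 0]
  rw [this]; ring

/-- A matrix `𝒜` whose quadratic form is positive definite has positive entries on the diagonal and
positive determinant. -/
theorem matA_pos (k : ℝ) {E : TwoOrbit} (hE : E ∈ domain) (V : Anomalies)
    (h : ∀ w, w ≠ 0 → 0 < secondV (distSq k) (E, V) w) :
    0 < matA k E V 0 0 ∧ 0 < (matA k E V).det := by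
  have h0 : 0 < matA k E V 0 0 := by
    have := h (Pi.single 0 1) (by simp)
    have e := secondV_distSq k hE V (Pi.single 0 1)
    simp at e
    linarith
  refine ⟨h0, ?_⟩
  have h1 := h ![-matA k E V 0 1, matA k E V 0 0] (fun hz => h0.ne' (congrFun hz 1))
  have e := secondV_distSq k hE V ![-matA k E V 0 1, matA k E V 0 0]
  simp only [Matrix.cons_val_zero, Matrix.cons_val_one] at e
  have e2 : matA k E V 0 0 * (matA k E V).det = 1 / 2 * secondV (distSq k) (E, V)
      ![-matA k E V 0 1, matA k E V 0 0] := by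
    rw [e, det_matA k hE]; ring
  exact pos_of_mul_pos_right (by linarith : 0 < matA k E V 0 0 * (matA k E V).det) h0.le

/-! ### Tangent vectors and the vector `τ₃` -/

theorem fderiv_jointDelta_zero (k : ℝ) {E : TwoOrbit} (hE : E ∈ domain) (V : Anomalies) :
    fderiv ℝ (jointDelta k) (E, V) (0, Pi.single 0 1) = deriv (Delaunay.position k E.1) (V 0) := by
  have h1 : HasDerivAt (fun s : ℝ => (E, Function.update V 0 s)) (0, Pi.single 0 1) (V 0) :=
    (hasDerivAt_const _ _).prodMk (hasDerivAt_update V 0 (V 0))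
  have h2 : HasFDerivAt (jointDelta k) (fderiv ℝ (jointDelta k) (E, V))
      (E, Function.update V 0 (V 0)) := by
    rw [Function.update_eq_self]
    exact ((contDiffAt_jointDelta k hE V).differentiableAt (by simp)).hasFDerivAt
  have h3 := (h2.comp_hasDerivAt _ h1).add_const (Delaunay.position k E.2 (V 1))
  rw [← h3.deriv]
  congr 1
  ext1 s
  simp [jointDelta, delta]

theorem fderiv_jointDelta_one (k : ℝ) {E : TwoOrbit} (hE : E ∈ domain) (V : Anomalies) :
    fderiv ℝ (jointDelta k) (E, V) (0, Pi.single 1 1) = -deriv (Delaunay.position k E.2) (V 1) := by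
  have h1 : HasDerivAt (fun s : ℝ => (E, Function.update V 1 s)) (0, Pi.single 1 1) (V 1) :=
    (hasDerivAt_const _ _).prodMk (hasDerivAt_update V 1 (V 1))
  have h2 : HasFDerivAt (jointDelta k) (fderiv ℝ (jointDelta k) (E, V))
      (E, Function.update V 1 (V 1)) := by
    rw [Function.update_eq_self]
    exact ((contDiffAt_jointDelta k hE V).differentiableAt (by simp)).hasFDerivAt
  have h3 := (h2.comp_hasDerivAt _ h1).const_sub (Delaunay.position k E.1 (V 0))
  rw [← neg_neg (fderiv ℝ (jointDelta k) (E, V) (0, Pi.single 1 1)), ← h3.deriv]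
  congr 2
  ext1 s
  simp [jointDelta, delta]

theorem fderiv_jointDelta_snd (k : ℝ) {E : TwoOrbit} (hE : E ∈ domain) (V w : Anomalies) :
    fderiv ℝ (jointDelta k) (E, V) (0, w) = w 0 • deriv (Delaunay.position k E.1) (V 0)
      - w 1 • deriv (Delaunay.position k E.2) (V 1) := by
  have hw : ((0 : TwoOrbit), w) = w 0 • ((0 : TwoOrbit), Pi.single 0 1)
      + w 1 • ((0 : TwoOrbit), Pi.single 1 1) := by
    ext i
    · simp
    · simp
    · fin_cases i <;> simp
  rw [hw, map_add, map_smul, map_smul, fderiv_jointDelta_zero k hE, fderiv_jointDelta_one k hE,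
    smul_neg, ← sub_eq_add_neg]

theorem fderiv_distSq (k : ℝ) {E : TwoOrbit} (hE : E ∈ domain) (V : Anomalies)
    (u : TwoOrbit × Anomalies) : fderiv ℝ (distSq k) (E, V) u
      = 2 * inner ℝ (delta k E V) (fderiv ℝ (jointDelta k) (E, V) u) := by
  have hd := ((contDiffAt_jointDelta k hE V).differentiableAt (by simp)).hasFDerivAt
  have h : HasFDerivAt (distSq k) _ (E, V) := hd.norm_sq
  rw [h.fderiv]
  simp [jointDelta]

/-- At a crossing point the second derivative of `d²` is the Gram form of the tangent vectors. -/
theorem fderiv_fderiv_distSq_of_crossing (k : ℝ) {E : TwoOrbit} (hE : E ∈ domain) {V : Anomalies}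
    (h0 : delta k E V = 0) (u w : TwoOrbit × Anomalies) :
    fderiv ℝ (fderiv ℝ (distSq k)) (E, V) u w
      = 2 * inner ℝ (fderiv ℝ (jointDelta k) (E, V) u) (fderiv ℝ (jointDelta k) (E, V) w) := by
  have hc := contDiffAt_jointDelta k hE V
  rw [← fderiv_apply_const (contDiffAt_distSq k hE V)]
  have hev : (fun q => fderiv ℝ (distSq k) q w)
      =ᶠ[𝓝 (E, V)] fun q => 2 * inner ℝ (jointDelta k q) (fderiv ℝ (jointDelta k) q w) := by
    have : ∀ᶠ q : TwoOrbit × Anomalies in 𝓝 (E, V), q.1 ∈ domain :=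
      continuousAt_fst.eventually_mem (isOpen_domain.mem_nhds hE)
    filter_upwards [this] with q hq using fderiv_distSq k hq q.2 w
  rw [hev.fderiv_eq]
  have h1 := (hc.differentiableAt (by simp)).hasFDerivAt
  have h2 := ((hc.fderiv_omega.clm_apply (contDiffAt_const (c := w))).differentiableAt
    (by simp)).hasFDerivAt
  rw [((h1.inner ℝ h2).const_mul 2).fderiv]
  simp [jointDelta, h0]

end TwoOrbit

/-! ### The normal vector of two tangent vectors -/

/-- The cross product in Euclidean space. -/
noncomputable def spaceCross (a b : Space) : Space :=
  WithLp.toLp 2 (crossProduct (WithLp.ofLp a) (WithLp.ofLp b))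

theorem space_inner_eq (a b : Space) : inner ℝ a b = a 0 * b 0 + a 1 * b 1 + a 2 * b 2 := by
  simp [PiLp.inner_apply, Fin.sum_univ_three, mul_comm]

theorem spaceCross_apply (a b : Space) :
    spaceCross a b 0 = a 1 * b 2 - a 2 * b 1 ∧ spaceCross a b 1 = a 2 * b 0 - a 0 * b 2 ∧
      spaceCross a b 2 = a 0 * b 1 - a 1 * b 0 := by
  simp [spaceCross, cross_apply]

theorem inner_spaceCross_left (a b : Space) : inner ℝ (spaceCross a b) a = 0 := by
  obtain ⟨h0, h1, h2⟩ := spaceCross_apply a b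
  rw [space_inner_eq, h0, h1, h2]; ring

theorem inner_spaceCross_right (a b : Space) : inner ℝ (spaceCross a b) b = 0 := by
  obtain ⟨h0, h1, h2⟩ := spaceCross_apply a b
  rw [space_inner_eq, h0, h1, h2]; ring

theorem norm_sq_spaceCross (a b : Space) :
    ‖spaceCross a b‖ ^ 2 = inner ℝ a a * inner ℝ b b - inner ℝ a b ^ 2 := by
  obtain ⟨h0, h1, h2⟩ := spaceCross_apply a b
  rw [← real_inner_self_eq_norm_sq]
  simp only [space_inner_eq, h0, h1, h2]; ring

/-- A vector orthogonal to `a` and `b` is parallel to their cross product. -/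
theorem inner_spaceCross_sq {a b v : Space} (ha : inner ℝ v a = 0) (hb : inner ℝ v b = 0) :
    inner ℝ (spaceCross a b) v ^ 2 = ‖spaceCross a b‖ ^ 2 * ‖v‖ ^ 2 := by
  obtain ⟨h0, h1, h2⟩ := spaceCross_apply a b
  have key : ‖spaceCross a b‖ ^ 2 * ‖v‖ ^ 2 - inner ℝ (spaceCross a b) v ^ 2
      = inner ℝ v a ^ 2 * inner ℝ b b - 2 * (inner ℝ v a * inner ℝ v b) * inner ℝ a b
        + inner ℝ v b ^ 2 * inner ℝ a a := by
    rw [← real_inner_self_eq_norm_sq, ← real_inner_self_eq_norm_sq]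
    simp only [space_inner_eq, h0, h1, h2]; ring
  rw [ha, hb] at key
  linarith

theorem ContDiffAt.spaceCross {E : Type*} [NormedAddCommGroup E] [NormedSpace ℝ E] {f g : E → Space}
    {x : E} (hf : ContDiffAt ℝ ω f x) (hg : ContDiffAt ℝ ω g x) :
    ContDiffAt ℝ ω (fun y => spaceCross (f y) (g y)) x := by
  rw [contDiffAt_euclidean] at *
  intro i
  fin_cases i
  · simpa only [(spaceCross_apply _ _).1, Fin.zero_eta] using
      ((hf 1).mul (hg 2)).sub ((hf 2).mul (hg 1))
  · simpa only [(spaceCross_apply _ _).2.1, Fin.mk_one] using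
      ((hf 2).mul (hg 0)).sub ((hf 0).mul (hg 2))
  · simpa only [(spaceCross_apply _ _).2.2, Fin.reduceFinMk] using
      ((hf 0).mul (hg 1)).sub ((hf 1).mul (hg 0))

namespace TwoOrbit

theorem tau3_eq (k : ℝ) (E : TwoOrbit) (V : Anomalies) : tau3 k E V
    = spaceCross (deriv (Delaunay.position k E.1) (V 0)) (deriv (Delaunay.position k E.2) (V 1)) :=
  rfl

theorem contDiffAt_tau3 (k : ℝ) {E : TwoOrbit} (hE : E ∈ domain) (V : Anomalies) :
    ContDiffAt ℝ ω (fun p : TwoOrbit × Anomalies => tau3 k p.1 p.2) (E, V) := by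
  have hc := (contDiffAt_jointDelta k hE V).fderiv_omega
  have h := (hc.clm_apply
    (contDiffAt_const (c := ((0 : TwoOrbit), (Pi.single 0 1 : Anomalies))))).spaceCross
    (hc.clm_apply (contDiffAt_const (c := ((0 : TwoOrbit), (Pi.single 1 1 : Anomalies))))).neg
  refine h.congr_of_eventuallyEq ?_
  have : ∀ᶠ q : TwoOrbit × Anomalies in 𝓝 (E, V), q.1 ∈ domain :=
    continuousAt_fst.eventually_mem (isOpen_domain.mem_nhds hE)
  filter_upwards [this] with q hq
  rw [tau3_eq, ← fderiv_jointDelta_zero k hq, ← neg_neg (deriv (Delaunay.position k q.1.2) (q.2 1)),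
    ← fderiv_jointDelta_one k hq]

/-! ### Crossing points -/

theorem delta_eq_zero_of_dist {k : ℝ} {E : TwoOrbit} {V : Anomalies} (h : dist k E V = 0) :
    delta k E V = 0 := norm_eq_zero.1 h

theorem isCritical_of_crossing (k : ℝ) {E : TwoOrbit} (hE : E ∈ domain) {V : Anomalies}
    (h0 : delta k E V = 0) : IsCritical k E V := by
  rw [isCritical_iff k hE]
  intro w
  rw [fderiv_distSq k hE, h0, inner_zero_left, mul_zero]

/-- At a non-degenerate crossing point the Hessian of `d²` is positive definite. -/
theorem secondV_pos_of_crossing (k : ℝ) {E : TwoOrbit} (hE : E ∈ domain) {V : Anomalies}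
    (h0 : delta k E V = 0) (hdet : (hessian k E V).det ≠ 0) (w : Anomalies) (hw : w ≠ 0) :
    0 < secondV (distSq k) (E, V) w := by
  have e := fderiv_fderiv_distSq_of_crossing k hE h0 (0, w) (0, w)
  rw [real_inner_self_eq_norm_sq] at e
  rw [secondV, e]
  suffices h : fderiv ℝ (jointDelta k) (E, V) (0, w) ≠ 0 by
    have := norm_pos_iff.2 h
    positivity
  intro hz
  refine hdet (Matrix.exists_mulVec_eq_zero_iff.1 ⟨w, hw, ?_⟩)
  have hws : ((0 : TwoOrbit), w) = w 0 • ((0 : TwoOrbit), Pi.single 0 1)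
      + w 1 • ((0 : TwoOrbit), Pi.single 1 1) := by
    ext i
    · simp
    · simp
    · fin_cases i <;> simp
  ext i
  have e2 := fderiv_fderiv_distSq_of_crossing k hE h0 (0, Pi.single i 1) (0, w)
  rw [hz, inner_zero_right, mul_zero, hws, map_add, map_smul, map_smul, ← hessian_apply k hE,
    ← hessian_apply k hE, smul_eq_mul, smul_eq_mul] at e2
  simp only [Matrix.mulVec, dotProduct, Fin.sum_univ_two, Pi.zero_apply]
  linarith

theorem tau3_ne_zero_of_crossing (k : ℝ) {E : TwoOrbit} (hE : E ∈ domain) {V : Anomalies}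
    (h0 : delta k E V = 0) (hdet : (hessian k E V).det ≠ 0) : tau3 k E V ≠ 0 := by
  intro hz
  refine hdet ?_
  have hn := norm_sq_spaceCross (deriv (Delaunay.position k E.1) (V 0))
    (deriv (Delaunay.position k E.2) (V 1))
  rw [← tau3_eq, hz, norm_zero] at hn
  rw [Matrix.det_fin_two]
  simp only [hessian_apply k hE, fderiv_fderiv_distSq_of_crossing k hE h0, fderiv_jointDelta_zero k hE,
    fderiv_jointDelta_one k hE, inner_neg_left, inner_neg_right]
  rw [real_inner_comm (deriv (Delaunay.position k E.1) (V 0))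
    (deriv (Delaunay.position k E.2) (V 1))]
  linear_combination (-4) * hn

/-- The critical point of `d²(E, ·)` continuing a non-degenerate one, from the implicit function
theorem. -/
theorem exists_critical_continuation (k : ℝ) {E₀ : TwoOrbit} (hE : E₀ ∈ domain) {V₀ : Anomalies}
    (hcrit : ∀ w, fderiv ℝ (distSq k) (E₀, V₀) (0, w) = 0)
    (hpos : ∀ w, w ≠ 0 → 0 < secondV (distSq k) (E₀, V₀) w) :
    ∃ Vh : TwoOrbit → Anomalies, ContDiffAt ℝ ω Vh E₀ ∧ Vh E₀ = V₀ ∧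
      ∀ᶠ E in 𝓝 E₀, ∀ w, fderiv ℝ (distSq k) (E, Vh E) (0, w) = 0 := by
  set G : TwoOrbit × Anomalies → (Anomalies →L[ℝ] ℝ) := fun p =>
    (fderiv ℝ (distSq k) p).comp (ContinuousLinearMap.inr ℝ TwoOrbit Anomalies) with hG
  have hc := contDiffAt_distSq k hE V₀
  have hGc : ContDiffAt ℝ ω G (E₀, V₀) := hc.fderiv_omega.clm_comp contDiffAt_const
  have hGapp (w v : Anomalies) : fderiv ℝ G (E₀, V₀) (0, w) v
      = fderiv ℝ (fderiv ℝ (distSq k)) (E₀, V₀) (0, w) (0, v) := by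
    have hd := (hc.fderiv_omega.differentiableAt (by simp)).hasFDerivAt
    rw [hG, (hd.clm_comp (hasFDerivAt_const _ _)).fderiv]
    simp
  have hinv : (fderiv ℝ G (E₀, V₀) ∘L .inr ℝ TwoOrbit Anomalies).IsInvertible := by
    set L := fderiv ℝ G (E₀, V₀) ∘L .inr ℝ TwoOrbit Anomalies with hL
    have hinj : Function.Injective (L : Anomalies →ₗ[ℝ] (Anomalies →L[ℝ] ℝ)) := by
      refine (injective_iff_map_eq_zero _).2 fun w hw => ?_
      by_contra hne
      have h1 : L w w = 0 := by
        have : L w = 0 := hw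
        rw [this]; rfl
      have h2 : L w w = secondV (distSq k) (E₀, V₀) w := by
        rw [secondV, ← hGapp]; simp [hL]
      exact (hpos w hne).ne' (h2.symm.trans h1)
    have hfin : Module.finrank ℝ Anomalies = Module.finrank ℝ (Anomalies →L[ℝ] ℝ) := by
      rw [← (LinearMap.toContinuousLinearMap (𝕜 := ℝ) (E := Anomalies) (F' := ℝ)).finrank_eq,
        Module.finrank_linearMap_self]
    refine ⟨(LinearEquiv.ofInjectiveOfFinrankEq _ hinj hfin).toContinuousLinearEquiv, ?_⟩
    ext w v
    rfl
  refine ⟨hGc.implicitFunction (by simp) hinv, hGc.contDiffAt_implicitFunction (by simp) hinv,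
    hGc.implicitFunction_apply_self (by simp) hinv, ?_⟩
  filter_upwards [hGc.eventually_apply_implicitFunction (by simp) hinv] with E hE' w
  have h0 : G (E₀, V₀) w = 0 := by simpa [hG] using hcrit w
  rw [← hE'] at h0
  simpa [hG] using h0

/-! ### The signed distance at a critical point -/

theorem signedDist_eq (k : ℝ) (E : TwoOrbit) (V : Anomalies) :
    signedDist k E V = inner ℝ (tau3Hat k E V) (delta k E V) := by
  unfold signedDist deltaHat dist
  by_cases h : delta k E V = 0
  · simp [h]
  · rw [real_inner_smul_right]
    have := norm_ne_zero_iff.2 h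
    field_simp

theorem norm_tau3Hat {k : ℝ} {E : TwoOrbit} {V : Anomalies} (h : tau3 k E V ≠ 0) :
    ‖tau3Hat k E V‖ = 1 := by
  rw [tau3Hat, norm_smul, norm_inv, norm_norm, inv_mul_cancel₀ (norm_ne_zero_iff.2 h)]

theorem inner_tau3Hat_fderiv (k : ℝ) {E : TwoOrbit} (hE : E ∈ domain) (V w : Anomalies) :
    inner ℝ (tau3Hat k E V) (fderiv ℝ (jointDelta k) (E, V) (0, w)) = 0 := by
  rw [tau3Hat, fderiv_jointDelta_snd k hE, real_inner_smul_left, inner_sub_right,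
    real_inner_smul_right, real_inner_smul_right, tau3_eq, inner_spaceCross_left,
    inner_spaceCross_right]
  simp

/-- At a critical point of the distance, `Δ` is normal to both orbits. -/
theorem signedDist_sq (k : ℝ) {E : TwoOrbit} (hE : E ∈ domain) {V : Anomalies}
    (hcrit : ∀ w, fderiv ℝ (distSq k) (E, V) (0, w) = 0) (htau : tau3 k E V ≠ 0) :
    signedDist k E V ^ 2 = dist k E V ^ 2 := by
  have ha := hcrit (Pi.single 0 1)
  have hb := hcrit (Pi.single 1 1)
  rw [fderiv_distSq k hE, fderiv_jointDelta_zero k hE] at ha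
  rw [fderiv_distSq k hE, fderiv_jointDelta_one k hE, inner_neg_right] at hb
  have h := inner_spaceCross_sq (a := deriv (Delaunay.position k E.1) (V 0))
    (b := deriv (Delaunay.position k E.2) (V 1)) (v := delta k E V) (by linarith) (by linarith)
  rw [← tau3_eq] at h
  have hn := norm_ne_zero_iff.2 htau
  rw [signedDist_eq, tau3Hat, real_inner_smul_left, mul_pow, h, dist]
  field_simp

theorem delta_eq_signedDist_smul (k : ℝ) {E : TwoOrbit} (hE : E ∈ domain) {V : Anomalies}
    (hcrit : ∀ w, fderiv ℝ (distSq k) (E, V) (0, w) = 0) (htau : tau3 k E V ≠ 0) :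
    delta k E V = signedDist k E V • tau3Hat k E V := by
  have h1 := signedDist_sq k hE hcrit htau
  have h2 : ‖delta k E V - signedDist k E V • tau3Hat k E V‖ ^ 2 = 0 := by
    rw [norm_sub_sq_real, real_inner_smul_right, real_inner_comm, ← signedDist_eq, norm_smul,
      norm_tau3Hat htau, mul_one, Real.norm_eq_abs, sq_abs]
    unfold dist at h1
    linarith
  exact sub_eq_zero.1 (norm_eq_zero.1 (pow_eq_zero_iff two_ne_zero |>.1 h2))

theorem contDiffAt_tau3Hat (k : ℝ) {E : TwoOrbit} (hE : E ∈ domain) {V : Anomalies}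
    (htau : tau3 k E V ≠ 0) :
    ContDiffAt ℝ ω (fun p : TwoOrbit × Anomalies => tau3Hat k p.1 p.2) (E, V) := by
  have h := contDiffAt_tau3 k hE V
  exact ((h.norm ℝ htau).inv (norm_ne_zero_iff.2 htau)).smul h

/-- The signed distance along a family of critical points, and its derivatives: only the explicit
dependence of `Δ` on the elements contributes. -/
theorem hasFDerivAt_signedDist (k : ℝ) {E : TwoOrbit} (hE : E ∈ domain) {Vh : TwoOrbit → Anomalies}
    (hV : ContDiffAt ℝ ω Vh E) (hcrit : ∀ w, fderiv ℝ (distSq k) (E, Vh E) (0, w) = 0)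
    (htau : tau3 k E (Vh E) ≠ 0) :
    ContDiffAt ℝ ω (fun E₁ => signedDist k E₁ (Vh E₁)) E ∧
      ∀ e, fderiv ℝ (fun E₁ => signedDist k E₁ (Vh E₁)) E e
        = inner ℝ (tau3Hat k E (Vh E)) (fderiv ℝ (jointDelta k) (E, Vh E) (e, 0)) := by
  have hpair : ContDiffAt ℝ ω (fun E₁ => (E₁, Vh E₁)) E := contDiffAt_id.prodMk hV
  have ht : ContDiffAt ℝ ω (fun E₁ => tau3Hat k E₁ (Vh E₁)) E :=
    ContDiffAt.comp (f := fun E₁ => (E₁, Vh E₁)) E (contDiffAt_tau3Hat k hE htau) hpair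
  have hδ : ContDiffAt ℝ ω (fun E₁ => jointDelta k (E₁, Vh E₁)) E :=
    ContDiffAt.comp (f := fun E₁ => (E₁, Vh E₁)) E (contDiffAt_jointDelta k hE (Vh E)) hpair
  have heq : (fun E₁ => signedDist k E₁ (Vh E₁))
      = fun E₁ => inner ℝ (tau3Hat k E₁ (Vh E₁)) (jointDelta k (E₁, Vh E₁)) := by
    ext E₁; exact signedDist_eq k E₁ (Vh E₁)
  rw [heq]
  refine ⟨ht.inner ℝ hδ, fun e => ?_⟩
  have htd := ht.differentiableAt (by simp)
  have hpd := (hV.differentiableAt (by simp)).hasFDerivAt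
  have hδd : HasFDerivAt (fun E₁ => jointDelta k (E₁, Vh E₁)) _ E :=
    HasFDerivAt.comp (f := fun E₁ => (E₁, Vh E₁)) E
      ((contDiffAt_jointDelta k hE (Vh E)).differentiableAt (by simp)).hasFDerivAt
      ((hasFDerivAt_id E).prodMk hpd)
  rw [(htd.hasFDerivAt.inner ℝ hδd).fderiv]
  -- the derivative of a unit vector is orthogonal to it
  have horth :
      inner ℝ (tau3Hat k E (Vh E)) (fderiv ℝ (fun E₁ => tau3Hat k E₁ (Vh E₁)) E e) = 0 := by
    have hone : (fun E₁ => ‖tau3Hat k E₁ (Vh E₁)‖ ^ 2) =ᶠ[𝓝 E] fun _ => 1 := by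
      have hcont : ContinuousAt (fun E₁ => tau3 k E₁ (Vh E₁)) E :=
        ContinuousAt.comp (f := fun E₁ => (E₁, Vh E₁)) (contDiffAt_tau3 k hE (Vh E)).continuousAt
          hpair.continuousAt
      filter_upwards [hcont.eventually_ne htau] with E₁ h1
      rw [norm_tau3Hat h1, one_pow]
    have h1 := (htd.hasFDerivAt.norm_sq).unique
      ((hasFDerivAt_const (1 : ℝ) E).congr_of_eventuallyEq hone)
    have h2 := congrArg (fun L => L e) h1
    simpa using h2
  have hsplit : fderiv ℝ (jointDelta k) (E, Vh E) (e, fderiv ℝ Vh E e)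
      = fderiv ℝ (jointDelta k) (E, Vh E) (e, 0)
        + fderiv ℝ (jointDelta k) (E, Vh E) (0, fderiv ℝ Vh E e) := by
    rw [← map_add]; simp
  have hΔ : jointDelta k (E, Vh E) = signedDist k E (Vh E) • tau3Hat k E (Vh E) :=
    delta_eq_signedDist_smul k hE hcrit htau
  simp only [ContinuousLinearMap.comp_apply, ContinuousLinearMap.prod_apply, fderivInnerCLM_apply,
    ContinuousLinearMap.coe_id', id_eq]
  rw [hsplit, inner_add_right, inner_tau3Hat_fderiv k hE, hΔ, real_inner_smul_right,
    real_inner_comm _ (fderiv ℝ (fun E₁ => tau3Hat k E₁ (Vh E₁)) E e), horth]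
  ring

/-! ### The squared distance in coordinates centred at the minimum point -/

/-- `d²` as a function of the configuration and of the displacement from the point `Vh`. -/
noncomputable def shiftedSq (k : ℝ) (Vh : TwoOrbit → Anomalies) (p : TwoOrbit × Anomalies) : ℝ :=
  distSq k (p.1, Vh p.1 + p.2)

/-- `1/d` as a function of the configuration and the mean anomalies jointly. -/
noncomputable def invDist (k : ℝ) (p : TwoOrbit × Anomalies) : ℝ := 1 / dist k p.1 p.2

/-- The indirect part of the perturbing function. -/
noncomputable def indirect (k : ℝ) (p : TwoOrbit × Anomalies) : ℝ :=
  inner ℝ (Delaunay.position k p.1.1 (p.2 0)) (Delaunay.position k p.1.2 (p.2 1))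
    / ‖Delaunay.position k p.1.2 (p.2 1)‖ ^ 3

variable {k : ℝ} {E : TwoOrbit} {Vh : TwoOrbit → Anomalies}

theorem fderiv_comp_shift {g : TwoOrbit × Anomalies → ℝ} {v : Anomalies}
    (hV : DifferentiableAt ℝ Vh E) (hg : DifferentiableAt ℝ g (E, Vh E + v))
    (e : TwoOrbit) (w : Anomalies) :
    fderiv ℝ (fun p : TwoOrbit × Anomalies => g (p.1, Vh p.1 + p.2)) (E, v) (e, w)
      = fderiv ℝ g (E, Vh E + v) (e, fderiv ℝ Vh E e + w) := by
  have h1 : HasFDerivAt (fun p : TwoOrbit × Anomalies => Vh p.1) _ (E, v) :=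
    HasFDerivAt.comp (f := Prod.fst) (E, v) hV.hasFDerivAt hasFDerivAt_fst
  have h : HasFDerivAt (fun p : TwoOrbit × Anomalies => g (p.1, Vh p.1 + p.2)) _ (E, v) :=
    HasFDerivAt.comp (f := fun p : TwoOrbit × Anomalies => (p.1, Vh p.1 + p.2)) (E, v)
      hg.hasFDerivAt (hasFDerivAt_fst.prodMk (h1.add hasFDerivAt_snd))
  rw [h.fderiv]
  simp

theorem contDiffAt_comp_shift {g : TwoOrbit × Anomalies → ℝ} {v : Anomalies}
    (hV : ContDiffAt ℝ ω Vh E) (hg : ContDiffAt ℝ ω g (E, Vh E + v)) :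
    ContDiffAt ℝ ω (fun p : TwoOrbit × Anomalies => g (p.1, Vh p.1 + p.2)) (E, v) :=
  ContDiffAt.comp (f := fun p : TwoOrbit × Anomalies => (p.1, Vh p.1 + p.2)) (E, v) hg
    (contDiffAt_fst.prodMk (hV.fst'.add contDiffAt_snd))

theorem contDiffAt_shiftedSq (hE : E ∈ domain) (hV : ContDiffAt ℝ ω Vh E) (v : Anomalies) :
    ContDiffAt ℝ ω (shiftedSq k Vh) (E, v) :=
  contDiffAt_comp_shift hV (contDiffAt_distSq k hE (Vh E + v))

theorem fderiv_shiftedSq (hE : E ∈ domain) (hV : ContDiffAt ℝ ω Vh E) (v : Anomalies)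
    (e : TwoOrbit) (w : Anomalies) : fderiv ℝ (shiftedSq k Vh) (E, v) (e, w)
      = fderiv ℝ (distSq k) (E, Vh E + v) (e, fderiv ℝ Vh E e + w) :=
  fderiv_comp_shift (hV.differentiableAt (by simp))
    ((contDiffAt_distSq k hE (Vh E + v)).differentiableAt (by simp)) e w

theorem secondV_shiftedSq (hE : E ∈ domain) (hV : ContDiffAt ℝ ω Vh E) (w : Anomalies) :
    secondV (shiftedSq k Vh) (E, 0) w = secondV (distSq k) (E, Vh E) w := by
  have hd := contDiffAt_distSq k hE (Vh E + 0)
  rw [secondV, secondV, ← fderiv_apply_const (contDiffAt_shiftedSq hE hV 0)]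
  have hev : (fun q => fderiv ℝ (shiftedSq k Vh) q (0, w)) =ᶠ[𝓝 (E, (0 : Anomalies))]
      fun q => fderiv ℝ (distSq k) (q.1, Vh q.1 + q.2) (0, w) := by
    have h1 : ∀ᶠ q : TwoOrbit × Anomalies in 𝓝 (E, 0), q.1 ∈ domain :=
      continuousAt_fst.eventually_mem (isOpen_domain.mem_nhds hE)
    have h2 : ∀ᶠ q : TwoOrbit × Anomalies in 𝓝 (E, 0), ContDiffAt ℝ ω Vh q.1 :=
      continuousAt_fst.eventually (hV.eventually (by simp))
    filter_upwards [h1, h2] with q hq1 hq2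
    rw [fderiv_shiftedSq hq1 hq2]
    simp
  rw [hev.fderiv_eq, fderiv_comp_shift (g := fun q => fderiv ℝ (distSq k) q (0, w))
    (hV.differentiableAt (by simp))
    ((hd.fderiv_omega.clm_apply contDiffAt_const).differentiableAt (by simp)),
    fderiv_apply_const hd]
  simp

theorem fderiv_shiftedSq_zero (hE : E ∈ domain) (hV : ContDiffAt ℝ ω Vh E)
    (hcrit : ∀ w, fderiv ℝ (distSq k) (E, Vh E) (0, w) = 0) (w : Anomalies) :
    fderiv ℝ (shiftedSq k Vh) (E, 0) (0, w) = 0 := by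
  rw [fderiv_shiftedSq hE hV]
  simpa using hcrit w

/-! ### Averages of derivatives of the inverse distance -/

theorem contDiffAt_invDist (hE : E ∈ domain) {V : Anomalies} (h : dist k E V ≠ 0) :
    ContDiffAt ℝ ω (invDist k) (E, V) :=
  contDiffAt_const.div ((contDiffAt_jointDelta k hE V).norm ℝ (norm_ne_zero_iff.1 h)) h

theorem fderiv_invDist (hE : E ∈ domain) {V : Anomalies} (h : dist k E V ≠ 0)
    (u : TwoOrbit × Anomalies) : fderiv ℝ (invDist k) (E, V) u
      = -(1 / 2) * fderiv ℝ (distSq k) (E, V) u * invCube (distSq k (E, V)) := by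
  have hpos : 0 < distSq k (E, V) := by
    have : 0 ≤ dist k E V := norm_nonneg _
    unfold distSq
    positivity
  have hf : invDist k = fun p => (Real.sqrt (distSq k p))⁻¹ := by
    ext p
    rw [invDist, distSq, Real.sqrt_sq (show 0 ≤ dist k p.1 p.2 from norm_nonneg _), one_div]
  have h1 : HasDerivAt (fun t => (Real.sqrt t)⁻¹) (-(1 / 2) * invCube (distSq k (E, V)))
      (distSq k (E, V)) := by
    have hs := (Real.sqrt_pos.2 hpos).ne'
    refine ((Real.hasDerivAt_sqrt hpos.ne').inv hs).congr_deriv ?_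
    unfold invCube
    field_simp
  have h2 := h1.comp_hasFDerivAt (E, V)
    ((contDiffAt_distSq k hE V).differentiableAt (by simp)).hasFDerivAt
  have h3 : HasFDerivAt (invDist k)
      ((-(1 / 2) * invCube (distSq k (E, V))) • fderiv ℝ (distSq k) (E, V)) (E, V) := by
    rw [hf]
    exact h2
  rw [h3.fderiv]
  simp only [_root_.smul_apply, smul_eq_mul]
  ring

theorem continuous_slice {F : Type*} [TopologicalSpace F] {g : TwoOrbit × Anomalies → F}
    (hg : ∀ V, ContinuousAt g (E, V)) : Continuous fun V => g (E, V) :=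
  continuous_iff_continuousAt.2 fun V => (hg V).comp (f := fun V => (E, V)) (by fun_prop)

theorem continuous_fderiv_invDist (hE : E ∈ domain) (h : ∀ V, dist k E V ≠ 0)
    (u : TwoOrbit × Anomalies) : Continuous fun V => fderiv ℝ (invDist k) (E, V) u :=
  continuous_slice (g := fun p => fderiv ℝ (invDist k) p u) fun V =>
    ((contDiffAt_invDist hE (h V)).fderiv_omega.clm_apply contDiffAt_const).continuousAt

theorem dist_periodic (hE : E ∈ domain) : IsTorusPeriodic (dist k E) := fun V i => by
  rw [dist, dist, delta_periodic k hE V i]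

/-- The average of `∂(1/d)/∂E` may be computed in coordinates centred at `Vh E`, with the total
derivative along the family `Vh`: the additional term is a derivative on the torus. -/
theorem integral_fderiv_invDist (hE : E ∈ domain) (hV : ContDiffAt ℝ ω Vh E)
    (h : ∀ V, dist k E V ≠ 0) (e : TwoOrbit) :
    ∫ V in torus, fderiv ℝ (invDist k) (E, V) (e, 0)
      = -∫ v in torus, 1 / 2 * fderiv ℝ (shiftedSq k Vh) (E, v) (e, 0)
          * invCube (shiftedSq k Vh (E, v)) := by
  set w := fderiv ℝ Vh E e with hw
  have hdiff (V : Anomalies) : DifferentiableAt ℝ (invDist k) (E, V) :=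
    (contDiffAt_invDist hE (h V)).differentiableAt (by simp)
  have hc (u : TwoOrbit × Anomalies) : Continuous fun V => fderiv ℝ (invDist k) (E, V) u :=
    continuous_fderiv_invDist hE h u
  have hper (e : TwoOrbit) : IsTorusPeriodic fun V => fderiv ℝ (invDist k) (E, V) (e, 0) := by
    intro V i
    simp only [← (fderiv_fst_slice (hdiff _) e).2]
    have hev : (fun E₁ => invDist k (E₁, V + Pi.single i (2 * Real.pi)))
        =ᶠ[𝓝 E] fun E₁ => invDist k (E₁, V) := by
      filter_upwards [isOpen_domain.mem_nhds hE] with E₁ h1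
      simp only [invDist, dist_periodic h1 V i]
    rw [hev.fderiv_eq]
  -- the derivative on the torus
  have hslice : ContDiff ℝ 1 fun V => invDist k (E, V) := by
    refine contDiff_iff_contDiffAt.2 fun V => ?_
    have := ContDiffAt.comp (f := fun V => (E, V)) V (contDiffAt_invDist hE (h V))
      (contDiffAt_const.prodMk contDiffAt_id)
    exact this.of_le (by simp)
  have hsper : IsTorusPeriodic fun V => invDist k (E, V) := fun V i => by
    simp only [invDist, dist_periodic hE V i]
  have hfper : IsTorusPeriodic fun V => fderiv ℝ (invDist k) (E, V) (0, w) := by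
    intro V i
    simp only [← fderiv_snd_slice (hdiff _) w]
    have hc2 := (fderiv_comp_add_right (f := fun V => invDist k (E, V)) (x := V) (𝕜 := ℝ)
      (Pi.single i (2 * Real.pi))).symm
    rw [hc2]
    congr 2
    ext V
    exact hsper V i
  have hzero : ∫ v in torus, fderiv ℝ (invDist k) (E, Vh E + v) (0, w) = 0 := by
    rw [integral_torus_add_left (hc (0, w)) hfper (Vh E),
      ← integral_torus_fderiv_eq_zero hslice hsper w]
    congr 1
    ext V
    rw [fderiv_snd_slice (hdiff V) w]
  have hadd : Continuous fun v : Anomalies => Vh E + v := by fun_prop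
  have hI (u : TwoOrbit × Anomalies) :
      IntegrableOn (fun v => fderiv ℝ (invDist k) (E, Vh E + v) u) torus :=
    ((hc u).comp hadd).continuousOn.integrableOn_compact isCompact_torus
  rw [← integral_torus_add_left (hc (e, 0)) (hper e) (Vh E), ← integral_neg,
    ← add_zero (∫ v in torus, fderiv ℝ (invDist k) (E, Vh E + v) (e, 0)), ← hzero, ← integral_add (hI _) (hI _)]
  congr 1
  ext v
  rw [← map_add, fderiv_invDist hE (h _), fderiv_shiftedSq hE hV]
  simp only [shiftedSq, Prod.mk_add_mk, add_zero, zero_add, ← hw]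
  ring

theorem contDiffAt_indirect (hk : 0 < k) (hE : E ∈ domain) (V : Anomalies) :
    ContDiffAt ℝ ω (indirect k) (E, V) := by
  have hne := Delaunay.position_ne_zero hk hE.2 (V 1)
  exact ((contDiffAt_fst_position k hE V).inner ℝ (contDiffAt_snd_position k hE V)).div
    (((contDiffAt_snd_position k hE V).norm ℝ hne).pow 3)
    (pow_ne_zero 3 (norm_ne_zero_iff.2 hne))

/-- If the orbits do not meet, the average of the derivative of `R` exists. -/
theorem hasAverage_of_dist_ne_zero (hk : 0 < k) (μ : ℝ) (hE : E ∈ domain)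
    (h : ∀ V, dist k E V ≠ 0) (j : Fin 4) :
    HasAverage k μ j E (μ * k ^ 2 / (4 * Real.pi ^ 2) *
      ((∫ V in torus, fderiv ℝ (invDist k) (E, V) (yDir j, 0))
        - ∫ V in torus, fderiv ℝ (indirect k) (E, V) (yDir j, 0))) := by
  have hd1 (V : Anomalies) : DifferentiableAt ℝ (invDist k) (E, V) :=
    (contDiffAt_invDist hE (h V)).differentiableAt (by simp)
  have hd2 (V : Anomalies) : DifferentiableAt ℝ (indirect k) (E, V) :=
    (contDiffAt_indirect hk hE V).differentiableAt (by simp)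
  have hdR (V : Anomalies) : DifferentiableAt ℝ (fun E₁ => perturbing k μ E₁ V) E :=
    ((fderiv_fst_slice (hd1 V) 0).1.sub (fderiv_fst_slice (hd2 V) 0).1).const_mul (μ * k ^ 2)
  have hR (V : Anomalies) : partialY j (fun E₁ => perturbing k μ E₁ V) E = μ * k ^ 2 *
      (fderiv ℝ (invDist k) (E, V) (yDir j, 0) - fderiv ℝ (indirect k) (E, V) (yDir j, 0)) := by
    have h1 := fderiv_fst_slice (hd1 V) (yDir j)
    have h2 := fderiv_fst_slice (hd2 V) (yDir j)
    have h3 : HasFDerivAt (fun E₁ => perturbing k μ E₁ V) _ E :=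
      (h1.1.hasFDerivAt.sub h2.1.hasFDerivAt).const_mul (μ * k ^ 2)
    rw [partialY_eq (hdR V), h3.fderiv, ← h1.2, ← h2.2]
    simp
  have hc1 : IntegrableOn (fun V => fderiv ℝ (invDist k) (E, V) (yDir j, 0)) torus :=
    (continuous_fderiv_invDist hE h _).continuousOn.integrableOn_compact isCompact_torus
  have hc2 : IntegrableOn (fun V => fderiv ℝ (indirect k) (E, V) (yDir j, 0)) torus :=
    (continuous_slice (g := fun p => fderiv ℝ (indirect k) p (yDir j, 0)) fun V =>
      ((contDiffAt_indirect hk hE V).fderiv_omega.clm_apply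
        contDiffAt_const).continuousAt).continuousOn.integrableOn_compact isCompact_torus
  refine ⟨fun V => (hasDerivAt_comp_setY (hdR V) j).differentiableAt, ?_, ?_⟩
  · simp only [hR]
    exact (hc1.sub hc2).const_mul _
  · simp only [hR]
    rw [integral_const_mul, integral_sub hc1 hc2]
    ring

end TwoOrbit

/-! ### Lipschitz bounds on compact convex sets -/

theorem LipOn.of_contDiffAt {X : Type*} [NormedAddCommGroup X] [NormedSpace ℝ X] {K : Set X}
    {f : X → ℝ} (hK : IsCompact K) (hKc : Convex ℝ K) (hf : ∀ x ∈ K, ContDiffAt ℝ ω f x) :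
    LipOn f K ∧ ∃ M, ∀ x ∈ K, |f x| ≤ M := by
  have hc : ContDiffOn ℝ ω f K := fun x hx => (hf x hx).contDiffWithinAt
  exact ⟨LipOn.iff_lipschitzOnWith.2 (hc.exists_lipschitzOnWith (by simp) hKc hK),
    hK.exists_bound_of_continuousOn hc.continuousOn⟩

theorem LipOn.integral_torus {X : Type*} [NormedAddCommGroup X] [NormedSpace ℝ X] {K : Set X}
    {f : X × Anomalies → ℝ} (hK : IsCompact K) (hKc : Convex ℝ K)
    (hf : ∀ x ∈ K, ∀ v, ContDiffAt ℝ ω f (x, v)) :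
    LipOn (fun x => ∫ v in TwoOrbit.torus, f (x, v)) K := by
  obtain ⟨C, hC, h⟩ := exists_lipschitz_of_contDiffAt hK hKc hf
  have hi (x : X) (hx : x ∈ K) : IntegrableOn (fun v => f (x, v)) TwoOrbit.torus := by
    have : Continuous fun v => f (x, v) := continuous_iff_continuousAt.2 fun v =>
      (hf x hx v).continuousAt.comp (f := fun v => (x, v)) (by fun_prop)
    exact this.continuousOn.integrableOn_compact TwoOrbit.isCompact_torus
  refine ⟨C * volume.real TwoOrbit.torus, by positivity, fun x hx y hy => ?_⟩
  rw [← integral_sub (hi x hx) (hi y hy), ← Real.norm_eq_abs]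
  refine (norm_setIntegral_le_of_norm_le_const (C := C * dist x y)
    TwoOrbit.isCompact_torus.measure_lt_top fun v hv => ?_).trans (le_of_eq (by ring))
  have := h x hx y hy v hv v hv
  rwa [dist_self, max_eq_left dist_nonneg] at this

namespace TwoOrbit

/-! ### Branches of non-degenerate minimum points -/

/-- `Vh` is, at `E`, an analytic branch of critical points of `V ↦ d²(ℰ, V)` at which the tangent
vectors of the two trajectories are not parallel. -/
structure IsCriticalBranch (k : ℝ) (Vh : TwoOrbit → Anomalies) (E : TwoOrbit) : Prop where
  mem_domain : E ∈ domain
  contDiffAt : ContDiffAt ℝ ω Vh E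
  fderiv_eq_zero : ∀ w, fderiv ℝ (distSq k) (E, Vh E) (0, w) = 0
  tau3_ne_zero : tau3 k E (Vh E) ≠ 0

variable {k : ℝ} {E : TwoOrbit} {Vh : TwoOrbit → Anomalies}

/-- Existence of the branch through a non-degenerate crossing point. -/
theorem exists_isCriticalBranch (hE : E ∈ domain) {V : Anomalies} (h0 : delta k E V = 0)
    (hdet : (hessian k E V).det ≠ 0) :
    ∃ (Vh : TwoOrbit → Anomalies) (U : Set TwoOrbit), IsOpen U ∧ E ∈ U ∧ Vh E = V ∧
      ∀ E' ∈ U, IsCriticalBranch k Vh E' := by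
  have hcrit := (isCritical_iff k hE V).1 (isCritical_of_crossing k hE h0)
  obtain ⟨Vh, hV, rfl, hev⟩ := exists_critical_continuation k hE hcrit
    (secondV_pos_of_crossing k hE h0 hdet)
  have htau : ContinuousAt (fun E₁ => tau3 k E₁ (Vh E₁)) E :=
    ContinuousAt.comp (f := fun E₁ => (E₁, Vh E₁)) (contDiffAt_tau3 k hE (Vh E)).continuousAt
      (continuousAt_id.prodMk hV.continuousAt)
  have hall : ∀ᶠ E' in 𝓝 E, IsCriticalBranch k Vh E' := by
    filter_upwards [isOpen_domain.eventually_mem hE, hV.eventually (by simp), hev,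
      htau.eventually_ne (tau3_ne_zero_of_crossing k hE h0 hdet)] with E' h1 h2 h3 h4
    exact ⟨h1, h2, h3, h4⟩
  obtain ⟨U, hU, hUo, hEU⟩ := eventually_nhds_iff.1 hall
  exact ⟨Vh, U, hUo, hEU, rfl, hU⟩

namespace IsCriticalBranch

theorem signedDist_sq (h : IsCriticalBranch k Vh E) :
    signedDist k E (Vh E) ^ 2 = shiftedSq k Vh (E, 0) := by
  rw [TwoOrbit.signedDist_sq k h.mem_domain h.fderiv_eq_zero h.tau3_ne_zero, shiftedSq, distSq]
  simp

theorem contDiffAt_signedDist (h : IsCriticalBranch k Vh E) :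
    ContDiffAt ℝ ω (fun E₁ => signedDist k E₁ (Vh E₁)) E :=
  (hasFDerivAt_signedDist k h.mem_domain h.contDiffAt h.fderiv_eq_zero h.tau3_ne_zero).1

theorem fderiv_signedDist (h : IsCriticalBranch k Vh E) (e : TwoOrbit) :
    fderiv ℝ (fun E₁ => signedDist k E₁ (Vh E₁)) E e
      = inner ℝ (tau3Hat k E (Vh E)) (fderiv ℝ (jointDelta k) (E, Vh E) (e, 0)) :=
  (hasFDerivAt_signedDist k h.mem_domain h.contDiffAt h.fderiv_eq_zero h.tau3_ne_zero).2 e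

/-- The derivative of the squared minimum distance, which is the square of the signed distance. -/
theorem fderiv_shiftedSq_fst (h : IsCriticalBranch k Vh E) (e : TwoOrbit) :
    fderiv ℝ (shiftedSq k Vh) (E, 0) (e, 0) = 2 * (signedDist k E (Vh E)
      * fderiv ℝ (fun E₁ => signedDist k E₁ (Vh E₁)) E e) := by
  have hsplit (w : Anomalies) : ((e, w) : TwoOrbit × Anomalies) = (e, 0) + (0, w) := by simp
  rw [fderiv_shiftedSq h.mem_domain h.contDiffAt, add_zero, add_zero, hsplit, map_add,
    h.fderiv_eq_zero, add_zero, fderiv_distSq k h.mem_domain,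
    delta_eq_signedDist_smul k h.mem_domain h.fderiv_eq_zero h.tau3_ne_zero, real_inner_smul_left,
    h.fderiv_signedDist]

/-- If `P = d²` in centred coordinates does not exceed its values on the square `‖v‖ ≤ π`, the
branch consists of global minimum points. -/
theorem sq_signedDist_le (h : IsCriticalBranch k Vh E)
    (hmin : ∀ v ∈ torus, shiftedSq k Vh (E, 0) ≤ shiftedSq k Vh (E, v)) (V : Anomalies) :
    signedDist k E (Vh E) ^ 2 ≤ dist k E V ^ 2 := by
  obtain ⟨v, hv, hd⟩ := exists_torus_delta_eq k h.mem_domain V (Vh E)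
  have := hmin v hv
  rw [h.signedDist_sq]
  simp only [dist, hd]
  exact this

end IsCriticalBranch

theorem contDiffAt_matA (k : ℝ) (hE : E ∈ domain) (V : Anomalies) (i j : Fin 2) :
    ContDiffAt ℝ ω (fun p : TwoOrbit × Anomalies => matA k p.1 p.2 i j) (E, V) := by
  have hc := (((contDiffAt_distSq k hE V).fderiv_omega.fderiv_omega.clm_apply
    (contDiffAt_const (c := ((0 : TwoOrbit), (Pi.single i 1 : Anomalies))))).clm_apply
    (contDiffAt_const (c := ((0 : TwoOrbit), (Pi.single j 1 : Anomalies)))))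
  refine (contDiffAt_const.mul hc (f := fun _ => (1 / 2 : ℝ))).congr_of_eventuallyEq ?_
  have : ∀ᶠ q : TwoOrbit × Anomalies in 𝓝 (E, V), q.1 ∈ domain :=
    continuousAt_fst.eventually (isOpen_domain.eventually_mem hE)
  filter_upwards [this] with q hq
  rw [matA, Matrix.smul_apply, hessian_apply k hq, smul_eq_mul]

theorem contDiffAt_one_div_sqrt_det (k : ℝ) (hE : E ∈ domain) (hV : ContDiffAt ℝ ω Vh E)
    (hdet : 0 < (matA k E (Vh E)).det) :
    ContDiffAt ℝ ω (fun E₁ => 1 / Real.sqrt (matA k E₁ (Vh E₁)).det) E := by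
  have hA (i j : Fin 2) : ContDiffAt ℝ ω (fun E₁ => matA k E₁ (Vh E₁) i j) E :=
    ContDiffAt.comp (f := fun E₁ => (E₁, Vh E₁)) E (contDiffAt_matA k hE (Vh E) i j)
      (contDiffAt_id.prodMk hV)
  have hd : ContDiffAt ℝ ω (fun E₁ => (matA k E₁ (Vh E₁)).det) E := by
    simp only [Matrix.det_fin_two]
    exact ((hA 0 0).mul (hA 1 1)).sub ((hA 0 1).mul (hA 1 0))
  exact contDiffAt_const.div (hd.sqrt hdet.ne') (Real.sqrt_pos.2 hdet).ne'

/-! ### The two Lipschitz extensions of the averaged derivative -/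

/-- The average of the derivative of `1/d` in the direction `e`, corrected by `2π` times the
derivative of `|D| / √det 𝒜`, where `D` is the signed distance, is Lipschitz off the crossing
configurations. -/
theorem lipOn_integral_fderiv_invDist {K : Set TwoOrbit} (hK : IsCompact K) (hKc : Convex ℝ K)
    (hbr : ∀ E ∈ K, IsCriticalBranch k Vh E) {σ C : ℝ} {e : TwoOrbit}
    (hdet : ∀ E ∈ K, 0 < matA k E (Vh E) 0 0 ∧ 0 < (matA k E (Vh E)).det)
    (hd : ∀ E ∈ K, signedDist k E (Vh E) ≠ 0 → ∀ V, dist k E V ≠ 0)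
    (h : SingularFamily K (fun x v => shiftedSq k Vh (x, v) - shiftedSq k Vh (x, 0))
      (fun x v => 1 / 2 * secondV (shiftedSq k Vh) (x, 0) v)
      (fun x v => fderiv ℝ (shiftedSq k Vh) (x, v) (e, 0)
        - fderiv ℝ (shiftedSq k Vh) (x, 0) (e, 0)) σ C) :
    LipOn (fun E => (∫ V in torus, fderiv ℝ (invDist k) (E, V) (e, 0))
      + 2 * Real.pi * SignType.sign (signedDist k E (Vh E))
        * (fderiv ℝ (fun E₁ => 1 / Real.sqrt (matA k E₁ (Vh E₁)).det) E e
            * signedDist k E (Vh E)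
          + 1 / Real.sqrt (matA k E (Vh E)).det
            * fderiv ℝ (fun E₁ => signedDist k E₁ (Vh E₁)) E e))
      (K ∩ {E | signedDist k E (Vh E) ≠ 0}) := by
  set D : TwoOrbit → ℝ := fun E₁ => signedDist k E₁ (Vh E₁) with hDdef
  set B : TwoOrbit → ℝ := fun E₁ => 1 / Real.sqrt (matA k E₁ (Vh E₁)).det with hBdef
  have hDc (E : TwoOrbit) (hE : E ∈ K) : ContDiffAt ℝ ω D E := (hbr E hE).contDiffAt_signedDist
  have hBc (E : TwoOrbit) (hE : E ∈ K) : ContDiffAt ℝ ω B E :=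
    contDiffAt_one_div_sqrt_det k (hbr E hE).mem_domain (hbr E hE).contDiffAt (hdet E hE).2
  obtain ⟨hDl, M₁, hDb⟩ := LipOn.of_contDiffAt hK hKc hDc
  obtain ⟨hDl', M₂, hDb'⟩ := LipOn.of_contDiffAt hK hKc (f := fun E => fderiv ℝ D E e)
    fun E hE => (hDc E hE).fderiv_omega.clm_apply contDiffAt_const
  obtain ⟨hBl, -⟩ := LipOn.of_contDiffAt hK hKc hBc
  obtain ⟨hBl', N, hBb'⟩ := LipOn.of_contDiffAt hK hKc (f := fun E => fderiv ℝ B E e)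
    fun E hE => (hBc E hE).fderiv_omega.clm_apply contDiffAt_const
  have hreg := h.lipOn_regular_part (D := D) (D' := fun E => fderiv ℝ D E e)
    (κ := fun E => 2 * Real.pi * B E) (M := max M₁ M₂) hDl
    (fun E hE => (hDb E hE).trans (le_max_left _ _)) hDl'
    (fun E hE => (hDb' E hE).trans (le_max_right _ _)) (hBl.const_mul _) (by
      intro E hE c hc
      obtain ⟨ha, hdt⟩ := hdet E hE
      have hbE := hbr E hE
      rw [det_matA k hbE.mem_domain] at hdt
      have := integral_invCube_quadratic ha hdt hc
      simp only [secondV_shiftedSq hbE.mem_domain hbE.contDiffAt, secondV_distSq k hbE.mem_domain]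
      rw [this, hBdef]
      simp only [det_matA k hbE.mem_domain]
      ring)
  have habs : LipOn (fun E => 2 * Real.pi * (|D E| * fderiv ℝ B E e)) K :=
    (hDl.abs.mul hBl' (A := M₁) (B := N) (fun E hE => by rw [abs_abs]; exact hDb E hE)
      hBb').const_mul _
  refine (hreg.add (habs.mono Set.inter_subset_left)).congr fun E hE => ?_
  have hbE := hbr E hE.1
  have hint := integral_fderiv_invDist (k := k) hbE.mem_domain hbE.contDiffAt (hd E hE.1 hE.2) e
  have hsgn : (SignType.sign (D E) : ℝ) * D E = |D E| := sign_mul_self (D E)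
  -- `D²` and `2 D D'` are the value and the derivative of the shifted squared distance at `v = 0`
  have hrw : (∫ v in torus, (D E * fderiv ℝ D E e + 1 / 2 *
        (fderiv ℝ (shiftedSq k Vh) (E, v) (e, 0) - fderiv ℝ (shiftedSq k Vh) (E, 0) (e, 0)))
        * invCube (D E ^ 2 + (shiftedSq k Vh (E, v) - shiftedSq k Vh (E, 0))))
      = ∫ v in torus, 1 / 2 * fderiv ℝ (shiftedSq k Vh) (E, v) (e, 0)
          * invCube (shiftedSq k Vh (E, v)) := by
    refine integral_congr_ae (Filter.Eventually.of_forall fun v => ?_)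
    simp only [hbE.fderiv_shiftedSq_fst, hDdef, hbE.signedDist_sq]
    congr 2 <;> ring
  simp only [hrw, hint, ← hsgn]
  ring

/-- The averages on the two sides of the crossing configurations, when the branch `Vh` consists of
uniformly non-degenerate minimum points. -/
theorem exists_lipschitz_averages (hk : 0 < k) (μ : ℝ) {K : Set TwoOrbit} (hK : IsCompact K)
    (hKc : Convex ℝ K) (hbr : ∀ E ∈ K, IsCriticalBranch k Vh E) (j : Fin 4) {σ C : ℝ}
    (hdet : ∀ E ∈ K, 0 < matA k E (Vh E) 0 0 ∧ 0 < (matA k E (Vh E)).det)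
    (hd : ∀ E ∈ K, signedDist k E (Vh E) ≠ 0 → ∀ V, dist k E V ≠ 0)
    (h : SingularFamily K (fun x v => shiftedSq k Vh (x, v) - shiftedSq k Vh (x, 0))
      (fun x v => 1 / 2 * secondV (shiftedSq k Vh) (x, 0) v)
      (fun x v => fderiv ℝ (shiftedSq k Vh) (x, v) (yDir j, 0)
        - fderiv ℝ (shiftedSq k Vh) (x, 0) (yDir j, 0)) σ C) :
    ∃ Rplus Rminus : TwoOrbit → ℝ,
      (∃ L : NNReal, LipschitzOnWith L Rplus K) ∧ (∃ L : NNReal, LipschitzOnWith L Rminus K) ∧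
      (∀ E ∈ K, 0 < signedDist k E (Vh E) → HasAverage k μ j E (Rplus E)) ∧
      (∀ E ∈ K, signedDist k E (Vh E) < 0 → HasAverage k μ j E (Rminus E)) ∧
      ∀ E ∈ K, Rminus E - Rplus E = μ * k ^ 2 / Real.pi *
        (fderiv ℝ (fun E₁ => 1 / Real.sqrt (matA k E₁ (Vh E₁)).det) E (yDir j)
            * signedDist k E (Vh E)
          + 1 / Real.sqrt (matA k E (Vh E)).det
            * fderiv ℝ (fun E₁ => signedDist k E₁ (Vh E₁)) E (yDir j)) := by
  have hDc (E : TwoOrbit) (hE : E ∈ K) := (hbr E hE).contDiffAt_signedDist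
  have hBc (E : TwoOrbit) (hE : E ∈ K) :=
    contDiffAt_one_div_sqrt_det k (hbr E hE).mem_domain (hbr E hE).contDiffAt (hdet E hE).2
  obtain ⟨Lf, hLf⟩ := LipOn.iff_lipschitzOnWith.1
    (lipOn_integral_fderiv_invDist hK hKc hbr hdet hd h)
  -- Lipschitz extension across the crossing configurations, where the average is not defined
  obtain ⟨Φ, hΦ, hΦeq⟩ := hLf.extend_real
  have hΦl : LipOn Φ K := (LipOn.iff_lipschitzOnWith.2 ⟨Lf, hΦ.lipschitzOnWith⟩)
  have hind : LipOn (fun E => ∫ V in torus, fderiv ℝ (indirect k) (E, V) (yDir j, 0)) K :=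
    LipOn.integral_torus (f := fun p => fderiv ℝ (indirect k) p (yDir j, 0)) hK hKc
      fun E hE V => (contDiffAt_indirect hk (hbr E hE).mem_domain V).fderiv_omega.clm_apply
        contDiffAt_const
  set S : TwoOrbit → ℝ := fun E =>
    fderiv ℝ (fun E₁ => 1 / Real.sqrt (matA k E₁ (Vh E₁)).det) E (yDir j) * signedDist k E (Vh E)
      + 1 / Real.sqrt (matA k E (Vh E)).det
        * fderiv ℝ (fun E₁ => signedDist k E₁ (Vh E₁)) E (yDir j) with hS
  have hSl : LipOn S K := (LipOn.of_contDiffAt hK hKc fun E hE =>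
    (((hBc E hE).fderiv_omega.clm_apply contDiffAt_const).mul (hDc E hE)).add
      ((hBc E hE).mul ((hDc E hE).fderiv_omega.clm_apply contDiffAt_const))).1
  have hpi := Real.pi_ne_zero
  have hmid := (hΦl.sub hind).const_mul (μ * k ^ 2 / (4 * Real.pi ^ 2))
  -- where `±D > 0`, the correction removed from `Φ` is `±2π S`
  refine ⟨_, _, LipOn.iff_lipschitzOnWith.1
    (hmid.sub (hSl.const_mul (μ * k ^ 2 / (2 * Real.pi)))), LipOn.iff_lipschitzOnWith.1
    (hmid.add (hSl.const_mul (μ * k ^ 2 / (2 * Real.pi)))), fun E hE hpos => ?_,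
    fun E hE hneg => ?_, fun E hE => ?_⟩
  · have hav := hasAverage_of_dist_ne_zero hk μ (hbr E hE).mem_domain (hd E hE hpos.ne') j
    convert hav using 1
    rw [← hΦeq ⟨hE, hpos.ne'⟩]
    simp only [sign_pos hpos, SignType.coe_one, hS]
    field_simp
    ring
  · have hav := hasAverage_of_dist_ne_zero hk μ (hbr E hE).mem_domain (hd E hE hneg.ne) j
    convert hav using 1
    rw [← hΦeq ⟨hE, hneg.ne⟩]
    simp only [sign_neg hneg, SignType.coe_neg_one, hS]
    field_simp
    ring
  · simp only [hS]
    field_simp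
    ring

end TwoOrbit

/-- A centred fundamental domain of the torus contains no other crossing point. -/
theorem TwoOrbit.IsUniqueCrossing.dist_pos {k : ℝ} {E : TwoOrbit} {V : Anomalies}
    (h : TwoOrbit.IsUniqueCrossing k E V) {v : Anomalies} (hv : v ∈ TwoOrbit.torus) (hv0 : v ≠ 0) :
    0 < TwoOrbit.dist k E (V + v) := by
  refine lt_of_le_of_ne (norm_nonneg _) fun h0 => hv0 ?_
  obtain ⟨n, hn⟩ := h.2 _ h0.symm
  ext i
  have hi : v i = 2 * Real.pi * n i := by simpa using hn i
  have hb : |v i| ≤ Real.pi := (norm_le_pi_norm v i).trans (TwoOrbit.mem_torus_iff.1 hv)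
  have hpi := Real.pi_pos
  have hn0 : n i = 0 := by
    by_contra hne
    have h1 : (1 : ℝ) ≤ |(n i : ℝ)| := by exact_mod_cast Int.one_le_abs hne
    rw [hi, abs_mul, abs_of_pos (by positivity)] at hb
    nlinarith
  simp [hi, hn0]

theorem theorem1 (k μ : ℝ) (hk : 0 < k) (Ec : TwoOrbit) (hdom : Ec ∈ TwoOrbit.domain)
    (hnd : TwoOrbit.NonDegenerate k Ec)
    (Vc : Anomalies) (hcross : TwoOrbit.IsUniqueCrossing k Ec Vc) :
    ∃ (W : Set TwoOrbit) (Vh : TwoOrbit → Anomalies),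
      IsOpen W ∧ IsPreconnected W ∧ Ec ∈ W ∧ W ⊆ TwoOrbit.domain ∧
      -- the local minimum point `V_h` that continues the crossing point
      ContinuousOn Vh W ∧ Vh Ec = Vc ∧
      (∀ E ∈ W, IsLocalMin (fun V => TwoOrbit.dist k E V ^ 2) (Vh E)) ∧
      (∀ E ∈ W, 0 < (TwoOrbit.matA k E (Vh E)).det ∧ TwoOrbit.tau3 k E (Vh E) ≠ 0) ∧
      ∀ j : Fin 4,
        -- the derivatives in the formula of the jump exist
        (∀ E ∈ W,
          DifferentiableAt ℝ
            (fun s : ℝ => 1 / Real.sqrt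
              (TwoOrbit.matA k (TwoOrbit.setY j E s) (Vh (TwoOrbit.setY j E s))).det)
            (TwoOrbit.getY j E) ∧
          HasDerivAt
            (fun s : ℝ => TwoOrbit.signedDist k (TwoOrbit.setY j E s) (Vh (TwoOrbit.setY j E s)))
            (inner ℝ (TwoOrbit.tau3Hat k E (Vh E))
              (TwoOrbit.partialY j (fun E₁ => TwoOrbit.delta k E₁ (Vh E)) E))
            (TwoOrbit.getY j E)) ∧
        ∃ Rplus Rminus : TwoOrbit → ℝ,
          (∃ K : NNReal, LipschitzOnWith K Rplus W) ∧
          (∃ K : NNReal, LipschitzOnWith K Rminus W) ∧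
          (∀ E ∈ W, 0 < TwoOrbit.signedDist k E (Vh E) →
            TwoOrbit.HasAverage k μ j E (Rplus E)) ∧
          (∀ E ∈ W, TwoOrbit.signedDist k E (Vh E) < 0 →
            TwoOrbit.HasAverage k μ j E (Rminus E)) ∧
          ∀ E ∈ W, Rminus E - Rplus E =
            μ * k ^ 2 / Real.pi *
              (TwoOrbit.partialY j
                  (fun E₁ => 1 / Real.sqrt (TwoOrbit.matA k E₁ (Vh E₁)).det) E
                * TwoOrbit.signedDist k E (Vh E)
              + 1 / Real.sqrt (TwoOrbit.matA k E (Vh E)).det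
                * TwoOrbit.partialY j (fun E₁ => TwoOrbit.signedDist k E₁ (Vh E₁)) E) := by
  have h0 := TwoOrbit.delta_eq_zero_of_dist hcross.1
  have hdetc := hnd Vc (TwoOrbit.isCritical_of_crossing k hdom h0)
  obtain ⟨Vh, U, hU, hEU, hVc, hbr⟩ := TwoOrbit.exists_isCriticalBranch hdom h0 hdetc
  subst hVc
  have hbc := hbr Ec hEU
  obtain ⟨r, hr, hrU, σ, hfam⟩ := exists_singularFamily (P := TwoOrbit.shiftedSq k Vh) hU hEU
    (fun E hE v => TwoOrbit.contDiffAt_shiftedSq (hbr E hE).mem_domain (hbr E hE).contDiffAt v)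
    (fun E hE v => TwoOrbit.fderiv_shiftedSq_zero (hbr E hE).mem_domain (hbr E hE).contDiffAt
      (hbr E hE).fderiv_eq_zero v)
    (fun v hv hv0 => by
      have := hcross.dist_pos hv hv0
      simp only [TwoOrbit.shiftedSq, TwoOrbit.distSq, add_zero, hcross.1, zero_pow two_ne_zero]
      positivity)
    (fun v hv => by
      rw [TwoOrbit.secondV_shiftedSq hbc.mem_domain hbc.contDiffAt]
      exact TwoOrbit.secondV_pos_of_crossing k hdom h0 hdetc v hv)
  have hbK (E : TwoOrbit) (hE : E ∈ Metric.closedBall Ec r) := hbr E (hrU hE)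
  -- only the lower bounds are needed here, and these do not depend on the direction `e`
  have hmin (E : TwoOrbit) (hE : E ∈ Metric.closedBall Ec r) (v : Anomalies)
      (hv : v ∈ TwoOrbit.torus) :
      TwoOrbit.shiftedSq k Vh (E, 0) ≤ TwoOrbit.shiftedSq k Vh (E, v) := by
    obtain ⟨C, hC⟩ := hfam 0
    have h1 := hC.lower E hE v hv
    have h2 : 0 ≤ 2 * σ ^ 2 * ‖v‖ ^ 2 := by positivity
    linarith
  have hdet (E : TwoOrbit) (hE : E ∈ Metric.closedBall Ec r) :
      0 < TwoOrbit.matA k E (Vh E) 0 0 ∧ 0 < (TwoOrbit.matA k E (Vh E)).det := by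
    refine TwoOrbit.matA_pos k (hbK E hE).mem_domain (Vh E) fun w hw => ?_
    obtain ⟨C, hC⟩ := hfam 0
    have h1 := hC.lower_quad E hE w
    have hσ := hC.pos
    rw [TwoOrbit.secondV_shiftedSq (hbK E hE).mem_domain (hbK E hE).contDiffAt] at h1
    have h2 : 0 < 2 * σ ^ 2 * ‖w‖ ^ 2 := by
      have := norm_pos_iff.2 hw
      positivity
    linarith
  have hd (E : TwoOrbit) (hE : E ∈ Metric.closedBall Ec r)
      (hne : TwoOrbit.signedDist k E (Vh E) ≠ 0) (V : Anomalies) : TwoOrbit.dist k E V ≠ 0 := by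
    intro hz
    have h1 := (hbK E hE).sq_signedDist_le (hmin E hE) V
    have h2 : 0 < TwoOrbit.signedDist k E (Vh E) ^ 2 := by positivity
    rw [hz] at h1
    linarith
  have hsub : Metric.ball Ec r ⊆ Metric.closedBall Ec r := Metric.ball_subset_closedBall
  refine ⟨Metric.ball Ec r, Vh, Metric.isOpen_ball, (convex_ball Ec r).isPreconnected,
    Metric.mem_ball_self hr, fun E hE => (hbK E (hsub hE)).mem_domain,
    fun E hE => (hbK E (hsub hE)).contDiffAt.continuousAt.continuousWithinAt, rfl,
    fun E hE => Filter.Eventually.of_forall fun V => ?_,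
    fun E hE => ⟨(hdet E (hsub hE)).2, (hbK E (hsub hE)).tau3_ne_zero⟩, fun j =>
    ⟨fun E hE => ⟨?_, ?_⟩, ?_⟩⟩
  · have hb := hbK E (hsub hE)
    have := hb.sq_signedDist_le (hmin E (hsub hE)) V
    rwa [TwoOrbit.signedDist_sq k hb.mem_domain hb.fderiv_eq_zero hb.tau3_ne_zero] at this
  · have hb := hbK E (hsub hE)
    exact (TwoOrbit.hasDerivAt_comp_setY ((TwoOrbit.contDiffAt_one_div_sqrt_det k hb.mem_domain
      hb.contDiffAt (hdet E (hsub hE)).2).differentiableAt (by simp)) j).differentiableAt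
  · have hb := hbK E (hsub hE)
    have h1 := TwoOrbit.hasDerivAt_comp_setY
      (hb.contDiffAt_signedDist.differentiableAt (by simp)) j
    obtain ⟨h2, h3⟩ := TwoOrbit.fderiv_fst_slice ((TwoOrbit.contDiffAt_jointDelta k hb.mem_domain
      (Vh E)).differentiableAt (by simp)) (TwoOrbit.yDir j)
    rw [hb.fderiv_signedDist, ← h3, ← TwoOrbit.partialY_eq h2] at h1
    exact h1
  · obtain ⟨C, hC⟩ := hfam (TwoOrbit.yDir j)
    obtain ⟨Rp, Rm, ⟨Lp, hLp⟩, ⟨Lm, hLm⟩, hp, hm, hjump⟩ := TwoOrbit.exists_lipschitz_averages hk μ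
      (isCompact_closedBall Ec r) (convex_closedBall Ec r) hbK j hdet hd hC
    refine ⟨Rp, Rm, ⟨Lp, hLp.mono hsub⟩, ⟨Lm, hLm.mono hsub⟩, fun E hE => hp E (hsub hE),
      fun E hE => hm E (hsub hE), fun E hE => ?_⟩
    have hb := hbK E (hsub hE)
    rw [hjump E (hsub hE), TwoOrbit.partialY_eq (hb.contDiffAt_signedDist.differentiableAt
      (by simp)), TwoOrbit.partialY_eq ((TwoOrbit.contDiffAt_one_div_sqrt_det k hb.mem_domain
      hb.contDiffAt (hdet E (hsub hE)).2).differentiableAt (by simp))]
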